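/- **Theorem 1.** Let $(m_n)_{n\ge 1}$ be a sequence of non-negative integers. For every $n\ge 1$ let $P_{n1},\dots,P_{nn}$ be probability distributions on $\{0,1,\dots,m_n\}$, and let $S_n(v_1),\dots,S_n(v_n)$ be independent random subsets of $W_n=\{w_1,\dots,w_{m_n}\}$ with $$\mathbf P(S_n(v_i)=A)=\binom{m_n}{|A|}^{-1}P_{ni}(|A|)\qquad\text{for all } A\subseteq W_n,\ 1\le i\le n.$$ The random intersection graph $G_n=G(n,m_n,\mathbf P_n)$, where $\mathbf P_n=(P_{n1},\dots,P_{nn})$, has vertex set $V_n=\{v_1,\dots,v_n\}$; two distinct vertices $v_i,v_j$ are adjacent whenever $S_n(v_i)\cap S_n(v_j)\neq\emptyset$. Let $d(u,v)$ denote the graph distance in $G_n$ ($d(u,v)=\infty$ if $u$ and $v$ lie in different components), let $C_1\subseteq V_n$ denote the vertex set of a connected component of $G_n$ with the largest number of vertices, and put $\tilde Z_{ni}=|S_n(v_i)|\sqrt{n/m_n}$. A vertex $u\in V_n$ is called maximal if $|S_n(u)|=\max_{v\in V_n}|S_n(v)|$. Let $0<\alpha<1$ and $c_0,c_1,c_2>0$,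 and let $(\omega_n)$ be a sequence of positive numbers with $\omega_n\to+\infty$. Assume that (i) $n\ln^2 n=o(m_n)$ as $n\to\infty$; (ii) there is $n_0$ such that for all $n>n_0$, all $t\in[c_0,\,n^{1/(1+\alpha)}\omega_n]$ and all $i\in\{1,\dots,n\}$ $$c_1t^{-1-\alpha}\le \mathbf P(\tilde Z_{ni}>t)\le c_2t^{-1-\alpha}.$$ Let $(u_n)$ be a sequence of (random) vertices such that, for every $n$, $u_n\in V_n$ is maximal in $G_n$. Then for every $\varepsilon>0$, as $n\to\infty$, $$\mathbf P\Bigl(d(v_1,u_n)\le(1+\varepsilon)\,\frac{\ln\ln(2+n)}{\ln(1/\alpha)}\ \Bigm|\ d(v_1,u_n)<\infty\Bigr)\to 1,$$ $$\mathbf P\Bigl(d(v_1,v_2)\le(2+\varepsilon)\,\frac{\ln\ln(2+n)}{\ln(1/\alpha)}\ \Bigm|\ v_1,v_2\in C_1\Bigr)\to 1.$$ If several vertices are maximal, or several components have the largest size, any (measurable) choice of $u_n$ and of $C_1$ is allowed. -/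

import Mathlib

open Set Filter Topology MeasureTheory ProbabilityTheory
open scoped ENNReal

/-- The intersection graph of a family of finite sets: two distinct vertices `i`, `j` are adjacent
whenever `S i` and `S j` have a common element. -/
def intersectionGraph {V W : Type*} (S : V → Finset W) : SimpleGraph V where
  Adj i j := i ≠ j ∧ ∃ w, w ∈ S i ∧ w ∈ S j
  symm := ⟨fun _ _ h => ⟨h.1.symm, h.2.imp fun _ hw => ⟨hw.2, hw.1⟩⟩⟩
  loopless := ⟨fun _ h => h.1 rfl⟩

theorem card_lt_succ_of_finset_fin {m : ℕ} (A : Finset (Fin m)) : A.card < m + 1 :=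
  Nat.lt_succ_of_le ((Finset.card_le_univ A).trans_eq (Fintype.card_fin m))

/-- `S 0, …, S (n - 1)` are the random sets that define the random intersection graph
`G(n, m, P)`: they are independent random subsets of `{0, …, m - 1}` and
`ℙ(S i = A) = P i (|A|) / (m choose |A|)` for every `A`, where `P i` is a probability distribution
on `{0, …, m}` (the distribution of the size of `S i`). -/
structure IsRandomIntersectionModel {n m : ℕ} {Ω : Type*} [MeasurableSpace Ω] (μ : Measure Ω)
    (P : Fin n → PMF (Fin (m + 1))) (S : Fin n → Ω → Finset (Fin m)) : Prop where
  measurable : ∀ (i : Fin n) (A : Finset (Fin m)), MeasurableSet {ω | S i ω = A}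
  indep : iIndepFun (m := fun _ : Fin n => (⊤ : MeasurableSpace (Finset (Fin m)))) S μ
  law : ∀ (i : Fin n) (A : Finset (Fin m)),
    μ {ω | S i ω = A} = P i ⟨A.card, card_lt_succ_of_finset_fin A⟩ / (m.choose A.card : ℝ≥0∞)

/-- The normalized size `|A| √(n / m)` of a subset `A` of an `m`-element set. -/
noncomputable def normalizedSize (n : ℕ) {m : ℕ} (A : Finset (Fin m)) : ℝ :=
  (A.card : ℝ) * Real.sqrt ((n : ℝ) / (m : ℝ))

/-- `u` is a maximal vertex: its set has the largest size. -/
def IsMaximalVertex {V W : Type*} (S : V → Finset W) (u : V) : Prop :=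
  ∀ v : V, (S v).card ≤ (S u).card

/-- `C` is the vertex set of a connected component of `G` with the largest number of vertices. -/
def IsLargestComponent {V : Type*} (G : SimpleGraph V) (C : Set V) : Prop :=
  ∃ c : G.ConnectedComponent, c.supp = C ∧
    ∀ c' : G.ConnectedComponent, c'.supp.encard ≤ c.supp.encard

/-! Measure set sizes in units of R = √(m/n) and call the result the weight of a vertex. Sets of
weights s and t in a ground set of m elements meet with probability about st·R²/m = st/n, as long as
this is small. Hence a vertex of weight s has about s·t^(-α) neighbours of weight of order t. For t
= s^β with 1 < β < 1/α this number is s^(1-αβ), which grows with s. One can therefore climb through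
the weights L, L^β, L^(β²), …; the failure probabilities sum to about Σ exp(-c·L^(β^i(1-αβ))), which
is small once L is large, and about ln ln n / ln β steps suffice (`lmarginal_climb_le`,
`exists_sum_exp_level_le`).

The climb stops at weight n^γ, far below the maximum. With high probability the maximal weight
exceeds n^σ for a given σ < 1/(1+α), and all sets of weights at least n^γ and n^σ meet when γ + σ >
1, so one further edge leads to every maximal vertex (`edist_le_of_mem_typicalSets`). The condition
γ(1+β) < 1 keeps the linking probabilities small enough for the estimate st/n. The two demands on γ
are compatible exactly because αβ < 1 (`exists_exponents`).

It remains to reach weight L from a given vertex. Its component is explored vertex by vertex. The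
size has a tail of exponent 1+α > 1, so its truncated mean is of order R, and a newly found vertex
brings at least L·R fresh elements with probability at least 1 - r, where r < 1 does not depend on
n. A component with more than M vertices thus fails with probability at most r^M plus the climbing
error (`lmarginal_explore_le`), and in a component with at most M vertices all distances are at most
M. Together this gives `exists_far_from_maximal_le`.

Conditioning costs only a constant factor: with probability bounded below two given vertices have
large weight and are joined to the maximal vertices (`exists_le_reachable`), and a counting argument
puts the maximal vertices into every largest component (`eventually_largest_le`). Two vertices of
the largest component are then compared through a maximal vertex, which explains the factor 2.

No conditional law appears in the exploration. What is known about an unrevealed set is recorded by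
restricting its factor of the product measure, and `lmarginal_le_scan` is the resulting stopping
rule. -/

/-! ### Marginals of finite product measures -/

section Marginal

variable {V C : Type*} [DecidableEq V] [MeasurableSpace C]

theorem lmarginal_congr_measure {μ ν : V → Measure C} {U : Finset V} (h : ∀ i ∈ U, μ i = ν i)
    (f : (V → C) → ℝ≥0∞) (x : V → C) : lmarginal μ U f x = lmarginal ν U f x := by
  have : (fun i : U => μ i) = fun i : U => ν i := funext fun i => h i i.2
  simp only [lmarginal, this]

/-- A marginal with respect to restricted measures is controlled by the values of the integrand
on the product of the restricting sets. -/
theorem lmarginal_restrict_le {ν : V → Measure C} [∀ i, IsFiniteMeasure (ν i)]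
    {Γ : V → Set C} (hΓ : ∀ i, MeasurableSet (Γ i)) {U : Finset V} {f : (V → C) → ℝ≥0∞} {x : V → C}
    {c : ℝ≥0∞} (h : ∀ S, (∀ i ∉ U, S i = x i) → (∀ i ∈ U, S i ∈ Γ i) → f S ≤ c) :
    lmarginal (fun i => (ν i).restrict (Γ i)) U f x ≤ c * ∏ i ∈ U, ν i (Γ i) := by
  have h1 := Measure.restrict_pi_pi (fun i : U => ν i) (fun i : U => Γ i)
  simp only [lmarginal]
  rw [← h1]
  have hm : MeasurableSet (Set.pi univ fun i : U => Γ i) :=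
    MeasurableSet.univ_pi fun i => hΓ i
  calc _ ≤ ∫⁻ y in Set.pi univ fun i : U => Γ i, c ∂Measure.pi fun i : U => ν i := by
        refine setLIntegral_mono' hm fun y hy => h _ (fun i hi => ?_) fun i hi => ?_
        · simp [Function.updateFinset, hi]
        · simpa [Function.updateFinset, hi] using hy ⟨i, hi⟩ (mem_univ _)
    _ = c * ∏ i ∈ U, ν i (Γ i) := by
        rw [setLIntegral_const, Measure.pi_pi, Finset.prod_coe_sort U fun i => ν i (Γ i)]

theorem lmarginal_le_of_forall_le {ν : V → Measure C} [∀ i, IsFiniteMeasure (ν i)]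
    {U : Finset V} {f : (V → C) → ℝ≥0∞} {x : V → C}
    {c : ℝ≥0∞} (h : ∀ S, (∀ i ∉ U, S i = x i) → f S ≤ c) :
    lmarginal ν U f x ≤ c * ∏ i ∈ U, ν i univ := by
  simpa using lmarginal_restrict_le (ν := ν) (Γ := fun _ => univ) (fun _ => MeasurableSet.univ)
    (f := f) (U := U) (x := x) (c := c) fun S hS _ => h S hS

/-- Here the measures are unrestricted and it is the integrand that vanishes off the product set.
This keeps the factor ∏ ν i (Γ i) in front of the climbing error. -/
theorem lmarginal_le_of_support {ν : V → Measure C} [∀ i, IsFiniteMeasure (ν i)]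
    {Γ : V → Set C} (hΓ : ∀ i, MeasurableSet (Γ i)) {U : Finset V} {f : (V → C) → ℝ≥0∞} {x : V → C}
    {c : ℝ≥0∞} (h : ∀ S, (∀ i ∉ U, S i = x i) → (∀ i ∈ U, S i ∈ Γ i) → f S ≤ c)
    (h0 : ∀ S, (∀ i ∉ U, S i = x i) → (∃ i ∈ U, S i ∉ Γ i) → f S = 0) :
    lmarginal ν U f x ≤ c * ∏ i ∈ U, ν i (Γ i) := by
  simp only [lmarginal]
  have hm : MeasurableSet (Set.pi univ fun i : U => Γ i) :=
    MeasurableSet.univ_pi fun i => hΓ i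
  calc _ ≤ ∫⁻ y, (Set.pi univ fun i : U => Γ i).indicator (fun _ => c) y
          ∂Measure.pi fun i : U => ν i := by
        refine lintegral_mono fun y => ?_
        by_cases hy : y ∈ Set.pi univ fun i : U => Γ i
        · rw [indicator_of_mem hy]
          refine h _ (fun i hi => ?_) fun i hi => ?_
          · simp [Function.updateFinset, hi]
          · simpa [Function.updateFinset, hi] using hy ⟨i, hi⟩ (mem_univ _)
        · rw [h0 _ (fun i hi => ?_)]
          · exact zero_le
          · simp only [Set.mem_pi, mem_univ, true_implies, not_forall] at hy
            obtain ⟨i, hi⟩ := hy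
            exact ⟨i, i.2, by simpa [Function.updateFinset] using hi⟩
          · simp [Function.updateFinset, hi]
    _ = c * ∏ i ∈ U, ν i (Γ i) := by
        rw [lintegral_indicator hm, setLIntegral_const, Measure.pi_pi,
          Finset.prod_coe_sort U fun i => ν i (Γ i)]

/-- The family of measures in which the measures with index in `Q` are restricted to the
complements of the sets `Γ i`. -/
noncomputable def restrictOn (ν : V → Measure C) (Γ : V → Set C) (Q : Finset V) : V → Measure C :=
  fun i => if i ∈ Q then (ν i).restrict (Γ i)ᶜ else ν i

theorem restrictOn_of_mem {ν : V → Measure C} {Γ : V → Set C} {Q : Finset V} {i : V} (h : i ∈ Q) :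
    restrictOn ν Γ Q i = (ν i).restrict (Γ i)ᶜ := if_pos h

theorem restrictOn_of_notMem {ν : V → Measure C} {Γ : V → Set C} {Q : Finset V} {i : V}
    (h : i ∉ Q) : restrictOn ν Γ Q i = ν i := if_neg h

instance (ν : V → Measure C) [∀ i, IsFiniteMeasure (ν i)] (Γ : V → Set C) (Q : Finset V) (i : V) :
    IsFiniteMeasure (restrictOn ν Γ Q i) := by
  unfold restrictOn; split <;> infer_instance

/-- Look for an index `t ∈ U` whose coordinate lies in `Γ t`, one index after the other: the
marginal is controlled by the contribution of the event that such an index is found and by the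
contribution of the event that there is none. -/
theorem lmarginal_le_scan {ν : V → Measure C} [∀ i, IsFiniteMeasure (ν i)] {Γ : V → Set C}
    (hΓ : ∀ i, MeasurableSet (Γ i)) {f : (V → C) → ℝ≥0∞} (hf : Measurable f) {θ : ℝ≥0∞}
    {U : Finset V} {x : V → C}
    (h : ∀ t ∈ U, ∀ Q ⊆ U.erase t,
      ∫⁻ a in Γ t, lmarginal (restrictOn ν Γ Q) (U.erase t) f (Function.update x t a) ∂ν t
        ≤ θ * ν t (Γ t) * ∏ i ∈ U.erase t, restrictOn ν Γ Q i univ) :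
    lmarginal ν U f x ≤ θ * ∏ i ∈ U, ν i univ + lmarginal (restrictOn ν Γ U) U f x := by
  -- `R` is the set of indices still to be tested; those in `U \ R` were tested without success. The
  -- case `R = U` is the claim and `R = ∅` is the event that no index was found.
  suffices H : ∀ R ⊆ U, lmarginal (restrictOn ν Γ (U \ R)) U f x ≤
      θ * ∏ i ∈ U, restrictOn ν Γ (U \ R) i univ + lmarginal (restrictOn ν Γ U) U f x by
    have e : restrictOn ν Γ ∅ = ν := funext fun i => restrictOn_of_notMem (Finset.notMem_empty i)
    simpa [e] using H U Finset.Subset.rfl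
  intro R
  induction R using Finset.induction_on with
  | empty => intro _; simp
  | insert j R hj ih =>
    intro hR
    have hjU : j ∈ U := hR (Finset.mem_insert_self _ _)
    have ih := ih ((Finset.subset_insert _ _).trans hR)
    set Q := U \ insert j R with hQ
    have hQj : j ∉ Q := by simp [hQ]
    have hQ' : U \ R = insert j Q := by
      ext i; simp only [hQ, Finset.mem_sdiff, Finset.mem_insert]
      by_cases hij : i = j
      · subst hij; simp [hjU, hj]
      · simp [hij]
    have hcongr : ∀ i ∈ U.erase j, restrictOn ν Γ (U \ R) i = restrictOn ν Γ Q i := by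
      intro i hi
      have : i ≠ j := Finset.ne_of_mem_erase hi
      simp [restrictOn, hQ', this]
    have hprod : ∏ i ∈ U.erase j, restrictOn ν Γ (U \ R) i univ
        = ∏ i ∈ U.erase j, restrictOn ν Γ Q i univ :=
      Finset.prod_congr rfl fun i hi => by rw [hcongr i hi]
    -- Split the law of coordinate `j`: on `Γ j` the search stops and `h` applies, on the complement
    -- `j` joins the failed indices and the induction hypothesis applies. The two masses add up to
    -- `ν j univ`.
    rw [lmarginal_erase f hf hjU, ← Finset.mul_prod_erase U _ hjU, restrictOn_of_notMem hQj,
      ← lintegral_add_compl _ (hΓ j)]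
    rw [lmarginal_erase f hf hjU, ← Finset.mul_prod_erase U _ hjU,
      restrictOn_of_mem (by simp [hQ']), Measure.restrict_apply_univ, hprod] at ih
    have e2 : ∀ a, lmarginal (restrictOn ν Γ (U \ R)) (U.erase j) f (Function.update x j a)
        = lmarginal (restrictOn ν Γ Q) (U.erase j) f (Function.update x j a) :=
      fun a => lmarginal_congr_measure hcongr _ _
    simp only [e2] at ih
    calc _ ≤ θ * ν j (Γ j) * ∏ i ∈ U.erase j, restrictOn ν Γ Q i univ +
          (θ * (ν j (Γ j)ᶜ * ∏ i ∈ U.erase j, restrictOn ν Γ Q i univ) +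
            lmarginal (restrictOn ν Γ U) U f x) := by
          gcongr
          refine h j hjU Q fun i hi => Finset.mem_erase.2 ⟨?_, ?_⟩
          · rintro rfl; exact hQj hi
          · exact (Finset.mem_sdiff.1 hi).1
      _ = _ := by
          rw [← measure_add_measure_compl (hΓ j)]; ring

end Marginal

/-! ### Exploring an intersection graph -/

section Exploration

theorem edist_intersectionGraph_le_one {V W : Type*} {S : V → Finset W} {i j : V} {w : W}
    (hi : w ∈ S i) (hj : w ∈ S j) : (intersectionGraph S).edist i j ≤ 1 := by
  rw [SimpleGraph.edist_le_one_iff_adj_or_eq]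
  by_cases h : i = j
  · exact Or.inr h
  · exact Or.inl ⟨h, w, hi, hj⟩

/-- The sets that avoid `A`, meet `D` and have a size in `(a, b]`. -/
def linkSet {W : Type*} (A D : Finset W) (a b : ℝ) : Set (Finset W) :=
  {B | Disjoint B A ∧ ¬ Disjoint B D ∧ a < (B.card : ℝ) ∧ (B.card : ℝ) ≤ b}

variable {V W : Type*} [Fintype V] [DecidableEq V] [Finite W]
  [MeasurableSpace (Finset W)] [DiscreteMeasurableSpace (Finset W)]

/-- From a vertex with a set of size at least `lo k` one finds, level by level, vertices with sets
of sizes more than `lo (k + 1), …, lo K`. -/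
theorem lmarginal_climb_le {v : V} {N K N₀ : ℕ} {τ : ℝ} {f : (V → Finset W) → ℝ≥0∞}
    (hf1 : ∀ S, f S ≤ 1)
    (hf0 : ∀ S y, (intersectionGraph S).edist v y ≤ N → τ ≤ ((S y).card : ℝ) → f S = 0)
    {A : Finset W} {lo hi : ℕ → ℝ} {p : ℕ → ℝ≥0∞}
    (hlohi : ∀ i j, i < j → j ≤ K → hi i ≤ lo j) (hτ : τ ≤ lo K) (r : ℕ) :
    ∀ (k : ℕ), k + r = K → ∀ (ν : V → Measure (Finset W)) [∀ i, IsFiniteMeasure (ν i)]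
      (U : Finset V) (x : V → Finset W) (h : V) (D : Finset W) (d : ℕ),
      (∀ j ∈ U, ν j univ ≤ 1) →
      (∀ j ∈ U, ∀ i, k ≤ i → i < K → ∀ D : Finset W, Disjoint D A → lo i ≤ D.card →
        p i ≤ ν j (linkSet A D (lo (i + 1)) (hi (i + 1)))) →
      N₀ + r ≤ U.card → h ∉ U → D ⊆ x h → Disjoint D A → lo k ≤ D.card →
      (∀ S : V → Finset W, (∀ i ∉ U, S i = x i) → (intersectionGraph S).edist v h ≤ d) →
      d + r ≤ N →
      lmarginal ν U f x ≤ (∑ i ∈ Finset.Ico k K, (1 - p i) ^ N₀) * ∏ i ∈ U, ν i univ := by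
  induction r with
  | zero =>
    intro k hk ν _ U x h D d _ _ _ hh hDx _ hloD hd hdN
    have hk' : k = K := by omega
    subst hk'
    refine (lmarginal_le_of_forall_le (c := 0) fun S hS => ?_).trans (by simp)
    rw [hf0 S h ((hd S hS).trans (by exact_mod_cast hdN))]
    rw [hS h hh]
    exact hτ.trans (hloD.trans (by exact_mod_cast Finset.card_le_card hDx))
  | succ r ih =>
    intro k hk ν _ U x h D d hν1 hν hU hh hDx hDA hloD hd hdN
    -- Scan `U` for a vertex of level `k + 1` that is linked to `h` through `D`. If there is none,
    -- `f ≤ 1` and the remaining mass is at most `(1 - p k) ^ N₀` times the total mass.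
    set Γ : V → Set (Finset W) := fun _ => linkSet A D (lo (k + 1)) (hi (k + 1)) with hΓ
    have hΓm : ∀ i, MeasurableSet (Γ i) := fun i => MeasurableSet.of_discrete
    have hscan := lmarginal_le_scan (ν := ν) hΓm (f := f) Measurable.of_discrete
      (θ := ∑ i ∈ Finset.Ico (k + 1) K, (1 - p i) ^ N₀) (U := U) (x := x) ?_
    · refine hscan.trans ?_
      have hk' : k < K := by omega
      rw [← Finset.sum_Ico_consecutive _ (Nat.le_succ k) (Nat.succ_le_of_lt hk')]
      rw [Nat.Ico_succ_singleton, Finset.sum_singleton, add_comm, add_mul]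
      refine add_le_add ?_ le_rfl
      rw [lmarginal_congr_measure (ν := fun i => (ν i).restrict (Γ i)ᶜ)
        fun i hi => restrictOn_of_mem hi]
      refine (lmarginal_restrict_le (fun i => (hΓm i).compl) (c := 1)
        fun S _ _ => hf1 S).trans ?_
      rw [one_mul]
      have hfac : ∀ j ∈ U, ν j (Γ j)ᶜ ≤ (1 - p k) * ν j univ := by
        intro j hj
        rw [measure_compl (hΓm j) (measure_ne_top _ _),
          ENNReal.sub_mul fun _ _ => measure_ne_top _ _, one_mul]
        refine tsub_le_tsub_left ?_ _
        calc p k * ν j univ ≤ p k * 1 := by gcongr; exact hν1 j hj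
          _ ≤ _ := by rw [mul_one]; exact hν j hj k le_rfl hk' D hDA hloD
      calc ∏ i ∈ U, ν i (Γ i)ᶜ ≤ ∏ i ∈ U, ((1 - p k) * ν i univ) := Finset.prod_le_prod' hfac
        _ = (1 - p k) ^ U.card * ∏ i ∈ U, ν i univ := by
          rw [Finset.prod_mul_distrib, Finset.prod_const]
        _ ≤ _ := by
          gcongr ?_ * _
          exact pow_le_pow_of_le_one zero_le tsub_le_self (by omega)
    · intro t ht Q hQ
      have hth : h ≠ t := fun e => hh (e ▸ ht)
      calc _ ≤ ∫⁻ a in Γ t, (∑ i ∈ Finset.Ico (k + 1) K, (1 - p i) ^ N₀) *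
              ∏ i ∈ U.erase t, restrictOn ν Γ Q i univ ∂ν t := by
            refine setLIntegral_mono' (hΓm t) fun a ha => ?_
            have hat : Function.update x t a t = a := by simp
            refine ih (k + 1) (by omega) (restrictOn ν Γ Q) (U.erase t) (Function.update x t a) t a
              (d + 1) ?_ ?_ ?_ (by simp) (by simp) ha.1 ha.2.2.1.le ?_ (by omega)
            · intro j hj
              refine le_trans ?_ (hν1 j (Finset.mem_of_mem_erase hj))
              unfold restrictOn
              split
              · exact Measure.restrict_apply_le _ _
              · exact le_rfl
            · intro j hj i hki hiK D' hD' hlo'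
              refine (hν j (Finset.mem_of_mem_erase hj) i (by omega) hiK D' hD' hlo').trans ?_
              unfold restrictOn
              split
              -- Vertices rejected at this level remain fully usable higher up: the size windows of
              -- different levels are disjoint, so the restriction removes no set of a later window.
              · rw [Measure.restrict_apply MeasurableSet.of_discrete]
                refine measure_mono fun B hB => ⟨hB, fun hB' => ?_⟩
                have h1 := hB.2.2.1
                have h2 := hB'.2.2.2
                have h3 := hlohi (k + 1) (i + 1) (by omega) (by omega)
                linarith
              · exact le_rfl
            · rw [Finset.card_erase_of_mem ht]; omega
            · intro S hS
              have hSh : S h = x h := by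
                rw [hS h (fun hm => hh (Finset.mem_of_mem_erase hm))]; simp [hth]
              have hSt : S t = a := by rw [hS t (by simp)]; simp
              have hdS : (intersectionGraph S).edist v h ≤ d := by
                refine hd S fun i hi => ?_
                have hit : i ≠ t := by rintro rfl; exact hi ht
                rw [hS i (fun hm => hi (Finset.mem_of_mem_erase hm)), Function.update_of_ne hit]
              obtain ⟨w, hwa, hwD⟩ := Finset.not_disjoint_iff.1 ha.2.1
              refine (SimpleGraph.edist_triangle (v := h)).trans ?_
              push_cast
              exact add_le_add hdS (edist_intersectionGraph_le_one (w := w) (hSh ▸ hDx hwD)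
                (hSt ▸ hwa))
        _ = _ := by rw [setLIntegral_const]; ring


/-- One explores the component of `v` vertex by vertex. Each newly found vertex contributes, with
probability at least `1 - r`, at least `ℓ` new elements, and then one can climb from it. -/
theorem lmarginal_explore_le [DecidableEq W] {v : V} {M N K N₀ : ℕ} {τ ℓ : ℝ}
    {f : (V → Finset W) → ℝ≥0∞}
    (hf1 : ∀ S, f S ≤ 1)
    (hf0 : ∀ S y, (intersectionGraph S).edist v y ≤ N → τ ≤ ((S y).card : ℝ) → f S = 0)
    (hfM : ∀ S, {y | (intersectionGraph S).Reachable v y}.ncard ≤ M → f S = 0)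
    {lo hi : ℕ → ℝ} {p : ℕ → ℝ≥0∞}
    (hlohi : ∀ i j, i < j → j ≤ K → hi i ≤ lo j) (hτ : τ ≤ lo K) (hℓ : lo 0 ≤ ℓ) (hℓ0 : 0 ≤ ℓ)
    (hN : M + 1 + K ≤ N) (hcard : N₀ + K + M + 1 ≤ Fintype.card V)
    (ρ : V → Measure (Finset W)) [∀ i, IsFiniteMeasure (ρ i)] (hρ1 : ∀ i, ρ i univ ≤ 1)
    {r : ℝ≥0∞}
    (hgood : ∀ j, ∀ A B : Finset W, B ⊆ A → (A.card : ℝ) ≤ M * ℓ →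
      ρ j {S | Disjoint S B ∧ ¬ Disjoint S A ∧ ((S \ A).card : ℝ) < ℓ}
        ≤ r * ρ j {S | Disjoint S B ∧ ¬ Disjoint S A})
    (hlink : ∀ j, ∀ A : Finset W, (A.card : ℝ) ≤ M * ℓ → ∀ i < K, ∀ D : Finset W, Disjoint D A →
      lo i ≤ D.card → p i ≤ ρ j (linkSet A D (lo (i + 1)) (hi (i + 1))))
    (k : ℕ) : ∀ (T : Finset V) (A : Finset W) (B : V → Finset W) (x : V → Finset W),
      v ∈ T → T.card + k = M + 1 → A = T.biUnion x → (A.card : ℝ) ≤ T.card * ℓ →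
      (∀ j, B j ⊆ A) →
      (∀ S : V → Finset W, (∀ i ∈ T, S i = x i) →
        ∀ t ∈ T, (intersectionGraph S).edist v t ≤ T.card) →
      lmarginal (fun j => (ρ j).restrict {S | Disjoint S (B j)}) Tᶜ f x ≤
        (r ^ k + ∑ i ∈ Finset.Ico 0 K, (1 - p i) ^ N₀) *
          ∏ j ∈ Tᶜ, (ρ j).restrict {S | Disjoint S (B j)} univ := by
  set δ := ∑ i ∈ Finset.Ico 0 K, (1 - p i) ^ N₀ with hδ
  induction k with
  | zero =>
    intro T A B x _ _ _ _ _ _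
    refine (lmarginal_le_of_forall_le (c := 1) fun S _ => hf1 S).trans ?_
    -- After the last round the factor `r ^ 0 = 1` makes the bound trivial.
    gcongr
    rw [pow_zero]; exact le_self_add
  | succ k ih =>
    intro T A B x hvT hTk hA hAcard hBA hd
    have hTM : T.card ≤ M := by omega
    have hAM : (A.card : ℝ) ≤ M * ℓ :=
      hAcard.trans (by gcongr)
    set ν : V → Measure (Finset W) := fun j => (ρ j).restrict {S | Disjoint S (B j)} with hν
    -- `T` is the set of revealed vertices and `A` the union of their sets; the set of an unrevealed
    -- `j` is so far known to avoid `B j ⊆ A`. Search for an unrevealed vertex whose set meets `A`.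
    set Γ : V → Set (Finset W) := fun _ => {S | ¬ Disjoint S A} with hΓ
    have hΓm : ∀ i, MeasurableSet (Γ i) := fun i => MeasurableSet.of_discrete
    have hscan := lmarginal_le_scan (ν := ν) hΓm (f := f) Measurable.of_discrete
      (θ := r ^ (k + 1) + δ) (U := Tᶜ) (x := x) ?_
    · refine hscan.trans (le_of_eq ?_)
      convert add_zero _
      rw [lmarginal_congr_measure (ν := fun i => (ν i).restrict (Γ i)ᶜ)
        fun i hi => restrictOn_of_mem hi, ← nonpos_iff_eq_zero]
      refine (lmarginal_restrict_le (fun i => (hΓm i).compl) (c := 0)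
        fun S hSx hS => le_of_eq (hfM S ?_)).trans (by simp)
      -- If no unrevealed set meets `A`, no edge leaves `T`; the component of `v` then has at most
      -- `M` vertices and `f` vanishes.
      have hsub : {y | (intersectionGraph S).Reachable v y} ⊆ (T : Set V) := by
        rintro y ⟨w⟩
        have : ∀ a b (w : (intersectionGraph S).Walk a b), a ∈ T → b ∈ T := by
          intro a b w
          induction w with
          | nil => exact id
          | @cons a b c hab _ ihw =>
            intro ha
            apply ihw
            by_contra hb
            obtain ⟨_, e, hea, heb⟩ := hab
            have := hS b (Finset.mem_compl.2 hb)
            simp only [hΓ, mem_compl_iff, mem_ofPred_eq, not_not] at this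
            refine Finset.disjoint_left.1 this heb ?_
            rw [hA, Finset.mem_biUnion]
            exact ⟨a, ha, by rw [← hSx a (by simpa using ha)]; exact hea⟩
        exact this v y w hvT
      calc _ ≤ (T : Set V).ncard := Set.ncard_le_ncard hsub
        _ ≤ M := by rwa [Set.ncard_coe_finset]
    · intro t ht Q hQ
      have htT : t ∉ T := Finset.mem_compl.1 ht
      have hU : Tᶜ.erase t = (insert t T)ᶜ := by
        ext i; simp
      rw [hU] at hQ ⊢
      -- The vertices of `Q` were tested before `t` and their sets avoid all of `A`; about the
      -- others nothing new is known.
      set B' : V → Finset W := fun j => if j ∈ Q then A else B j with hB'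
      have hB'A : ∀ j, B' j ⊆ A := by
        intro j; simp only [hB']; split
        · exact Finset.Subset.rfl
        · exact hBA j
      have hν' : restrictOn ν Γ Q = fun j => (ρ j).restrict {S | Disjoint S (B' j)} := by
        funext j
        simp only [restrictOn, hB', hν]
        split
        · rw [Measure.restrict_restrict MeasurableSet.of_discrete]
          congr 1
          ext S
          simp only [hΓ, mem_inter_iff, mem_compl_iff, mem_ofPred_eq, not_not]
          exact ⟨fun h => h.1, fun h => ⟨h, h.mono_right (hBA j)⟩⟩
        · rfl
      set Y := ∏ i ∈ (insert t T)ᶜ, restrictOn ν Γ Q i univ with hY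
      have hnear : ∀ a ∈ Γ t, ∀ S : V → Finset W,
          (∀ i ∈ insert t T, S i = Function.update x t a i) →
          (∀ s ∈ insert t T, (intersectionGraph S).edist v s ≤ ((insert t T).card : ℕ)) := by
        intro a ha S hS
        have hSx : ∀ i ∈ T, S i = x i := fun i hi => by
          rw [hS i (Finset.mem_insert_of_mem hi), Function.update_of_ne]
          rintro rfl; exact htT hi
        have hSt : S t = a := by rw [hS t (Finset.mem_insert_self _ _)]; simp
        rw [Finset.card_insert_of_notMem htT]
        intro s hs
        rcases Finset.mem_insert.1 hs with rfl | hs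
        · obtain ⟨w, hwa, hwA⟩ := Finset.not_disjoint_iff.1 ha
          rw [hA, Finset.mem_biUnion] at hwA
          obtain ⟨t', ht', hw⟩ := hwA
          refine (SimpleGraph.edist_triangle (v := t')).trans ?_
          push_cast
          exact add_le_add (hd S hSx t' ht') (edist_intersectionGraph_le_one (w := w)
            (hSx t' ht' ▸ hw) (hSt ▸ hwa))
        · refine (hd S hSx s hs).trans ?_
          exact_mod_cast Nat.le_succ _
      -- With at least `ℓ` fresh elements one climbs from `a \ A`, with error `δ`. Otherwise the
      -- exploration continues with error `r ^ k + δ`. Since the second case has proportion at most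
      -- `r`, the total is `r ^ (k + 1) + δ`.
      calc _ ≤ ∫⁻ a in Γ t, (δ * Y + {S : Finset W | ((S \ A).card : ℝ) < ℓ}.indicator
              (fun _ => r ^ k * Y) a) ∂ν t := by
            refine setLIntegral_mono' (hΓm t) fun a ha => ?_
            by_cases hgd : ((a \ A).card : ℝ) < ℓ
            · rw [indicator_of_mem (by exact hgd), ← add_mul, add_comm, hY, hν']
              refine ih (insert t T) (A ∪ a) B' _ (Finset.mem_insert_of_mem hvT) ?_ ?_ ?_ ?_ ?_
              · rw [Finset.card_insert_of_notMem htT]; omega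
              · rw [Finset.biUnion_insert, Function.update_self, Finset.union_comm, hA]
                congr 1
                refine Finset.biUnion_congr rfl fun i hi => ?_
                rw [Function.update_of_ne]
                rintro rfl; exact htT hi
              · rw [Finset.card_insert_of_notMem htT, ← Finset.union_sdiff_self_eq_union,
                  Finset.card_union_of_disjoint Finset.disjoint_sdiff]
                push_cast
                linarith
              · exact fun j => (hB'A j).trans Finset.subset_union_left
              · exact hnear a ha
            · rw [indicator_of_notMem (by exact hgd), add_zero, hY, hδ]
              refine lmarginal_climb_le hf1 hf0 (A := A) hlohi hτ K 0 (by omega)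
                (restrictOn ν Γ Q) (insert t T)ᶜ (Function.update x t a) t (a \ A)
                (insert t T).card ?_ ?_ ?_ (by simp) (by simp) Finset.sdiff_disjoint ?_ ?_ ?_
              · intro j _
                rw [hν']
                exact (Measure.restrict_apply_le _ _).trans (hρ1 j)
              · intro j _ i _ hiK D hD hlo
                refine (hlink j A hAM i hiK D hD hlo).trans ?_
                simp only [hν']
                rw [Measure.restrict_apply MeasurableSet.of_discrete]
                -- Link sets avoid `A`, hence also `B' j`, so the recorded information does not
                -- reduce the linking probability.
                exact measure_mono fun C hC => ⟨hC, hC.1.mono_right (hB'A j)⟩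
              · rw [Finset.card_compl, Finset.card_insert_of_notMem htT]; omega
              · exact hℓ.trans (not_lt.1 hgd)
              · intro S hS
                refine hnear a ha S (fun i hi => hS i (by simpa only [Finset.mem_compl, not_not] using hi)) t
                  (Finset.mem_insert_self _ _)
              · rw [Finset.card_insert_of_notMem htT]; omega
        _ = δ * Y * ν t (Γ t) + r ^ k * Y * ν t ({S : Finset W | ((S \ A).card : ℝ) < ℓ} ∩ Γ t) := by
            have e : (ν t).restrict (Γ t) {S : Finset W | ((S \ A).card : ℝ) < ℓ} =
                ν t ({S : Finset W | ((S \ A).card : ℝ) < ℓ} ∩ Γ t) :=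
              Measure.restrict_apply MeasurableSet.of_discrete
            rw [lintegral_add_left measurable_const, setLIntegral_const,
              lintegral_indicator MeasurableSet.of_discrete, setLIntegral_const, e]
        _ ≤ δ * Y * ν t (Γ t) + r ^ k * Y * (r * ν t (Γ t)) := by
            have e1 : ν t ({S : Finset W | ((S \ A).card : ℝ) < ℓ} ∩ Γ t) =
                ρ t {S | Disjoint S (B t) ∧ ¬ Disjoint S A ∧ ((S \ A).card : ℝ) < ℓ} := by
              refine (Measure.restrict_apply MeasurableSet.of_discrete).trans ?_
              congr 1
              ext S
              exact ⟨fun h => ⟨h.2, h.1.2, h.1.1⟩, fun h => ⟨⟨h.2.2, h.2.1⟩, h.1⟩⟩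
            have e2 : ν t (Γ t) = ρ t {S | Disjoint S (B t) ∧ ¬ Disjoint S A} := by
              refine (Measure.restrict_apply MeasurableSet.of_discrete).trans ?_
              congr 1
              ext S
              exact and_comm
            rw [e1, e2]
            gcongr
            exact hgood t A (B t) (hBA t) hAM
        _ = _ := by ring

/-- The exploration bound for the product measure. -/
theorem lintegral_explore_le [DecidableEq W] {v : V} {M N K N₀ : ℕ} {τ ℓ : ℝ}
    {f : (V → Finset W) → ℝ≥0∞}
    (hf1 : ∀ S, f S ≤ 1)
    (hf0 : ∀ S y, (intersectionGraph S).edist v y ≤ N → τ ≤ ((S y).card : ℝ) → f S = 0)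
    (hfM : ∀ S, {y | (intersectionGraph S).Reachable v y}.ncard ≤ M → f S = 0)
    {lo hi : ℕ → ℝ} {p : ℕ → ℝ≥0∞}
    (hlohi : ∀ i j, i < j → j ≤ K → hi i ≤ lo j) (hτ : τ ≤ lo K) (hℓ : lo 0 ≤ ℓ) (hℓ0 : 0 ≤ ℓ)
    (hN : M + 1 + K ≤ N) (hcard : N₀ + K + M + 1 ≤ Fintype.card V)
    (ρ : V → Measure (Finset W)) [∀ i, IsFiniteMeasure (ρ i)] (hρ1 : ∀ i, ρ i univ ≤ 1)
    {r : ℝ≥0∞}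
    (hgood : ∀ j, ∀ A B : Finset W, B ⊆ A → (A.card : ℝ) ≤ M * ℓ →
      ρ j {S | Disjoint S B ∧ ¬ Disjoint S A ∧ ((S \ A).card : ℝ) < ℓ}
        ≤ r * ρ j {S | Disjoint S B ∧ ¬ Disjoint S A})
    (hlink : ∀ j, ∀ A : Finset W, (A.card : ℝ) ≤ M * ℓ → ∀ i < K, ∀ D : Finset W, Disjoint D A →
      lo i ≤ D.card → p i ≤ ρ j (linkSet A D (lo (i + 1)) (hi (i + 1)))) :
    ∫⁻ S, f S ∂Measure.pi ρ ≤ r ^ M + ∑ i ∈ Finset.Ico 0 K, (1 - p i) ^ N₀ := by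
  set δ := ∑ i ∈ Finset.Ico 0 K, (1 - p i) ^ N₀ with hδ
  have hU : (Finset.univ : Finset V).erase v = {v}ᶜ := by ext i; simp
  have hprod : ∀ ν : V → Measure (Finset W), (∀ i, ν i univ ≤ 1) →
      ∏ i ∈ ({v} : Finset V)ᶜ, ν i univ ≤ 1 := fun ν h => Finset.prod_le_one' fun i _ => h i
  rw [lintegral_eq_lmarginal_univ (fun _ => ∅), lmarginal_erase f Measurable.of_discrete
    (Finset.mem_univ v), hU]
  calc _ ≤ ∫⁻ _, (r ^ M + δ) ∂ρ v := by
        refine lintegral_mono fun a => ?_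
        by_cases ha : ℓ ≤ a.card
        · refine (lmarginal_climb_le hf1 hf0 (A := ∅) (N₀ := N₀) (p := p) hlohi hτ K 0 (by omega)
            ρ {v}ᶜ (Function.update (fun _ => ∅) v a) v a 0 (fun j _ => hρ1 j) ?_ ?_ (by simp)
            (by simp) (by simp) (hℓ.trans ha) (fun S _ => by simp) (by omega)).trans ?_
          · exact fun j _ i _ hiK D hD hlo => hlink j ∅ (by simp; positivity) i hiK D hD hlo
          · rw [Finset.card_compl, Finset.card_singleton]; omega
          · calc _ ≤ δ * 1 := by gcongr; exact hprod ρ hρ1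
              _ ≤ _ := by rw [mul_one]; exact le_add_self
        · have := lmarginal_explore_le hf1 hf0 hfM hlohi hτ hℓ hℓ0 hN hcard ρ hρ1 hgood hlink M
            {v} a (fun _ => ∅) (Function.update (fun _ => ∅) v a) (by simp) (by simp; omega)
            (by simp) (by simpa using (not_le.1 ha).le) (by simp) (fun S _ t ht => by
              rw [Finset.mem_singleton.1 ht]; simp)
          simp only [Finset.disjoint_empty_right, ofPred_true, Measure.restrict_univ] at this
          refine this.trans ?_
          calc _ ≤ (r ^ M + δ) * 1 := by gcongr; exact hprod ρ hρ1
            _ = _ := mul_one _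
    _ = (r ^ M + δ) * ρ v univ := lintegral_const _
    _ ≤ (r ^ M + δ) * 1 := by gcongr; exact hρ1 v
    _ = _ := mul_one _

/-- Climbing from a vertex of a given set `Q` of vertices with large sets. -/
theorem lintegral_climb_le {v : V} {N K N₀ : ℕ} {τ ℓ : ℝ} {f : (V → Finset W) → ℝ≥0∞}
    (hf1 : ∀ S, f S ≤ 1)
    (hf0 : ∀ S y, (intersectionGraph S).edist v y ≤ N → τ ≤ ((S y).card : ℝ) → f S = 0)
    {Q : Finset V} (hvQ : v ∈ Q) (hfQ : ∀ S, (∃ i ∈ Q, ¬ ℓ < ((S i).card : ℝ)) → f S = 0)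
    {lo hi : ℕ → ℝ} {p : ℕ → ℝ≥0∞}
    (hlohi : ∀ i j, i < j → j ≤ K → hi i ≤ lo j) (hτ : τ ≤ lo K) (hℓ : lo 0 ≤ ℓ)
    (hN : K ≤ N) (hcard : N₀ + K + Q.card ≤ Fintype.card V)
    (ρ : V → Measure (Finset W)) [∀ i, IsFiniteMeasure (ρ i)] (hρ1 : ∀ i, ρ i univ ≤ 1)
    (hlink : ∀ j, ∀ i < K, ∀ D : Finset W,
      lo i ≤ D.card → p i ≤ ρ j (linkSet ∅ D (lo (i + 1)) (hi (i + 1)))) :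
    ∫⁻ S, f S ∂Measure.pi ρ ≤ (∑ i ∈ Finset.Ico 0 K, (1 - p i) ^ N₀) *
      ∏ i ∈ Q, ρ i {S | ℓ < (S.card : ℝ)} := by
  set δ := ∑ i ∈ Finset.Ico 0 K, (1 - p i) ^ N₀ with hδ
  rw [lintegral_eq_lmarginal_univ (fun _ => ∅), ← Finset.union_compl Q,
    lmarginal_union ρ f Measurable.of_discrete disjoint_compl_right]
  have key : ∀ S : V → Finset W, lmarginal ρ Qᶜ f S ≤ δ := by
    intro S
    by_cases hS : ∃ i ∈ Q, ¬ ℓ < ((S i).card : ℝ)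
    · refine (lmarginal_le_of_forall_le (c := 0) fun S' hS' => ?_).trans (by simp)
      obtain ⟨i, hi, h⟩ := hS
      rw [hfQ S' ⟨i, hi, by rwa [hS' i (by simpa using hi)]⟩]
    · push Not at hS
      refine (lmarginal_climb_le hf1 hf0 (A := ∅) (N₀ := N₀) (p := p) hlohi hτ K 0 (by omega)
        ρ Qᶜ S v (S v) 0 (fun j _ => hρ1 j) (fun j _ i _ hiK D _ hlo => hlink j i hiK D hlo) ?_
        (by simpa using hvQ) Finset.Subset.rfl (by simp) (hℓ.trans (hS v hvQ).le)
        (fun S _ => by simp) (by omega)).trans ?_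
      · rw [Finset.card_compl]; omega
      · calc _ ≤ δ * 1 := by gcongr; exact Finset.prod_le_one' fun i _ => hρ1 i
          _ = _ := mul_one _
  refine lmarginal_le_of_support (ν := ρ) (Γ := fun _ => {S | ℓ < (S.card : ℝ)})
    (fun _ => MeasurableSet.of_discrete) (fun S _ _ => key S) fun S _ hS => ?_
  rw [← nonpos_iff_eq_zero]
  refine (lmarginal_le_of_forall_le (c := 0) fun S' hS' => ?_).trans (by simp)
  obtain ⟨i, hi, h⟩ := hS
  rw [hfQ S' ⟨i, hi, by rwa [hS' i (by simpa using hi)]⟩]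

end Exploration

/-! ### Uniform random sets of a given size -/

section UniformSets

variable {W : Type*} [Fintype W] [DecidableEq W]

theorem card_filter_mem_powersetCard (a : W) (x : ℕ) :
    (((Finset.univ.powersetCard x).filter fun S : Finset W => a ∈ S).card : ℝ) * Fintype.card W
      = x * (Fintype.card W).choose x := by
  rcases x with _ | x
  · simp
  have h : ((Finset.univ.powersetCard (x + 1)).filter fun S : Finset W => a ∈ S).card
      = (Fintype.card W - 1).choose x := by
    have := Finset.card_filter_powersetCard_subset {a} (Finset.univ : Finset W) (x + 1) (by simp)
      (by simp)
    simpa [Finset.card_univ] using this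
  obtain ⟨m, hm⟩ : ∃ m, Fintype.card W = m + 1 :=
    ⟨Fintype.card W - 1, (Nat.succ_pred_eq_of_pos (Fintype.card_pos_iff.2 ⟨a⟩)).symm⟩
  rw [h, hm]
  have := Nat.add_one_mul_choose_eq m x
  rw [Nat.add_sub_cancel]
  have h2 : ((m + 1 : ℕ) : ℝ) * (m.choose x : ℝ) = ((m + 1).choose (x + 1) : ℝ) * ((x + 1 : ℕ) : ℝ) := by
    exact_mod_cast this
  linarith

/-- The exact proportion is x(x-1)/(M(M-1)) for a ground set of M elements, at most (x/M)² when x ≤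
M: two given elements are negatively correlated. -/
theorem card_filter_mem_mem_powersetCard_le {a b : W} (hab : a ≠ b) (x : ℕ) :
    (((Finset.univ.powersetCard x).filter fun S : Finset W => a ∈ S ∧ b ∈ S).card : ℝ)
      * (Fintype.card W : ℝ) ^ 2 ≤ (x : ℝ) ^ 2 * (Fintype.card W).choose x := by
  by_cases hx : x < 2
  · have : ((Finset.univ.powersetCard x).filter fun S : Finset W => a ∈ S ∧ b ∈ S) = ∅ := by
      rw [Finset.filter_eq_empty_iff]
      intro S hS hab'
      have h2 : ({a, b} : Finset W) ⊆ S := by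
        intro c hc; rw [Finset.mem_insert, Finset.mem_singleton] at hc
        rcases hc with rfl | rfl
        · exact hab'.1
        · exact hab'.2
      have := Finset.card_le_card h2
      rw [Finset.card_pair hab, (Finset.mem_powersetCard.1 hS).2] at this
      omega
    rw [this]; simp; positivity
  obtain ⟨x, rfl⟩ : ∃ y, x = y + 2 := ⟨x - 2, by omega⟩
  have h := Finset.card_filter_powersetCard_subset {a, b} (Finset.univ : Finset W) (x + 2) (by simp)
    (by rw [Finset.card_pair hab]; omega)
  have h' : ((Finset.univ.powersetCard (x + 2)).filter fun S : Finset W => a ∈ S ∧ b ∈ S).card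
      = (Fintype.card W - 2).choose x := by
    rw [Finset.card_pair hab, Finset.card_univ, Nat.add_sub_cancel] at h
    rw [← h]
    congr 1
    ext S
    simp [Finset.insert_subset_iff]
  have hm2 : 2 ≤ Fintype.card W := by
    have := Finset.card_le_univ ({a, b} : Finset W)
    rwa [Finset.card_pair hab] at this
  obtain ⟨m, hm⟩ : ∃ m, Fintype.card W = m + 2 := ⟨Fintype.card W - 2, by omega⟩
  rw [h', hm, Nat.add_sub_cancel]
  have e1 : ((m : ℝ) + 1) * (m.choose x : ℝ) = ((m + 1).choose (x + 1) : ℝ) * ((x : ℝ) + 1) := by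
    exact_mod_cast Nat.add_one_mul_choose_eq m x
  have e2 : ((m : ℝ) + 2) * ((m + 1).choose (x + 1) : ℝ) =
      ((m + 2).choose (x + 2) : ℝ) * ((x : ℝ) + 2) := by
    exact_mod_cast Nat.add_one_mul_choose_eq (m + 1) (x + 1)
  push_cast
  set p : ℝ := (m.choose x : ℝ)
  set q : ℝ := ((m + 1).choose (x + 1) : ℝ)
  set r : ℝ := ((m + 2).choose (x + 2) : ℝ)
  have hq : 0 ≤ q := by positivity
  have hr : 0 ≤ r := by positivity
  by_cases hxm : m < x
  · have : p = 0 := by simp only [p]; exact_mod_cast Nat.choose_eq_zero_of_lt hxm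
    rw [this]; nlinarith [mul_nonneg (sq_nonneg ((x : ℝ) + 2)) hr]
  have hxm' : (x : ℝ) ≤ m := by exact_mod_cast not_lt.1 hxm
  have hm0 : (0 : ℝ) ≤ m := by positivity
  have hx0 : (0 : ℝ) ≤ x := by positivity
  have e3 : p * ((m : ℝ) + 2) * (m + 1) = r * (x + 2) * (x + 1) := by
    linear_combination (m + 2 : ℝ) * e1 + (x + 1 : ℝ) * e2
  have e4 : ((x : ℝ) + 1) * (m + 2) ≤ (x + 2) * (m + 1) := by nlinarith
  have : (p * ((m : ℝ) + 2) ^ 2) * (m + 1) ≤ ((x + 2 : ℝ) ^ 2 * r) * (m + 1) := by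
    calc (p * ((m : ℝ) + 2) ^ 2) * (m + 1) = r * (x + 2) * ((x + 1) * (m + 2)) := by
          linear_combination (m + 2 : ℝ) * e3
      _ ≤ r * (x + 2) * ((x + 2) * (m + 1)) := by gcongr
      _ = _ := by ring
  exact le_of_mul_le_mul_right this (by positivity)

/-- Most sets of size `x` that meet a small set `D` meet `D` in one element and avoid another small
set `A`. -/
theorem card_filter_inter_card_eq_one_ge {D A : Finset W} (hDA : Disjoint D A) {x : ℕ}
    (hx : 2 * ((D.card + A.card) * (x : ℝ)) ≤ Fintype.card W) :
    (D.card : ℝ) * x * (Fintype.card W).choose x ≤ 2 * Fintype.card W *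
      ((Finset.univ.powersetCard x).filter fun S : Finset W =>
        (S ∩ D).card = 1 ∧ Disjoint S A).card := by
  set F := (Finset.univ : Finset W).powersetCard x with hF
  set m : ℝ := (Fintype.card W : ℝ) with hm
  set c : ℝ := ((Fintype.card W).choose x : ℝ) with hc
  rcases D.eq_empty_or_nonempty with rfl | ⟨a0, ha0⟩
  · simp
  have hm0 : 0 < m := by
    have : 0 < Fintype.card W := Fintype.card_pos_iff.2 ⟨a0⟩
    positivity
  -- A Bonferroni-type inequality: the left side equals |S ∩ D|·(2 - |S ∩ (D ∪ A)|), which is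
  -- positive only if `S` meets `D ∪ A` in a single element, lying in `D`.
  have point : ∀ S : Finset W, (∑ a ∈ D, ((if a ∈ S then (1 : ℝ) else 0)
      - ∑ b ∈ (D ∪ A).erase a, if a ∈ S ∧ b ∈ S then (1 : ℝ) else 0))
      ≤ if (S ∩ D).card = 1 ∧ Disjoint S A then 1 else 0 := by
    intro S
    have e1 : ∀ a ∈ D, ((if a ∈ S then (1 : ℝ) else 0)
        - ∑ b ∈ (D ∪ A).erase a, if a ∈ S ∧ b ∈ S then (1 : ℝ) else 0)
        = if a ∈ S then 2 - ((S ∩ (D ∪ A)).card : ℝ) else 0 := by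
      intro a ha
      by_cases haS : a ∈ S
      · simp only [haS, if_true, true_and]
        rw [Finset.sum_ite_mem, Finset.sum_const, nsmul_eq_mul, mul_one]
        have : (D ∪ A).erase a ∩ S = (S ∩ (D ∪ A)).erase a := by
          ext b; simp; tauto
        rw [this, Finset.cast_card_erase_of_mem (by simp [haS, ha])]
        ring
      · simp [haS]
    rw [Finset.sum_congr rfl e1, Finset.sum_ite_mem, Finset.sum_const, nsmul_eq_mul]
    rw [Finset.inter_comm D S]
    have h1 : (S ∩ D).card ≤ (S ∩ (D ∪ A)).card :=
      Finset.card_le_card (Finset.inter_subset_inter_left Finset.subset_union_left)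
    by_cases h0 : (S ∩ D).card = 0
    · rw [h0]; simp
    by_cases h2 : 2 ≤ (S ∩ (D ∪ A)).card
    · have h2' : (2 : ℝ) ≤ ((S ∩ (D ∪ A)).card : ℝ) := by exact_mod_cast h2
      have : ((S ∩ D).card : ℝ) * (2 - ((S ∩ (D ∪ A)).card : ℝ)) ≤ 0 :=
        mul_nonpos_of_nonneg_of_nonpos (by positivity) (by linarith)
      refine this.trans ?_
      split <;> norm_num
    · have h3 : (S ∩ D).card = 1 := by omega
      have h4 : (S ∩ (D ∪ A)).card = 1 := by omega
      have h5 : Disjoint S A := by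
        rw [Finset.inter_union_distrib_left, Finset.card_union_of_disjoint] at h4
        · rw [Finset.disjoint_iff_inter_eq_empty, ← Finset.card_eq_zero]; omega
        · exact hDA.mono Finset.inter_subset_right Finset.inter_subset_right
      rw [if_pos ⟨h3, h5⟩, h3, h4]; norm_num
  have hsum := Finset.sum_le_sum fun S (_ : S ∈ F) => point S
  rw [Finset.sum_boole, Finset.sum_comm] at hsum
  have lower : ∀ a ∈ D, x * c / m - (D.card + A.card) * ((x : ℝ) ^ 2 * c / m ^ 2) ≤
      ∑ S ∈ F, ((if a ∈ S then (1 : ℝ) else 0)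
        - ∑ b ∈ (D ∪ A).erase a, if a ∈ S ∧ b ∈ S then (1 : ℝ) else 0) := by
    intro a ha
    rw [Finset.sum_sub_distrib, Finset.sum_boole, Finset.sum_comm]
    refine sub_le_sub (le_of_eq ?_) ?_
    · rw [div_eq_iff hm0.ne']; exact (card_filter_mem_powersetCard a x).symm
    · calc _ ≤ ∑ b ∈ (D ∪ A).erase a, (x : ℝ) ^ 2 * c / m ^ 2 := by
            refine Finset.sum_le_sum fun b hb => ?_
            rw [Finset.sum_boole, le_div_iff₀ (by positivity)]
            exact card_filter_mem_mem_powersetCard_le (Finset.ne_of_mem_erase hb).symm x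
        _ ≤ _ := by
            rw [Finset.sum_const, nsmul_eq_mul]
            gcongr
            calc (((D ∪ A).erase a).card : ℝ) ≤ (D ∪ A).card := by
                  exact_mod_cast Finset.card_erase_le
              _ ≤ _ := by exact_mod_cast Finset.card_union_le _ _
  have h1 := (Finset.sum_le_sum lower).trans hsum
  rw [Finset.sum_const, nsmul_eq_mul] at h1
  -- By `hx` the pairs cost at most half of the first moment.
  have h2 : x * c / m - (D.card + A.card) * ((x : ℝ) ^ 2 * c / m ^ 2) ≥ x * c / (2 * m) := by
    have : x * c / m - (D.card + A.card) * ((x : ℝ) ^ 2 * c / m ^ 2) - x * c / (2 * m)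
        = (x * c / (2 * m ^ 2)) * (m - 2 * ((D.card + A.card) * x)) := by
      field_simp; ring
    have h3 : 0 ≤ (x * c / (2 * m ^ 2)) * (m - 2 * ((D.card + A.card) * x)) :=
      mul_nonneg (by positivity) (by linarith)
    linarith
  have h4 : (D.card : ℝ) * (x * c / (2 * m)) ≤ _ := (mul_le_mul_of_nonneg_left h2 (by positivity)).trans h1
  have h5 := mul_le_mul_of_nonneg_left h4 (show 0 ≤ 2 * m by positivity)
  calc _ = 2 * m * ((D.card : ℝ) * (x * c / (2 * m))) := by field_simp
    _ ≤ _ := h5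

/-- Drawing without replacement avoids `a` marked elements at most as often as drawing with
replacement, because (m-a-y)/(m-y) ≤ (m-a)/m in every draw. Truncated subtraction makes the left
side vanish when fewer than `y` elements are left. -/
theorem choose_sub_mul_pow_le (m a y : ℕ) :
    (m - a).choose y * m ^ y ≤ (m - a) ^ y * m.choose y := by
  induction y with
  | zero => simp
  | succ y ih =>
    refine Nat.le_of_mul_le_mul_right ?_ (Nat.succ_pos y)
    have h : (m - a - y) * m ≤ (m - a) * (m - y) := by
      rcases le_or_gt (a + y) m with h | h
      · obtain ⟨k, rfl⟩ := Nat.exists_eq_add_of_le h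
        have e1 : a + y + k - a - y = k := by omega
        have e2 : a + y + k - a = y + k := by omega
        have e3 : a + y + k - y = a + k := by omega
        rw [e1, e2, e3]; nlinarith [Nat.zero_le (y * a)]
      · have : m - a - y = 0 := by omega
        rw [this]; simp
    calc (m - a).choose (y + 1) * m ^ (y + 1) * (y + 1)
        = ((m - a).choose (y + 1) * (y + 1)) * m ^ (y + 1) := by ring
      _ = ((m - a).choose y * m ^ y) * ((m - a - y) * m) := by
          rw [Nat.choose_succ_right_eq]; ring
      _ ≤ ((m - a) ^ y * m.choose y) * ((m - a) * (m - y)) := Nat.mul_le_mul ih h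
      _ = (m - a) ^ (y + 1) * (m.choose y * (m - y)) := by ring
      _ = (m - a) ^ (y + 1) * m.choose (y + 1) * (y + 1) := by
          rw [← Nat.choose_succ_right_eq]; ring

theorem choose_sub_le_exp (m a y : ℕ) :
    ((m - a).choose y : ℝ) ≤ Real.exp (-(a * y / m)) * m.choose y := by
  rcases Nat.eq_zero_or_pos m with rfl | hm
  · simp
  have hm' : (0 : ℝ) < m := by exact_mod_cast hm
  have h : ((m - a).choose y : ℝ) * (m : ℝ) ^ y ≤ ((m - a : ℕ) : ℝ) ^ y * m.choose y := by
    exact_mod_cast choose_sub_mul_pow_le m a y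
  rw [← le_div_iff₀ (by positivity)] at h
  refine h.trans ?_
  rw [mul_comm, mul_div_assoc, ← div_pow, mul_comm]
  gcongr
  by_cases hy : y = 0
  · subst hy; simp
  by_cases ham : a ≤ m
  · rw [Nat.cast_sub ham, sub_div, div_self hm'.ne']
    have e : Real.exp (-(a * y / m)) = Real.exp (-(a / m)) ^ y := by
      rw [← Real.exp_nat_mul]; congr 1; ring
    rw [e]
    have h1 : (a : ℝ) / m ≤ 1 := by rw [div_le_one hm']; exact_mod_cast ham
    refine pow_le_pow_left₀ (by linarith) ?_ y
    have := Real.add_one_le_exp (-((a : ℝ) / m))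
    linarith
  · rw [Nat.sub_eq_zero_of_le (by omega)]
    simp [hy]
    positivity

theorem card_filter_disjoint_powersetCard_le (A : Finset W) (y : ℕ) :
    (((Finset.univ.powersetCard y).filter fun S : Finset W => Disjoint S A).card : ℝ)
      ≤ Real.exp (-(A.card * y / Fintype.card W)) * (Fintype.card W).choose y := by
  have : ((Finset.univ.powersetCard y).filter fun S : Finset W => Disjoint S A)
      = Aᶜ.powersetCard y := by
    ext S
    simp only [Finset.mem_filter, Finset.mem_powersetCard, Finset.subset_univ, true_and]
    rw [and_comm, Finset.subset_compl_iff_disjoint_right]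
  rw [this, Finset.card_powersetCard, Finset.card_compl]
  exact choose_sub_le_exp _ _ _

variable [MeasurableSpace (Finset W)] [DiscreteMeasurableSpace (Finset W)]

omit [DecidableEq W] in
/-- Under a measure that gives the same mass to sets of the same size, the sets of a given size are
equally likely. -/
theorem measureReal_and_card_eq {ν : Measure (Finset W)} [IsFiniteMeasure ν]
    (hν : ∀ A B : Finset W, A.card = B.card → ν {A} = ν {B}) (p : Finset W → Prop)
    [DecidablePred p] (x : ℕ) :
    ν.real {S | p S ∧ S.card = x} * (Fintype.card W).choose x =
      ((Finset.univ.powersetCard x).filter p).card * ν.real {S | S.card = x} := by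
  by_cases hx : ∃ A : Finset W, A.card = x
  · obtain ⟨A, hA⟩ := hx
    have key : ∀ F : Finset (Finset W), (∀ S ∈ F, S.card = x) →
        ν.real (F : Set (Finset W)) = F.card * ν.real {A} := by
      intro F hF
      rw [← sum_measureReal_singleton, ← nsmul_eq_mul, ← Finset.sum_const]
      refine Finset.sum_congr rfl fun S hS => ?_
      simp only [measureReal_def]
      rw [hν S A ((hF S hS).trans hA.symm)]
    have e1 : {S | p S ∧ S.card = x} =
        (((Finset.univ.powersetCard x).filter p : Finset (Finset W)) : Set (Finset W)) := by
      ext S; simp [and_comm]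
    have e2 : {S : Finset W | S.card = x} =
        ((Finset.univ.powersetCard x : Finset (Finset W)) : Set (Finset W)) := by
      ext S; simp
    rw [e1, e2, key _ (fun S hS => (Finset.mem_powersetCard.1 (Finset.mem_filter.1 hS).1).2),
      key _ (fun S hS => (Finset.mem_powersetCard.1 hS).2), Finset.card_powersetCard,
      Finset.card_univ]
    ring
  · have e1 : {S | p S ∧ S.card = x} = ∅ := by
      ext S; simp only [mem_ofPred_eq, mem_empty_iff_false, iff_false]
      exact fun h => hx ⟨S, h.2⟩
    have e2 : {S : Finset W | S.card = x} = ∅ := by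
      ext S; simp only [mem_ofPred_eq, mem_empty_iff_false, iff_false]
      exact fun h => hx ⟨S, h⟩
    rw [e1, e2]; simp

omit [DecidableEq W] in
theorem measureReal_and_card_mem_eq_sum {ν : Measure (Finset W)} [IsFiniteMeasure ν]
    (p : Finset W → Prop) (I : Set ℕ) [DecidablePred (· ∈ I)] :
    ν.real {S | p S ∧ S.card ∈ I} =
      ∑ x ∈ (Finset.range (Fintype.card W + 1)).filter (· ∈ I), ν.real {S | p S ∧ S.card = x} := by
  rw [← measureReal_biUnion_finset]
  · congr 1
    ext S
    simp only [mem_ofPred_eq, Finset.mem_filter, Finset.mem_range, mem_iUnion, exists_prop]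
    constructor
    · rintro ⟨h1, h2⟩
      exact ⟨S.card, ⟨Nat.lt_succ_of_le (Finset.card_le_univ S), h2⟩, h1, rfl⟩
    · rintro ⟨x, ⟨_, h2⟩, h1, rfl⟩
      exact ⟨h1, h2⟩
  · intro x _ y _ hxy
    refine Set.disjoint_left.2 fun S h1 h2 => hxy ?_
    exact h1.2.symm.trans h2.2
  · exact fun _ _ => MeasurableSet.of_discrete

omit [DecidableEq W] in
-- Transfers counting estimates for sets of one fixed size to random sizes, by summing over the
-- sizes in `I`.
theorem measureReal_card_mem_le {ν : Measure (Finset W)} [IsFiniteMeasure ν]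
    (p q : Finset W → Prop) (I : Set ℕ) (a b : ℝ)
    (h : ∀ x ∈ I, a * ν.real {S | p S ∧ S.card = x} ≤ b * ν.real {S | q S ∧ S.card = x}) :
    a * ν.real {S | p S ∧ S.card ∈ I} ≤ b * ν.real {S | q S ∧ S.card ∈ I} := by
  classical
  rw [measureReal_and_card_mem_eq_sum, measureReal_and_card_mem_eq_sum, Finset.mul_sum,
    Finset.mul_sum]
  exact Finset.sum_le_sum fun x hx => h x (Finset.mem_filter.1 hx).2

omit [DecidableEq W] [DiscreteMeasurableSpace (Finset W)] in
theorem measureReal_card_eq_eq_zero {ν : Measure (Finset W)} {x : ℕ}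
    (hx : Fintype.card W < x) (p : Finset W → Prop) : ν.real {S | p S ∧ S.card = x} = 0 := by
  have : {S | p S ∧ S.card = x} = ∅ := by
    ext S; simp only [mem_ofPred_eq, mem_empty_iff_false, iff_false]
    intro h
    have := Finset.card_le_univ S
    omega
  rw [this]; simp

/-- The probability of containing a given element. -/
theorem measureReal_mem_le {ν : Measure (Finset W)} [IsFiniteMeasure ν]
    (hν : ∀ A B : Finset W, A.card = B.card → ν {A} = ν {B}) (a : W) (I : Set ℕ) {b : ℝ}
    (hI : ∀ x ∈ I, (x : ℝ) ≤ b) :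
    ν.real {S | a ∈ S ∧ S.card ∈ I} ≤ b / Fintype.card W * ν.real {S | S.card ∈ I} := by
  have hm : (0 : ℝ) < Fintype.card W := by exact_mod_cast Fintype.card_pos_iff.2 ⟨a⟩
  have := measureReal_card_mem_le (ν := ν) (fun S => a ∈ S) (fun _ => True) I 1
    (b / Fintype.card W) fun x hx => ?_
  · simpa using this
  rw [one_mul]
  by_cases hxm : Fintype.card W < x
  · simp only [measureReal_card_eq_eq_zero hxm, mul_zero, le_refl]
  have hc : (0 : ℝ) < (Fintype.card W).choose x := by
    exact_mod_cast Nat.choose_pos (not_lt.1 hxm)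
  have h1 := measureReal_and_card_eq hν (fun S => a ∈ S) x
  have h2 := card_filter_mem_powersetCard a x
  simp only [true_and]
  rw [← mul_le_mul_iff_left₀ hc, h1]
  calc _ ≤ (b / Fintype.card W * (Fintype.card W).choose x) * ν.real {S | S.card = x} := by
        gcongr
        rw [div_mul_eq_mul_div, le_div_iff₀ hm, h2]
        gcongr
        exact hI x hx
    _ = _ := by ring

/-- The probability of meeting a small set in one element and avoiding another small set. -/
theorem le_measureReal_inter_card_eq_one {ν : Measure (Finset W)} [IsFiniteMeasure ν]
    (hν : ∀ A B : Finset W, A.card = B.card → ν {A} = ν {B}) {D A : Finset W} (hDA : Disjoint D A)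
    (I : Set ℕ) {a b : ℝ} (ha : ∀ x ∈ I, a ≤ x) (hb : ∀ x ∈ I, (x : ℝ) ≤ b)
    (hsmall : 2 * ((D.card + A.card) * b) ≤ Fintype.card W) :
    D.card * a / (2 * Fintype.card W) * ν.real {S | S.card ∈ I} ≤
      ν.real {S | ((S ∩ D).card = 1 ∧ Disjoint S A) ∧ S.card ∈ I} := by
  rcases D.eq_empty_or_nonempty with rfl | ⟨d, _⟩
  · simp
  have hm : (0 : ℝ) < Fintype.card W := by exact_mod_cast Fintype.card_pos_iff.2 ⟨d⟩
  have := measureReal_card_mem_le (ν := ν) (fun _ => True)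
    (fun S => (S ∩ D).card = 1 ∧ Disjoint S A) I (D.card * a / (2 * Fintype.card W)) 1
    fun x hx => ?_
  · simpa using this
  rw [one_mul]
  by_cases hxm : Fintype.card W < x
  · simp only [measureReal_card_eq_eq_zero hxm, mul_zero, le_refl]
  have hc : (0 : ℝ) < (Fintype.card W).choose x := by
    exact_mod_cast Nat.choose_pos (not_lt.1 hxm)
  have h1 := measureReal_and_card_eq hν (fun S => (S ∩ D).card = 1 ∧ Disjoint S A) x
  have h2 := card_filter_inter_card_eq_one_ge hDA (x := x) (le_trans (by gcongr; exact hb x hx)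
    hsmall)
  simp only [true_and]
  rw [← mul_le_mul_iff_left₀ hc, h1]
  calc _ = (D.card * a / (2 * Fintype.card W) * (Fintype.card W).choose x)
          * ν.real {S | S.card = x} := by ring
    _ ≤ _ := by
      gcongr
      rw [div_mul_eq_mul_div, div_le_iff₀ (by positivity), mul_comm (Nat.cast _ : ℝ) (2 * _)]
      refine le_trans ?_ h2
      gcongr
      exact ha x hx

/-- The probability that a large set avoids a large set. -/
theorem measureReal_disjoint_le {ν : Measure (Finset W)} [IsProbabilityMeasure ν]
    (hν : ∀ A B : Finset W, A.card = B.card → ν {A} = ν {B}) {A : Finset W} {a b : ℝ} (hb0 : 0 ≤ b)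
    (ha : a ≤ A.card) :
    ν.real {S | Disjoint S A ∧ b ≤ (S.card : ℝ)} ≤ Real.exp (-(a * b / Fintype.card W)) := by
  have := measureReal_card_mem_le (ν := ν) (fun S => Disjoint S A) (fun _ => True)
    {x : ℕ | b ≤ (x : ℝ)} 1 (Real.exp (-(a * b / Fintype.card W))) fun x hx => ?_
  · simp only [one_mul, true_and, mem_ofPred_eq] at this
    exact this.trans (mul_le_of_le_one_right (Real.exp_nonneg _) measureReal_le_one)
  rw [one_mul]
  by_cases hxm : Fintype.card W < x
  · simp only [measureReal_card_eq_eq_zero hxm, mul_zero, le_refl]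
  have hc : (0 : ℝ) < (Fintype.card W).choose x := by
    exact_mod_cast Nat.choose_pos (not_lt.1 hxm)
  have h1 := measureReal_and_card_eq hν (fun S => Disjoint S A) x
  have h2 := card_filter_disjoint_powersetCard_le A x
  simp only [true_and]
  rw [← mul_le_mul_iff_left₀ hc, h1]
  calc _ ≤ (Real.exp (-(A.card * x / Fintype.card W)) * (Fintype.card W).choose x)
          * ν.real {S | S.card = x} := by gcongr
    _ ≤ (Real.exp (-(a * b / Fintype.card W)) * (Fintype.card W).choose x)
          * ν.real {S | S.card = x} := by
        gcongr
        exact hx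
    _ = _ := by ring

end UniformSets

/-! ### Random sets whose size has a power law -/

section PowerLaw

variable {W : Type*} [MeasurableSpace (Finset W)]

/-- A probability distribution on finite sets that depends on the size only, where the size in
units of `R` has tails of order `t ^ (-1 - α)` for `c₀ ≤ t ≤ T`. -/
structure IsPowerLaw (α c₀ c₁ c₂ T R : ℝ) (ν : Measure (Finset W)) : Prop where
  isProbabilityMeasure : IsProbabilityMeasure ν
  exch : ∀ A B : Finset W, A.card = B.card → ν {A} = ν {B}
  lower : ∀ t ∈ Icc c₀ T, c₁ * t ^ (-1 - α) ≤ ν.real {A | t * R < (A.card : ℝ)}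
  upper : ∀ t ∈ Icc c₀ T, ν.real {A | t * R < (A.card : ℝ)} ≤ c₂ * t ^ (-1 - α)

/-- A constant that bounds the truncated mean of the size. -/
noncomputable def meanBound (α c₀ c₂ : ℝ) : ℝ := c₀ + 2 * c₂ * c₀ ^ (-α) / (1 - 2 ^ (-α))

/-- A constant `κ` such that the sizes in `(t, κ t]` have at least half of the mass of the lower
bound for the tail. -/
noncomputable def spread (α c₁ c₂ : ℝ) : ℝ := max 2 ((2 * c₂ / c₁) ^ (1 / (1 + α)))

variable {α c₀ c₁ c₂ T R : ℝ} {ν : Measure (Finset W)}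

theorem two_rpow_neg_lt_one (hα : 0 < α) : (2 : ℝ) ^ (-α) < 1 :=
  Real.rpow_lt_one_of_one_lt_of_neg (by norm_num) (by linarith)

theorem meanBound_pos (hα : 0 < α) (hc₀ : 0 < c₀) (hc₂ : 0 < c₂) : 0 < meanBound α c₀ c₂ := by
  have := two_rpow_neg_lt_one hα
  have h2 : 0 < 1 - (2 : ℝ) ^ (-α) := by linarith
  unfold meanBound
  positivity

theorem two_le_spread : 2 ≤ spread α c₁ c₂ := le_max_left _ _

theorem two_mul_le_spread_rpow (hα : 0 < α) (hc₁ : 0 < c₁) (hc₂ : 0 < c₂) :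
    2 * c₂ / c₁ ≤ spread α c₁ c₂ ^ (1 + α) := by
  calc 2 * c₂ / c₁ = ((2 * c₂ / c₁) ^ (1 / (1 + α))) ^ (1 + α) := by
        rw [← Real.rpow_mul (by positivity), one_div_mul_cancel (by linarith), Real.rpow_one]
    _ ≤ _ := by
        apply Real.rpow_le_rpow (by positivity) (le_max_right _ _) (by linarith)

namespace IsPowerLaw

/-- The probability that the size is in `(t, κ t]`. -/
theorem le_measureReal_Ioc (h : IsPowerLaw α c₀ c₁ c₂ T R ν) (hα : 0 < α) (hc₀ : 0 < c₀)
    (hc₁ : 0 < c₁) (hc₂ : 0 < c₂) {t : ℝ} (ht : c₀ ≤ t) (htT : spread α c₁ c₂ * t ≤ T) :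
    c₁ / 2 * t ^ (-1 - α) ≤
      ν.real {A | t * R < (A.card : ℝ) ∧ (A.card : ℝ) ≤ spread α c₁ c₂ * t * R} := by
  have := h.isProbabilityMeasure
  set κ := spread α c₁ c₂ with hκ
  have hκ2 : 2 ≤ κ := two_le_spread
  have ht0 : 0 < t := hc₀.trans_le ht
  have htκ : t ≤ κ * t := by nlinarith
  have h1 := h.lower t ⟨ht, htκ.trans htT⟩
  have h2 := h.upper (κ * t) ⟨ht.trans htκ, htT⟩
  have h3 : ν.real {A | t * R < (A.card : ℝ)} ≤
      ν.real {A | t * R < (A.card : ℝ) ∧ (A.card : ℝ) ≤ κ * t * R} +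
        ν.real {A | κ * t * R < (A.card : ℝ)} := by
    refine le_trans (measureReal_mono fun A hA => ?_) (measureReal_union_le _ _)
    by_cases hA2 : κ * t * R < (A.card : ℝ)
    · exact Or.inr hA2
    · exact Or.inl ⟨hA, not_lt.1 hA2⟩
  -- The constant `κ` satisfies κ^(1+α) ≥ 2c₂/c₁, so the tail beyond κt is at most half of the lower
  -- bound at t.
  have h4 : c₂ * (κ * t) ^ (-1 - α) ≤ c₁ / 2 * t ^ (-1 - α) := by
    rw [Real.mul_rpow (by positivity) (by positivity), ← mul_assoc]
    gcongr
    have h5 := two_mul_le_spread_rpow hα hc₁ hc₂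
    rw [← hκ] at h5
    have e : κ ^ (-1 - α) = (κ ^ (1 + α))⁻¹ := by
      rw [← Real.rpow_neg (by positivity)]; congr 1; ring
    rw [e, ← div_eq_mul_inv, div_le_iff₀ (by positivity)]
    rw [div_le_iff₀ hc₁] at h5
    linarith
  linarith

variable [Fintype W] [DecidableEq W] [DiscreteMeasurableSpace (Finset W)]

/-- The probability that a given element belongs to the set, the size being truncated. -/
theorem measureReal_mem_le (h : IsPowerLaw α c₀ c₁ c₂ T R ν) (hα : 0 < α) (hc₀ : 0 < c₀)
    (hc₂ : 0 < c₂) (hR : 0 ≤ R) (a : W) :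
    ν.real {S | a ∈ S ∧ (S.card : ℝ) ≤ T * R} ≤ meanBound α c₀ c₂ * R / Fintype.card W := by
  have := h.isProbabilityMeasure
  have hm : (0 : ℝ) < Fintype.card W := by exact_mod_cast Fintype.card_pos_iff.2 ⟨a⟩
  have hg1 := two_rpow_neg_lt_one hα
  have hg0 : 0 < (2 : ℝ) ^ (-α) := by positivity
  set g := (2 : ℝ) ^ (-α) with hg
  set m : ℝ := (Fintype.card W : ℝ)
  -- dyadic decomposition of the range of the size
  have key : ∀ N : ℕ, ν.real {S | a ∈ S ∧ (S.card : ℝ) ≤ min T (c₀ * 2 ^ N) * R} ≤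
      c₀ * R / m + ∑ k ∈ Finset.range N, 2 * c₂ * c₀ ^ (-α) * g ^ k * (R / m) := by
    intro N
    induction N with
    | zero =>
      have h1 := _root_.measureReal_mem_le h.exch a {x : ℕ | (x : ℝ) ≤ min T (c₀ * 2 ^ 0) * R}
        (b := c₀ * R) fun x hx => le_trans hx (by gcongr; simp)
      refine h1.trans ?_
      simp only [Finset.range_zero, Finset.sum_empty, add_zero]
      exact mul_le_of_le_one_right (by positivity) measureReal_le_one
    | succ N ih =>
      rw [Finset.sum_range_succ, ← add_assoc]
      have hsub : {S : Finset W | a ∈ S ∧ (S.card : ℝ) ≤ min T (c₀ * 2 ^ (N + 1)) * R} ⊆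
          {S | a ∈ S ∧ (S.card : ℝ) ≤ min T (c₀ * 2 ^ N) * R} ∪
          {S | a ∈ S ∧ S.card ∈ {x : ℕ | min T (c₀ * 2 ^ N) * R < (x : ℝ) ∧
            (x : ℝ) ≤ min T (c₀ * 2 ^ (N + 1)) * R}} := by
        rintro S ⟨haS, hS⟩
        by_cases h1 : (S.card : ℝ) ≤ min T (c₀ * 2 ^ N) * R
        · exact Or.inl ⟨haS, h1⟩
        · exact Or.inr ⟨haS, not_le.1 h1, hS⟩
      refine (measureReal_mono hsub).trans ((measureReal_union_le _ _).trans (add_le_add ih ?_))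
      have h1 := _root_.measureReal_mem_le h.exch a {x : ℕ | min T (c₀ * 2 ^ N) * R < (x : ℝ) ∧
            (x : ℝ) ≤ min T (c₀ * 2 ^ (N + 1)) * R}
        (b := c₀ * 2 ^ (N + 1) * R) fun x hx => le_trans hx.2 (by gcongr; simp)
      refine h1.trans ?_
      -- Beyond `T` the dyadic window is empty. Below `T` the tail bound at its left end gives a
      -- geometric term of ratio 2^(-α), which is summable since α > 0.
      by_cases hT : T < c₀ * 2 ^ N
      · have : {S : Finset W | S.card ∈ {x : ℕ | min T (c₀ * 2 ^ N) * R < (x : ℝ) ∧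
            (x : ℝ) ≤ min T (c₀ * 2 ^ (N + 1)) * R}} = ∅ := by
          ext S
          simp only [mem_ofPred_eq, mem_empty_iff_false, iff_false, not_and, not_le]
          rw [min_eq_left hT.le, min_eq_left]
          · exact id
          · refine hT.le.trans ?_
            gcongr
            · norm_num
            · omega
        rw [this]; simp; positivity
      · push Not at hT
        have ht : c₀ ≤ c₀ * 2 ^ N := le_mul_of_one_le_right hc₀.le (one_le_pow₀ (by norm_num))
        have h2 := h.upper (c₀ * 2 ^ N) ⟨ht, hT⟩
        have h3 : ν.real {S : Finset W | S.card ∈ {x : ℕ | min T (c₀ * 2 ^ N) * R < (x : ℝ) ∧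
            (x : ℝ) ≤ min T (c₀ * 2 ^ (N + 1)) * R}} ≤ c₂ * (c₀ * 2 ^ N) ^ (-1 - α) := by
          refine le_trans (measureReal_mono fun S hS => ?_) h2
          have := hS.1
          rwa [min_eq_right hT] at this
        have h4 : (c₀ * 2 ^ N) ^ (-1 - α) = (c₀ * 2 ^ N)⁻¹ * (c₀ ^ (-α) * g ^ N) := by
          rw [show (-1 - α) = -1 + -α by ring, Real.rpow_add (by positivity), Real.rpow_neg_one,
            Real.mul_rpow (by positivity) (by positivity), hg, ← Real.rpow_natCast,
            ← Real.rpow_natCast, ← Real.rpow_mul (by norm_num), ← Real.rpow_mul (by norm_num),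
            mul_comm (N : ℝ)]
        calc _ ≤ c₀ * 2 ^ (N + 1) * R / m * (c₂ * (c₀ * 2 ^ N) ^ (-1 - α)) := by gcongr
          _ = _ := by rw [h4]; field_simp; ring
  obtain ⟨N, hN⟩ := pow_unbounded_of_one_lt (T / c₀) (one_lt_two : (1 : ℝ) < 2)
  rw [div_lt_iff₀ hc₀] at hN
  have hTN : min T (c₀ * 2 ^ N) = T := min_eq_left (by linarith)
  have h1 := key N
  rw [hTN] at h1
  refine h1.trans ?_
  rw [← Finset.sum_mul, ← Finset.mul_sum]
  have h2 : ∑ k ∈ Finset.range N, g ^ k ≤ (1 - g)⁻¹ := by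
    rw [← tsum_geometric_of_lt_one hg0.le hg1]
    exact (summable_geometric_of_lt_one hg0.le hg1).sum_le_tsum _ fun _ _ => by positivity
  calc _ ≤ c₀ * R / m + 2 * c₂ * c₀ ^ (-α) * (1 - g)⁻¹ * (R / m) := by gcongr
    _ = _ := by unfold meanBound; rw [← hg]; ring

/-- The probability of linking to a set `D` while avoiding a set `A`. -/
theorem le_measureReal_linkSet (h : IsPowerLaw α c₀ c₁ c₂ T R ν) (hα : 0 < α) (hc₀ : 0 < c₀)
    (hc₁ : 0 < c₁) (hc₂ : 0 < c₂) (hR : 0 ≤ R) {D A : Finset W} (hDA : Disjoint D A) {s t : ℝ}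
    (hs1 : 1 ≤ s * R) (hsD : s * R ≤ D.card) (ht : c₀ ≤ t) (htT : spread α c₁ c₂ * t ≤ T)
    (hsmall : 2 * ((2 * s * R + A.card) * (spread α c₁ c₂ * t * R)) ≤ Fintype.card W) :
    c₁ / 4 * s * t ^ (-α) * R ^ 2 / Fintype.card W ≤
      ν.real (linkSet A D (t * R) (spread α c₁ c₂ * t * R)) := by
  have := h.isProbabilityMeasure
  set κ := spread α c₁ c₂ with hκ
  have ht0 : 0 < t := hc₀.trans_le ht
  have hκ2 : 2 ≤ κ := two_le_spread
  -- `D` may be too large for the second moment argument, so it is replaced by a subset of ⌈sR⌉ ≤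
  -- 2sR elements; meeting the subset implies meeting `D`.
  have hceil : ⌈s * R⌉₊ ≤ D.card := Nat.ceil_le.2 hsD
  obtain ⟨D', hD'D, hD'c⟩ := Finset.exists_subset_card_eq hceil
  have hD'1 : s * R ≤ D'.card := by rw [hD'c]; exact Nat.le_ceil _
  have hD'2 : (D'.card : ℝ) ≤ 2 * s * R := by
    rw [hD'c]
    have := (Nat.ceil_lt_add_one (show 0 ≤ s * R by linarith)).le
    linarith
  have h1 := le_measureReal_inter_card_eq_one h.exch (hDA.mono_left hD'D)
    {x : ℕ | t * R < (x : ℝ) ∧ (x : ℝ) ≤ κ * t * R} (a := t * R) (b := κ * t * R)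
    (fun x hx => hx.1.le) (fun x hx => hx.2) (le_trans (by gcongr) hsmall)
  have h2 := h.le_measureReal_Ioc hα hc₀ hc₁ hc₂ ht htT
  calc _ = s * R * (t * R) / (2 * Fintype.card W) * (c₁ / 2 * t ^ (-1 - α)) := by
        rw [show (-1 - α) = -1 + -α by ring, Real.rpow_add ht0, Real.rpow_neg_one]
        field_simp
        ring
    _ ≤ D'.card * (t * R) / (2 * Fintype.card W) *
          ν.real {A | t * R < (A.card : ℝ) ∧ (A.card : ℝ) ≤ κ * t * R} := by gcongr
    _ ≤ _ := h1
    _ ≤ _ := by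
        refine measureReal_mono fun S hS => ⟨hS.1.2, fun hd => ?_, hS.2.1, hS.2.2⟩
        have h3 := hS.1.1
        rw [Finset.disjoint_iff_inter_eq_empty.1 (hd.mono_right hD'D)] at h3
        simp at h3

/-- Among the sets that avoid `B` and meet `A ⊇ B`, those with at least `L R` elements outside of
`A` have a proportion that is bounded away from zero. -/
theorem measureReal_small_sdiff_le (h : IsPowerLaw α c₀ c₁ c₂ T R ν) (hα : 0 < α) (hc₀ : 0 < c₀)
    (hc₁ : 0 < c₁) (hc₂ : 0 < c₂) (hR : 0 ≤ R) {A B : Finset W} (hBA : B ⊆ A) {L : ℝ}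
    (hL1 : 1 ≤ L * R) (hL : c₀ ≤ 2 * L) (hLT : spread α c₁ c₂ * (2 * L) ≤ T)
    (hsmall : 2 * (A.card * (spread α c₁ c₂ * (2 * L) * R)) ≤ Fintype.card W) :
    (ν.restrict {S | (S.card : ℝ) ≤ T * R}).real
        {S | Disjoint S B ∧ ¬ Disjoint S A ∧ ((S \ A).card : ℝ) < L * R} ≤
      (1 - c₁ / 2 * L * (2 * L) ^ (-1 - α) / meanBound α c₀ c₂) *
        (ν.restrict {S | (S.card : ℝ) ≤ T * R}).real {S | Disjoint S B ∧ ¬ Disjoint S A} := by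
  have := h.isProbabilityMeasure
  set κ := spread α c₁ c₂ with hκ
  set m : ℝ := (Fintype.card W : ℝ) with hm
  have hκ2 : 2 ≤ κ := two_le_spread
  have hC := meanBound_pos hα hc₀ hc₂
  set C := meanBound α c₀ c₂ with hCdef
  have hL0 : 0 < L := by linarith
  set ρ := ν.restrict {S | (S.card : ℝ) ≤ T * R} with hρ
  have hρapp : ∀ E : Set (Finset W), ρ.real E = ν.real (E ∩ {S | (S.card : ℝ) ≤ T * R}) :=
    fun E => measureReal_restrict_apply MeasurableSet.of_discrete
  set D := A \ B with hD
  have hDB : Disjoint D B := Finset.sdiff_disjoint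
  have hcardDB : ((D.card : ℝ) + B.card) = A.card := by
    rw [hD]; exact_mod_cast Finset.card_sdiff_add_card_eq_card hBA
  -- upper bound for the total
  have hup : ρ.real {S | Disjoint S B ∧ ¬ Disjoint S A} ≤ D.card * (C * R / m) := by
    rw [hρapp]
    have hsub : {S | Disjoint S B ∧ ¬ Disjoint S A} ∩ {S : Finset W | (S.card : ℝ) ≤ T * R} ⊆
        ⋃ a ∈ D, {S | a ∈ S ∧ (S.card : ℝ) ≤ T * R} := by
      rintro S ⟨⟨h1, h2⟩, h3⟩
      obtain ⟨a, haS, haA⟩ := Finset.not_disjoint_iff.1 h2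
      simp only [mem_iUnion, exists_prop]
      exact ⟨a, Finset.mem_sdiff.2 ⟨haA, fun haB => Finset.disjoint_left.1 h1 haS haB⟩, haS, h3⟩
    refine (measureReal_mono hsub (measure_ne_top _ _)).trans ((measureReal_biUnion_finset_le _ _).trans ?_)
    rw [← nsmul_eq_mul]
    exact Finset.sum_le_card_nsmul _ _ _ fun a _ => h.measureReal_mem_le hα hc₀ hc₂ hR a
  -- lower bound for the good part
  have hlow : D.card * (L * R) / m * (c₁ / 2 * (2 * L) ^ (-1 - α)) ≤
      ρ.real {S | Disjoint S B ∧ ¬ Disjoint S A ∧ L * R ≤ ((S \ A).card : ℝ)} := by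
    -- Sets of size more than 2LR that avoid `B` and meet `A` in exactly one element have more than
    -- 2LR - 1 ≥ LR elements outside of `A`. Both this bound and the upper bound for the total are
    -- proportional to |A \ B|·R/m, so their quotient is free of n, m and `A`.
    have h1 := le_measureReal_inter_card_eq_one h.exch hDB
      {x : ℕ | 2 * L * R < (x : ℝ) ∧ (x : ℝ) ≤ κ * (2 * L) * R} (a := 2 * L * R)
      (b := κ * (2 * L) * R) (fun x hx => hx.1.le) (fun x hx => hx.2) (by rw [hcardDB]; exact hsmall)
    have h2 := h.le_measureReal_Ioc hα hc₀ hc₁ hc₂ hL hLT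
    rw [hρapp]
    calc _ = D.card * (2 * L * R) / (2 * m) * (c₁ / 2 * (2 * L) ^ (-1 - α)) := by
          rw [show (D.card : ℝ) * (2 * L * R) = 2 * (D.card * (L * R)) by ring,
            mul_div_mul_left _ _ two_ne_zero]
      _ ≤ D.card * (2 * L * R) / (2 * m) *
          ν.real {A | 2 * L * R < (A.card : ℝ) ∧ (A.card : ℝ) ≤ κ * (2 * L) * R} := by gcongr
      _ ≤ _ := h1
      _ ≤ _ := by
        refine measureReal_mono ?_ (measure_ne_top _ _)
        rintro S ⟨⟨h3, h4⟩, h5, h6⟩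
        have hSA : (S ∩ A).card = 1 := by
          rw [← h3]; congr 1
          ext a; simp only [hD, Finset.mem_inter, Finset.mem_sdiff]
          exact ⟨fun ha => ⟨ha.1, ha.2, Finset.disjoint_left.1 h4 ha.1⟩, fun ha => ⟨ha.1, ha.2.1⟩⟩
        refine ⟨⟨h4, fun hd => ?_, ?_⟩, ?_⟩
        · rw [Finset.disjoint_iff_inter_eq_empty.1 hd] at hSA
          simp at hSA
        · have h7 : ((S \ A).card : ℝ) + 1 = S.card := by
            have := Finset.card_sdiff_add_card_inter S A
            rw [hSA] at this
            exact_mod_cast this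
          linarith
        · exact h6.trans (by gcongr)
  have hadd : ρ.real {S | Disjoint S B ∧ ¬ Disjoint S A ∧ ((S \ A).card : ℝ) < L * R} +
      ρ.real {S | Disjoint S B ∧ ¬ Disjoint S A ∧ L * R ≤ ((S \ A).card : ℝ)} =
      ρ.real {S | Disjoint S B ∧ ¬ Disjoint S A} := by
    rw [← measureReal_union _ MeasurableSet.of_discrete]
    · congr 1; ext S
      simp only [mem_union, mem_ofPred_eq]
      constructor
      · rintro (h | h) <;> exact ⟨h.1, h.2.1⟩
      · rintro ⟨h1, h2⟩
        rcases lt_or_ge ((S \ A).card : ℝ) (L * R) with h3 | h3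
        · exact Or.inl ⟨h1, h2, h3⟩
        · exact Or.inr ⟨h1, h2, h3⟩
    · exact Set.disjoint_left.2 fun S h1 h2 => absurd h1.2.2 (not_lt.2 h2.2.2)
  set q := c₁ / 2 * L * (2 * L) ^ (-1 - α) / C with hq
  have hq0 : 0 ≤ q := by positivity
  have : q * ρ.real {S | Disjoint S B ∧ ¬ Disjoint S A} ≤
      D.card * (L * R) / m * (c₁ / 2 * (2 * L) ^ (-1 - α)) := by
    calc _ ≤ q * (D.card * (C * R / m)) := by gcongr
      _ = _ := by rw [hq]; field_simp
  linarith

end IsPowerLaw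

end PowerLaw

/-! ### Scales of the climb -/

section Scales

theorem one_sub_ofReal_pow_le (p : ℝ) (N : ℕ) :
    (1 - ENNReal.ofReal p) ^ N ≤ ENNReal.ofReal (Real.exp (-(p * N))) := by
  have h1 : 1 - ENNReal.ofReal p ≤ ENNReal.ofReal (Real.exp (-p)) := by
    rw [tsub_le_iff_right, ← ENNReal.ofReal_one]
    refine le_trans (ENNReal.ofReal_le_ofReal ?_) ENNReal.ofReal_add_le
    have := Real.add_one_le_exp (-p)
    linarith
  calc _ ≤ ENNReal.ofReal (Real.exp (-p)) ^ N := by gcongr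
    _ = _ := by
      rw [← ENNReal.ofReal_pow (Real.exp_nonneg _), ← Real.exp_nat_mul]
      congr 2; ring

/-- The sum of the failure probabilities of a climb that starts at level `L`. -/
theorem exists_sum_exp_level_le {β η c δ : ℝ} (hβ : 1 < β) (hη : 0 < η) (hc : 0 < c) (hδ : 0 < δ) :
    ∀ᶠ L : ℝ in atTop, ∀ K : ℕ,
      ∑ i ∈ Finset.range K, Real.exp (-(c * (L ^ (β ^ i)) ^ η)) ≤ δ := by
  have h1 : Tendsto (fun L : ℝ => L ^ (-(η * (β - 1)))) atTop (𝓝 0) :=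
    tendsto_rpow_neg_atTop (mul_pos hη (by linarith))
  have h2 : Tendsto (fun L : ℝ => L ^ (-η)) atTop (𝓝 0) := tendsto_rpow_neg_atTop hη
  filter_upwards [h1.eventually (ge_mem_nhds (show (0 : ℝ) < 1 / 2 by norm_num)),
    h2.eventually (ge_mem_nhds (show (0 : ℝ) < c * δ / 2 by positivity)),
    eventually_ge_atTop 1] with L hL1 hL2 hL K
  have hL0 : 0 < L := by linarith
  set g := L ^ (-(η * (β - 1))) with hg
  have hg0 : 0 ≤ g := by positivity
  -- From exp(-z) ≤ 1/z and Bernoulli's inequality β^i ≥ 1 + i(β-1); the resulting series is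
  -- geometric with ratio at most 1/2.
  have term : ∀ i : ℕ, Real.exp (-(c * (L ^ (β ^ i)) ^ η)) ≤ c⁻¹ * L ^ (-η) * g ^ i := by
    intro i
    set z := c * (L ^ (β ^ i)) ^ η with hz
    have hz0 : 0 < z := by positivity
    have e1 : Real.exp (-z) ≤ z⁻¹ := by
      rw [Real.exp_neg]
      gcongr
      have := Real.add_one_le_exp z
      linarith
    refine e1.trans ?_
    rw [hz, mul_inv, mul_assoc]
    gcongr
    rw [← Real.rpow_natCast g i, ← Real.rpow_mul hL0.le, ← Real.rpow_neg hL0.le, hg,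
      ← Real.rpow_mul hL0.le, ← Real.rpow_add hL0]
    apply Real.rpow_le_rpow_of_exponent_le hL
    have h3 : 1 + (i : ℝ) * (β - 1) ≤ β ^ i := by
      have := one_add_mul_le_pow (a := β - 1) (by linarith) i
      simpa using this
    nlinarith
  calc _ ≤ ∑ i ∈ Finset.range K, c⁻¹ * L ^ (-η) * g ^ i := Finset.sum_le_sum fun i _ => term i
    _ = c⁻¹ * L ^ (-η) * ∑ i ∈ Finset.range K, g ^ i := by rw [Finset.mul_sum]
    _ ≤ c⁻¹ * (c * δ / 2) * 2 := by
        gcongr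
        calc ∑ i ∈ Finset.range K, g ^ i ≤ ∑ i ∈ Finset.range K, (1 / 2 : ℝ) ^ i := by gcongr
          _ ≤ 2 := by
            have := (summable_geometric_two).sum_le_tsum (Finset.range K)
              (fun i _ => by positivity)
            rwa [tsum_geometric_two] at this
    _ = δ := by field_simp

/-- The number `K` of levels `L ^ β ^ i`, `i ≤ K`, that one needs to climb to `n ^ γ`, with the
restrictions on the size of these numbers. -/
structure IsClimbScale (α κ β γ L : ℝ) (M K n : ℕ) : Prop where
  top : (n : ℝ) ^ γ ≤ L ^ β ^ K
  le_top : ∀ i < K, κ * L ^ β ^ (i + 1) ≤ (n : ℝ) ^ (1 / (1 + α))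
  small : ∀ i < K, 2 * κ * (2 * L ^ β ^ i + M * L) * L ^ β ^ (i + 1) ≤ n
  card : n ≤ 2 * n - 2 * (K + M + 2)
  start_le : κ * (2 * L) ≤ (n : ℝ) ^ (1 / (1 + α))
  start_small : 4 * κ * M * L ^ 2 ≤ n

/-- The number of steps of a climb. -/
noncomputable def climbSteps (β : ℝ) (n : ℕ) : ℕ :=
  ⌈Real.log (Real.log n) / Real.log β⌉₊

theorem eventually_rpow_mul_le {a b C : ℝ} (hab : a < b) :
    ∀ᶠ n : ℕ in atTop, C * (n : ℝ) ^ a ≤ (n : ℝ) ^ b := by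
  have h : Tendsto (fun n : ℕ => (n : ℝ) ^ (b - a)) atTop atTop :=
    (tendsto_rpow_atTop (sub_pos.2 hab)).comp tendsto_natCast_atTop_atTop
  filter_upwards [h.eventually_ge_atTop C, eventually_gt_atTop 0] with n hn hn0
  have hn0' : (0 : ℝ) < n := by exact_mod_cast hn0
  calc C * (n : ℝ) ^ a ≤ (n : ℝ) ^ (b - a) * (n : ℝ) ^ a := by gcongr
    _ = _ := by rw [← Real.rpow_add hn0']; congr 1; ring

theorem eventually_climbSteps_le {β c : ℝ} (hβ : 1 < β) (hc : 0 < c) (C : ℕ) :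
    ∀ᶠ n : ℕ in atTop, (climbSteps β n : ℝ) + C ≤ c * n := by
  have hlog : 0 < Real.log β := Real.log_pos hβ
  have h1 : Tendsto (fun n : ℕ => Real.log (Real.log n)) atTop atTop :=
    Real.tendsto_log_atTop.comp (Real.tendsto_log_atTop.comp tendsto_natCast_atTop_atTop)
  have h2 : ∀ᶠ n : ℕ in atTop, Real.log n ≤ c * Real.log β / 2 * n := by
    have := (Real.isLittleO_log_id_atTop.comp_tendsto tendsto_natCast_atTop_atTop).def
      (show 0 < c * Real.log β / 2 by positivity)
    filter_upwards [this, eventually_ge_atTop 1] with n hn hn1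
    simp only [Function.comp, id, Real.norm_natCast] at hn
    exact (Real.le_norm_self _).trans hn
  have h3 : ∀ᶠ n : ℕ in atTop, 2 * ((C : ℝ) + 1) / c ≤ n :=
    tendsto_natCast_atTop_atTop.eventually_ge_atTop _
  filter_upwards [h1.eventually_ge_atTop 0, h2, h3, eventually_ge_atTop 3] with n h0 h2 h3 hn
  have hn1 : (1 : ℝ) < n := by exact_mod_cast (by omega : 1 < n)
  have h4 := (Nat.ceil_lt_add_one (div_nonneg h0 hlog.le)).le
  have h5 : Real.log (Real.log n) ≤ Real.log n := by
    have := Real.log_le_sub_one_of_pos (Real.log_pos hn1); linarith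
  have h6 : Real.log (Real.log n) / Real.log β ≤ c / 2 * n := by
    rw [div_le_iff₀ hlog]; nlinarith
  rw [div_le_iff₀ hc] at h3
  unfold climbSteps
  linarith

/-- `K` is the first level above n^γ. All earlier levels are at most n^γ and their successors at
most n^(γβ), so the upper bounds reduce to γβ < 1/(1+α) and γ(1+β) < 1. As L ≥ e, `climbSteps β n`
levels already exceed n. -/
theorem eventually_exists_isClimbScale {α κ β γ L : ℝ} (hα : 0 < α) (hκ : 0 ≤ κ) (hβ : 1 < β)
    (hαβ : α * β < 1) (hγ0 : 0 < γ) (hγ : γ * (1 + β) < 1) (hL : Real.exp 1 ≤ L) (M : ℕ) :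
    ∀ᶠ n : ℕ in atTop, ∃ K ≤ climbSteps β n, IsClimbScale α κ β γ L M K n := by
  have hL1 : 1 < L := lt_of_lt_of_le (by simp) hL
  have hL0 : 0 < L := by linarith
  have hlogβ : 0 < Real.log β := Real.log_pos hβ
  have hγβ : γ * β < 1 / (1 + α) := by
    rw [lt_div_iff₀ (by linarith)]
    nlinarith
  have hn : Tendsto (fun n : ℕ => (n : ℝ)) atTop atTop := tendsto_natCast_atTop_atTop
  have h0 : Tendsto (fun n : ℕ => Real.log (Real.log n)) atTop atTop :=
    Real.tendsto_log_atTop.comp (Real.tendsto_log_atTop.comp hn)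
  have hpow : ∀ a : ℝ, 0 < a → Tendsto (fun n : ℕ => (n : ℝ) ^ a) atTop atTop :=
    fun a ha => (tendsto_rpow_atTop ha).comp hn
  filter_upwards [eventually_rpow_mul_le (C := κ) hγβ,
    eventually_rpow_mul_le (C := 6 * κ) hγ, (hpow γ hγ0).eventually_ge_atTop (M * L),
    eventually_climbSteps_le hβ (show (0 : ℝ) < 1 / 2 by norm_num) (M + 2),
    (hpow (1 / (1 + α)) (by positivity)).eventually_ge_atTop (κ * (2 * L)),
    hn.eventually_ge_atTop (4 * κ * M * L ^ 2), eventually_ge_atTop 3,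
    h0.eventually_ge_atTop 0] with n h1 h2 h3 h4 h5 h6 h7 h8
  have hn1 : (1 : ℝ) < n := by exact_mod_cast (by omega : 1 < n)
  have hn0 : (0 : ℝ) < n := by linarith
  have hex : (n : ℝ) ^ γ ≤ L ^ β ^ climbSteps β n := by
    have hlogn : 0 < Real.log n := Real.log_pos hn1
    have e1 : Real.log n ≤ β ^ climbSteps β n := by
      rw [← Real.log_le_log_iff hlogn (by positivity), Real.log_pow, ← div_le_iff₀ hlogβ]
      exact Nat.le_ceil _
    have hγ1 : γ ≤ 1 := by nlinarith
    calc (n : ℝ) ^ γ ≤ (n : ℝ) ^ (1 : ℝ) := Real.rpow_le_rpow_of_exponent_le hn1.le hγ1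
      _ = Real.exp 1 ^ (Real.log n) := by
        rw [Real.rpow_one, ← Real.exp_mul, one_mul, Real.exp_log hn0]
      _ ≤ L ^ (Real.log n) := Real.rpow_le_rpow (Real.exp_nonneg _) hL hlogn.le
      _ ≤ _ := Real.rpow_le_rpow_of_exponent_le hL1.le e1
  classical
  have hexists : ∃ K, (n : ℝ) ^ γ ≤ L ^ β ^ K := ⟨_, hex⟩
  have hlt : ∀ i < Nat.find hexists, L ^ β ^ i ≤ (n : ℝ) ^ γ := fun i hi =>
    (not_le.1 (Nat.find_min hexists hi)).le
  have hlt' : ∀ i < Nat.find hexists, L ^ β ^ (i + 1) ≤ (n : ℝ) ^ (γ * β) := fun i hi => by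
    rw [pow_succ, Real.rpow_mul hL0.le, Real.rpow_mul hn0.le]
    exact Real.rpow_le_rpow (by positivity) (hlt i hi) (by linarith)
  have hK := Nat.find_min' hexists hex
  refine ⟨Nat.find hexists, hK, Nat.find_spec hexists, fun i hi => ?_,
    fun i hi => ?_, ?_, h5, h6⟩
  · exact (mul_le_mul_of_nonneg_left (hlt' i hi) hκ).trans h1
  · rw [Real.rpow_one] at h2
    calc _ ≤ 2 * κ * (2 * (n : ℝ) ^ γ + (n : ℝ) ^ γ) * (n : ℝ) ^ (γ * β) := by
          have := hlt i hi
          have := hlt' i hi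
          gcongr
      _ = 6 * κ * (n : ℝ) ^ (γ * (1 + β)) := by
          rw [mul_add γ, mul_one, Real.rpow_add hn0]; ring
      _ ≤ n := h2
  · have : (2 * (climbSteps β n + (M + 2)) : ℝ) ≤ n := by push_cast at h4; linarith
    have : 2 * (climbSteps β n + (M + 2)) ≤ n := by exact_mod_cast this
    omega

end Scales

/-! ### Climbing in the random intersection graph -/

section Climb

variable {α c₀ c₁ c₂ β γ L T : ℝ} {n m M K : ℕ}

theorem sq_sqrt_div_div (hn : 0 < n) (hnm : n ≤ m) :
    Real.sqrt ((m : ℝ) / n) ^ 2 / m = 1 / n := by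
  have hn0 : (0 : ℝ) < n := by exact_mod_cast hn
  have hm0 : (0 : ℝ) < m := by exact_mod_cast hn.trans_le hnm
  rw [Real.sq_sqrt (by positivity)]; field_simp

theorem one_le_sqrt_div (hn : 0 < n) (hnm : n ≤ m) : 1 ≤ Real.sqrt ((m : ℝ) / n) := by
  have hn0 : (0 : ℝ) < n := by exact_mod_cast hn
  rw [Real.one_le_sqrt, one_le_div hn0]; exact_mod_cast hnm

/-- The failure probability of level `i`. -/
noncomputable def levelProb (α c₁ β L : ℝ) (n i : ℕ) : ℝ :=
  c₁ / 4 * (L ^ β ^ i) ^ (1 - α * β) / n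

/-- `levelProb` is a lower bound for the chance that one vertex provides the step up from level `i`.
At least half of the vertices are still available at each level, whence c₁/4 becomes c₁/8. -/
theorem sum_one_sub_levelProb_pow_le (hc₁ : 0 < c₁) (hL : 0 < L) (hn : 0 < n) :
    ∑ i ∈ Finset.Ico 0 K, (1 - ENNReal.ofReal (levelProb α c₁ β L n i)) ^ ((n + 1) / 2) ≤
      ENNReal.ofReal (∑ i ∈ Finset.range K,
        Real.exp (-(c₁ / 8 * (L ^ (β ^ i)) ^ (1 - α * β)))) := by
  rw [ENNReal.ofReal_sum_of_nonneg fun _ _ => Real.exp_nonneg _, ← Finset.range_eq_Ico]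
  refine Finset.sum_le_sum fun i _ => (one_sub_ofReal_pow_le _ _).trans
    (ENNReal.ofReal_le_ofReal (Real.exp_le_exp.2 (neg_le_neg ?_)))
  have hn0 : (0 : ℝ) < n := by exact_mod_cast hn
  have h1 : (n : ℝ) / 2 ≤ ((n + 1) / 2 : ℕ) := by
    have : n ≤ 2 * ((n + 1) / 2) := by omega
    have : (n : ℝ) ≤ 2 * ((n + 1) / 2 : ℕ) := by exact_mod_cast this
    linarith
  calc _ = c₁ / 4 * (L ^ β ^ i) ^ (1 - α * β) / n * ((n : ℝ) / 2) := by field_simp; ring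
    _ ≤ _ := by unfold levelProb; gcongr

/-- Makes the size windows of different levels disjoint: β^j ≥ β·β^i ≥ β^i + (β-1). -/
theorem level_spread_le {κ : ℝ} (hβ : 1 < β) (hL : 1 ≤ L) (hκ : κ ≤ L ^ (β - 1)) {i j : ℕ}
    (hij : i < j) : κ * L ^ β ^ i ≤ L ^ β ^ j := by
  have hL0 : 0 < L := by linarith
  have h1 : (1 : ℝ) ≤ β ^ i := one_le_pow₀ hβ.le
  have h2 : β ^ (i + 1) ≤ β ^ j := pow_le_pow_right₀ hβ.le hij
  calc κ * L ^ β ^ i ≤ L ^ (β - 1) * L ^ β ^ i := by gcongr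
    _ = L ^ (β - 1 + β ^ i) := by rw [Real.rpow_add hL0]
    _ ≤ L ^ β ^ j := by
      apply Real.rpow_le_rpow_of_exponent_le hL
      rw [pow_succ] at h2
      nlinarith

variable [MeasurableSpace (Finset (Fin m))] [DiscreteMeasurableSpace (Finset (Fin m))]

/-- With s = L^(β^i) and t = s^β the linking bound c₁/4·s·t^(-α)·R²/m equals c₁/4·s^(1-αβ)/n. -/
theorem IsPowerLaw.levelProb_le {ν : Measure (Finset (Fin m))}
    (h : IsPowerLaw α c₀ c₁ c₂ T (Real.sqrt ((m : ℝ) / n)) ν)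
    (hα : 0 < α) (hc₀ : 0 < c₀) (hc₁ : 0 < c₁) (hc₂ : 0 < c₂) (hβ : 1 < β)
    (hL1 : 1 ≤ L) (hLc : c₀ ≤ L) (hn : 0 < n) (hnm : n ≤ m)
    (hT : (n : ℝ) ^ (1 / (1 + α)) ≤ T)
    (hsc : IsClimbScale α (spread α c₁ c₂) β γ L M K n) {i : ℕ} (hi : i < K)
    {A D : Finset (Fin m)} (hA : (A.card : ℝ) ≤ M * (L * Real.sqrt ((m : ℝ) / n)))
    (hDA : Disjoint D A) (hD : L ^ β ^ i * Real.sqrt ((m : ℝ) / n) ≤ D.card) :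
    ENNReal.ofReal (levelProb α c₁ β L n i) ≤
      ν (linkSet A D (L ^ β ^ (i + 1) * Real.sqrt ((m : ℝ) / n))
        (spread α c₁ c₂ * L ^ β ^ (i + 1) * Real.sqrt ((m : ℝ) / n))) := by
  have := h.isProbabilityMeasure
  set R := Real.sqrt ((m : ℝ) / n) with hR
  have hR1 : 1 ≤ R := one_le_sqrt_div hn hnm
  have hn0 : (0 : ℝ) < n := by exact_mod_cast hn
  have hm0 : (0 : ℝ) < m := by exact_mod_cast hn.trans_le hnm
  have hRm : R ^ 2 / m = 1 / n := sq_sqrt_div_div hn hnm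
  have hL0 : 0 < L := by linarith
  have hκ2 : 2 ≤ spread α c₁ c₂ := two_le_spread
  set κ := spread α c₁ c₂ with hκ
  have hlev : ∀ k : ℕ, L ≤ L ^ β ^ k := fun k => by
    calc L = L ^ (1 : ℝ) := (Real.rpow_one L).symm
      _ ≤ _ := Real.rpow_le_rpow_of_exponent_le hL1 (one_le_pow₀ hβ.le)
  set s := L ^ β ^ i with hs
  set t := L ^ β ^ (i + 1) with ht
  have hst : t = s ^ β := by rw [ht, hs, pow_succ, Real.rpow_mul hL0.le]
  have hs0 : 0 < s := hL0.trans_le (hlev i)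
  have hsm := hsc.small i hi
  have h1 := h.le_measureReal_linkSet hα hc₀ hc₁ hc₂ (by linarith) hDA (s := s) (t := t)
    (one_le_mul_of_one_le_of_one_le (hL1.trans (hlev i)) hR1) hD (hLc.trans (hlev _))
    ((hsc.le_top i hi).trans hT) ?_
  · rw [Fintype.card_fin] at h1
    rw [ENNReal.ofReal_le_iff_le_toReal (measure_ne_top _ _)]
    refine le_trans (le_of_eq ?_) h1
    have e : t ^ (-α) * s = s ^ (1 - α * β) := by
      rw [hst, ← Real.rpow_mul hs0.le]
      nth_rewrite 2 [← Real.rpow_one s]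
      rw [← Real.rpow_add hs0]; congr 1; ring
    calc levelProb α c₁ β L n i = c₁ / 4 * (t ^ (-α) * s) * (1 / n) := by
          rw [e, levelProb]; ring
      _ = _ := by rw [← hRm]; ring
  · rw [Fintype.card_fin]
    calc 2 * ((2 * s * R + A.card) * (κ * t * R))
        ≤ 2 * ((2 * s * R + M * (L * R)) * (κ * t * R)) := by gcongr
      _ = (2 * κ * (2 * s + M * L) * t) * R ^ 2 := by ring
      _ ≤ n * R ^ 2 := by gcongr
      _ = m * (n * (R ^ 2 / m)) := by field_simp
      _ = m := by rw [hRm]; field_simp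

end Climb

/-! ### Failure probabilities of the climb and of the exploration. -/

section PowerLawGraph

variable {α c₀ c₁ c₂ β γ L T : ℝ} {n m M K K' : ℕ}
  [MeasurableSpace (Finset (Fin m))] [DiscreteMeasurableSpace (Finset (Fin m))]

/-- The vertex `v` is far from all the vertices with a set of size at least `τ`. -/
def FarFromLarge {V W : Type*} (v : V) (N : ℕ) (τ : ℝ) (S : V → Finset W) : Prop :=
  ∀ y, (intersectionGraph S).edist v y ≤ N → ((S y).card : ℝ) < τ

/-- The number of vertices in the component of `v`. -/
noncomputable def componentCard {V W : Type*} (v : V) (S : V → Finset W) : ℕ :=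
  {y | (intersectionGraph S).Reachable v y}.ncard

/-- The probability that the climb from a vertex of a set `Q` of vertices of large weight fails. -/
theorem pi_climb_le {ν : Fin n → Measure (Finset (Fin m))}
    (h : ∀ i, IsPowerLaw α c₀ c₁ c₂ T (Real.sqrt ((m : ℝ) / n)) (ν i))
    (hα : 0 < α) (hc₀ : 0 < c₀) (hc₁ : 0 < c₁) (hc₂ : 0 < c₂) (hβ : 1 < β)
    (hL1 : 1 ≤ L) (hLc : c₀ ≤ L) (hLκ : spread α c₁ c₂ ≤ L ^ (β - 1)) (hn : 0 < n) (hnm : n ≤ m)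
    (hT : (n : ℝ) ^ (1 / (1 + α)) ≤ T)
    (hsc : IsClimbScale α (spread α c₁ c₂) β γ L M K n) (hK : K ≤ K') {v : Fin n}
    {Q : Finset (Fin n)} (hvQ : v ∈ Q) (hQ : Q.card ≤ 2) :
    Measure.pi ν {S | (∀ i ∈ Q, L * Real.sqrt ((m : ℝ) / n) < ((S i).card : ℝ)) ∧
        FarFromLarge v K' ((n : ℝ) ^ γ * Real.sqrt ((m : ℝ) / n)) S} ≤
      ENNReal.ofReal (∑ i ∈ Finset.range K,
        Real.exp (-(c₁ / 8 * (L ^ (β ^ i)) ^ (1 - α * β)))) *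
      ∏ i ∈ Q, ν i {A | L * Real.sqrt ((m : ℝ) / n) < (A.card : ℝ)} := by
  have hprob := fun i => (h i).isProbabilityMeasure
  set R := Real.sqrt ((m : ℝ) / n) with hR
  have hR1 : 1 ≤ R := one_le_sqrt_div hn hnm
  set E := {S : Fin n → Finset (Fin m) | (∀ i ∈ Q, L * R < ((S i).card : ℝ)) ∧
        FarFromLarge v K' ((n : ℝ) ^ γ * R) S} with hE
  have hcard := hsc.card
  have := lintegral_climb_le (v := v) (N := K') (K := K) (N₀ := (n + 1) / 2)
    (τ := (n : ℝ) ^ γ * R) (ℓ := L * R) (f := E.indicator 1) (fun S => ?_) (fun S y hy hτ => ?_) hvQ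
    (fun S hS => ?_) (lo := fun i => L ^ β ^ i * R)
    (hi := fun i => spread α c₁ c₂ * L ^ β ^ i * R)
    (p := fun i => ENNReal.ofReal (levelProb α c₁ β L n i)) ?_ ?_ ?_ hK ?_ ν
    (fun i => measure_univ.le) ?_
  · rw [lintegral_indicator_one MeasurableSet.of_discrete] at this
    refine this.trans ?_
    gcongr
    exact sum_one_sub_levelProb_pow_le hc₁ (by linarith) hn
  · exact indicator_le_self' (fun _ _ => zero_le) S |>.trans le_rfl
  · refine indicator_of_notMem (fun hS => ?_) _
    exact absurd (hS.2 y hy) (not_lt.2 hτ)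
  · refine indicator_of_notMem (fun hS' => ?_) _
    obtain ⟨i, hi, hlt⟩ := hS
    exact hlt (hS'.1 i hi)
  · intro i j hij _
    have := level_spread_le hβ hL1 hLκ hij
    gcongr
  · have := hsc.top
    gcongr
  · simp
  · rw [Fintype.card_fin]; omega
  · intro j i hi D hD
    exact (h j).levelProb_le hα hc₀ hc₁ hc₂ hβ hL1 hLc hn hnm hT hsc hi (A := ∅)
      (by rw [Finset.card_empty]; push_cast; positivity) (by simp) hD

/-- The probability that the component of `v` is large, but does not contain a vertex of large
weight near `v`. -/
theorem pi_explore_le {ν : Fin n → Measure (Finset (Fin m))}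
    (h : ∀ i, IsPowerLaw α c₀ c₁ c₂ T (Real.sqrt ((m : ℝ) / n)) (ν i))
    (hα : 0 < α) (hc₀ : 0 < c₀) (hc₁ : 0 < c₁) (hc₂ : 0 < c₂) (hβ : 1 < β)
    (hL1 : 1 ≤ L) (hLc : c₀ ≤ L) (hLκ : spread α c₁ c₂ ≤ L ^ (β - 1)) (hn : 0 < n) (hnm : n ≤ m)
    (hT : (n : ℝ) ^ (1 / (1 + α)) ≤ T)
    (hsc : IsClimbScale α (spread α c₁ c₂) β γ L M K n) (hK : K ≤ K') (v : Fin n) :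
    Measure.pi ν {S | (∀ i, ((S i).card : ℝ) ≤ T * Real.sqrt ((m : ℝ) / n)) ∧
        M < componentCard v S ∧
        FarFromLarge v (M + 1 + K') ((n : ℝ) ^ γ * Real.sqrt ((m : ℝ) / n)) S} ≤
      ENNReal.ofReal (1 - c₁ / 2 * L * (2 * L) ^ (-1 - α) / meanBound α c₀ c₂) ^ M +
      ENNReal.ofReal (∑ i ∈ Finset.range K,
        Real.exp (-(c₁ / 8 * (L ^ (β ^ i)) ^ (1 - α * β)))) := by
  have hprob := fun i => (h i).isProbabilityMeasure
  set R := Real.sqrt ((m : ℝ) / n) with hR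
  have hR1 : 1 ≤ R := one_le_sqrt_div hn hnm
  have hn0 : (0 : ℝ) < n := by exact_mod_cast hn
  have hm0 : (0 : ℝ) < m := by exact_mod_cast hn.trans_le hnm
  have hRm : R ^ 2 / m = 1 / n := sq_sqrt_div_div hn hnm
  have hκ2 : 2 ≤ spread α c₁ c₂ := two_le_spread
  set κ := spread α c₁ c₂ with hκ
  set E := {S : Fin n → Finset (Fin m) | M < componentCard v S ∧
        FarFromLarge v (M + 1 + K') ((n : ℝ) ^ γ * R) S} with hE
  set ρ : Fin n → Measure (Finset (Fin m)) :=
    fun i => (ν i).restrict {A | (A.card : ℝ) ≤ T * R} with hρ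
  have hcard := hsc.card
  have := lintegral_explore_le (v := v) (M := M) (N := M + 1 + K') (K := K) (N₀ := (n + 1) / 2)
    (τ := (n : ℝ) ^ γ * R) (ℓ := L * R) (f := E.indicator 1) (fun S => ?_) (fun S y hy hτ => ?_)
    (fun S hS => ?_) (lo := fun i => L ^ β ^ i * R)
    (hi := fun i => κ * L ^ β ^ i * R)
    (p := fun i => ENNReal.ofReal (levelProb α c₁ β L n i)) ?_ ?_ ?_ ?_ ?_ ?_ ρ ?_
    (r := ENNReal.ofReal (1 - c₁ / 2 * L * (2 * L) ^ (-1 - α) / meanBound α c₀ c₂)) ?_ ?_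
  -- The truncation of all sizes at `T * R` is a product event, so it is imposed by restricting
  -- every factor. It makes the truncated mean bound available.
  · rw [lintegral_indicator_one MeasurableSet.of_discrete, hρ, ← Measure.restrict_pi_pi,
      Measure.restrict_apply MeasurableSet.of_discrete] at this
    refine le_trans (measure_mono fun S hS => ?_) (this.trans ?_)
    · exact ⟨hS.2, fun i _ => hS.1 i⟩
    · gcongr
      exact sum_one_sub_levelProb_pow_le hc₁ (by linarith) hn
  · exact indicator_le_self' (fun _ _ => zero_le) S |>.trans le_rfl
  · refine indicator_of_notMem (fun hS => ?_) _
    exact absurd (hS.2 y hy) (not_lt.2 hτ)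
  · refine indicator_of_notMem (fun hS' => ?_) _
    exact absurd hS'.1 (not_lt.2 hS)
  · intro i j hij _
    have := level_spread_le hβ hL1 hLκ hij
    gcongr
  · have := hsc.top
    gcongr
  · simp
  · positivity
  · omega
  · rw [Fintype.card_fin]; omega
  · exact fun i => (Measure.restrict_apply_le _ _).trans measure_univ.le
  · intro j A B hBA hA
    have h1 := (h j).measureReal_small_sdiff_le hα hc₀ hc₁ hc₂ (by linarith) hBA (L := L)
      (one_le_mul_of_one_le_of_one_le hL1 hR1) (by linarith) (hsc.start_le.trans hT) ?_
    · rw [← ofReal_measureReal (measure_ne_top _ _), ← ofReal_measureReal (measure_ne_top _ _),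
        ← ENNReal.ofReal_mul' measureReal_nonneg]
      exact ENNReal.ofReal_le_ofReal h1
    · rw [Fintype.card_fin]
      have h2 := hsc.start_small
      calc 2 * (A.card * (κ * (2 * L) * R)) ≤ 2 * (M * (L * R) * (κ * (2 * L) * R)) := by gcongr
        _ = (4 * κ * M * L ^ 2) * R ^ 2 := by ring
        _ ≤ n * R ^ 2 := by gcongr
        _ = m * (n * (R ^ 2 / m)) := by field_simp
        _ = m := by rw [hRm]; field_simp
  · intro j A hA i hi D hDA hD
    refine ((h j).levelProb_le hα hc₀ hc₁ hc₂ hβ hL1 hLc hn hnm hT hsc hi hA hDA hD).trans ?_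
    rw [hρ, Measure.restrict_apply MeasurableSet.of_discrete]
    -- The windows of the climb lie below the truncation, so it does not affect the links.
    refine measure_mono fun S hS => ⟨hS, hS.2.2.2.trans ?_⟩
    have := hsc.le_top i hi
    rw [← hR]
    gcongr
    exact this.trans hT

end PowerLawGraph

/-! ### Distances and components -/

section Components

variable {V W : Type*} [Finite V]

/-- The vertices of a shortest path are distinct and lie in the component. -/
theorem edist_le_componentCard {S : V → Finset W} {v w : V}
    (h : (intersectionGraph S).Reachable v w) :
    (intersectionGraph S).edist v w ≤ componentCard v S := by
  classical
  obtain ⟨p, hp, hpl⟩ := h.exists_path_of_dist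
  have hsub : (p.support.toFinset : Set V) ⊆ {y | (intersectionGraph S).Reachable v y} := by
    intro y hy
    rw [Finset.mem_coe, List.mem_toFinset] at hy
    exact ⟨p.takeUntil y hy⟩
  have h1 := Set.ncard_le_ncard hsub
  rw [Set.ncard_coe_finset, List.toFinset_card_of_nodup hp.support_nodup,
    SimpleGraph.Walk.length_support] at h1
  refine (SimpleGraph.edist_le p).trans ?_
  have : p.length ≤ componentCard v S := by unfold componentCard; omega
  exact_mod_cast this

omit [Finite V] in
theorem componentCard_eq {S : V → Finset W} {v w : V} (h : (intersectionGraph S).Reachable v w) :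
    componentCard v S = componentCard w S := by
  unfold componentCard
  congr 1; ext y
  exact ⟨fun hy => h.symm.trans hy, fun hy => h.trans hy⟩

theorem exists_isMaximalVertex [Nonempty V] (S : V → Finset W) : ∃ w, IsMaximalVertex S w :=
  Finite.exists_max fun v => (S v).card

/-- If most of the vertices of a set `X` are connected to `w`, and few vertices of large components
are not, then every largest component contains `w`. -/
theorem mem_of_isLargestComponent {S : V → Finset W} {w : V} {C : Set V}
    (hC : IsLargestComponent (intersectionGraph S) C) {M : ℕ} {X : Set V}
    (h : M + {i | i ∈ X ∧ ¬ (intersectionGraph S).Reachable i w}.ncard < X.ncard)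
    (h' : {i | M < componentCard i S ∧ ¬ (intersectionGraph S).Reachable i w}.ncard
      + {i | i ∈ X ∧ ¬ (intersectionGraph S).Reachable i w}.ncard < X.ncard) :
    w ∈ C := by
  obtain ⟨c, rfl, hc⟩ := hC
  by_contra hw
  have h1 : X.ncard ≤ {i | i ∈ X ∧ ¬ (intersectionGraph S).Reachable i w}.ncard +
      ((intersectionGraph S).connectedComponentMk w).supp.ncard := by
    refine le_trans (Set.ncard_le_ncard fun i hi => ?_) (Set.ncard_union_le _ _)
    by_cases hr : (intersectionGraph S).Reachable i w
    · exact Or.inr (by rwa [SimpleGraph.ConnectedComponent.mem_supp_iff,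
        SimpleGraph.ConnectedComponent.eq])
    · exact Or.inl ⟨hi, hr⟩
  have h2 : ((intersectionGraph S).connectedComponentMk w).supp.ncard ≤ c.supp.ncard := by
    have := hc ((intersectionGraph S).connectedComponentMk w)
    rw [← Set.Finite.cast_ncard_eq (Set.toFinite _), ← Set.Finite.cast_ncard_eq (Set.toFinite _)]
      at this
    exact_mod_cast this
  have hcomp : ∀ i ∈ c.supp, componentCard i S = c.supp.ncard ∧
      ¬ (intersectionGraph S).Reachable i w := by
    intro i hi
    rw [SimpleGraph.ConnectedComponent.mem_supp_iff] at hi hw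
    subst hi
    rw [SimpleGraph.ConnectedComponent.eq] at hw
    refine ⟨?_, fun h => hw h.symm⟩
    unfold componentCard
    congr 1; ext y
    rw [SimpleGraph.ConnectedComponent.mem_supp_iff, SimpleGraph.ConnectedComponent.eq]
    exact SimpleGraph.reachable_comm
  -- If `w` is outside the largest component, all vertices there are disconnected from `w` and lie
  -- in a component larger than `M`. There are too few such vertices, since the component of `w`
  -- already contains most of `X`.
  have h3 : c.supp.ncard ≤
      {i | M < componentCard i S ∧ ¬ (intersectionGraph S).Reachable i w}.ncard := by
    refine Set.ncard_le_ncard fun i hi => ⟨?_, (hcomp i hi).2⟩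
    rw [(hcomp i hi).1]; omega
  omega

end Components

/-! ### Concentration -/

section Concentration

variable {ι C : Type*} [Fintype ι] [Finite C] [MeasurableSpace C] [DiscreteMeasurableSpace C]

/-- Markov's inequality for the number of events that occur. -/
theorem measureReal_le_ncard_le {Ω : Type*} [Finite Ω] [MeasurableSpace Ω]
    [DiscreteMeasurableSpace Ω] {μ : Measure Ω} [IsFiniteMeasure μ] {E : ι → Set Ω} {a b : ℝ}
    (ha : 0 < a) (h : ∑ i, μ.real (E i) ≤ b) :
    μ.real {x | a ≤ ({i | x ∈ E i}.ncard : ℝ)} ≤ b / a := by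
  classical
  have h1 := mul_meas_ge_le_integral_of_nonneg (μ := μ) (f := fun x => ∑ i, (E i).indicator 1 x)
    (ae_of_all _ fun x => Finset.sum_nonneg fun i _ => indicator_nonneg (fun _ _ => zero_le_one) x)
    (Integrable.of_finite) a
  rw [integral_finsetSum _ fun i _ => Integrable.of_finite] at h1
  simp only [integral_indicator_one MeasurableSet.of_discrete] at h1
  rw [le_div_iff₀ ha, mul_comm]
  refine le_trans (le_of_eq ?_) (h1.trans h)
  congr 3
  ext x
  have : ({i | x ∈ E i}.ncard : ℝ) = ∑ i, (E i).indicator (1 : Ω → ℝ) x := by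
    simp only [indicator_apply, Pi.one_apply]
    rw [Finset.sum_boole, ← Set.ncard_coe_finset]
    simp
  exact (iff_of_eq (by rw [this]) : a ≤ ({i | x ∈ E i}.ncard : ℝ) ↔ a ≤ _)

/-- A lower tail bound for the number of independent events that occur. -/
theorem measureReal_ncard_le_le {ν : ι → Measure C} [∀ i, IsProbabilityMeasure (ν i)]
    (E : Set C) {q : ℝ} (hq : ∀ i, q ≤ (ν i).real E) :
    (Measure.pi ν).real {x | ({i | x i ∈ E}.ncard : ℝ) ≤ Fintype.card ι * q / 2} ≤
      Real.exp (-((1 / 2 - Real.exp (-1)) * (Fintype.card ι * q))) := by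
  classical
  set n : ℝ := (Fintype.card ι : ℝ) with hn
  set g : C → ℝ := fun c => 1 - (1 - Real.exp (-1)) * E.indicator 1 c with hg
  have he : 0 ≤ 1 - Real.exp (-1) := by
    have : Real.exp (-1) ≤ 1 := Real.exp_le_one_iff.2 (by norm_num)
    linarith
  have hgE : ∀ c, g c = Real.exp (-(E.indicator 1 c)) := by
    intro c
    simp only [hg]
    by_cases hc : c ∈ E
    · simp [hc]
    · simp [hc]
  have hint : ∀ i, ∫ c, g c ∂ν i ≤ Real.exp (-((1 - Real.exp (-1)) * q)) := by
    intro i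
    have : ∫ c, g c ∂ν i = 1 - (1 - Real.exp (-1)) * (ν i).real E := by
      simp only [hg]
      rw [integral_sub Integrable.of_finite Integrable.of_finite, integral_const_mul,
        integral_indicator_one MeasurableSet.of_discrete]
      simp
    rw [this]
    have h1 := Real.add_one_le_exp (-((1 - Real.exp (-1)) * q))
    have h2 := mul_le_mul_of_nonneg_left (hq i) he
    linarith
  have hprod : ∫ x, ∏ i, g (x i) ∂Measure.pi ν ≤ Real.exp (-(n * ((1 - Real.exp (-1)) * q))) := by
    rw [integral_fintype_prod_eq_prod (fun _ => g)]
    calc _ ≤ ∏ _i : ι, Real.exp (-((1 - Real.exp (-1)) * q)) := by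
          refine Finset.prod_le_prod (fun i _ => integral_nonneg fun c => ?_) fun i _ => hint i
          rw [hgE]; exact (Real.exp_nonneg _)
      _ = _ := by
          rw [Finset.prod_const, Finset.card_univ, ← Real.exp_nat_mul]; congr 1; ring
  have h1 := mul_meas_ge_le_integral_of_nonneg (μ := Measure.pi ν) (f := fun x => ∏ i, g (x i))
    (ae_of_all _ fun x => Finset.prod_nonneg fun i _ => by rw [hgE]; exact (Real.exp_nonneg _))
    (Integrable.of_finite) (Real.exp (-(n * q / 2)))
  have h2 := h1.trans hprod
  have h3 : {x : ι → C | ({i | x i ∈ E}.ncard : ℝ) ≤ n * q / 2} ⊆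
      {x | Real.exp (-(n * q / 2)) ≤ ∏ i, g (x i)} := by
    intro x hx
    rw [mem_ofPred_eq] at hx ⊢
    simp only [hgE]
    rw [← Real.exp_sum, Real.exp_le_exp, Finset.sum_neg_distrib]
    have : ({i | x i ∈ E}.ncard : ℝ) = ∑ i, E.indicator (1 : C → ℝ) (x i) := by
      simp only [indicator_apply, Pi.one_apply]
      rw [Finset.sum_boole, ← Set.ncard_coe_finset]
      simp
    linarith
  refine (measureReal_mono h3).trans ?_
  rw [mul_comm, ← le_div_iff₀ (Real.exp_pos _), ← Real.exp_sub] at h2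
  refine h2.trans (Real.exp_le_exp.2 (le_of_eq ?_))
  ring

end Concentration

/-! ### Typical configurations of sets -/

section Typical

variable {α c₀ c₁ c₂ γ σ T R : ℝ} {n m : ℕ}

/-- No set is too large, some set is large, and large sets meet. -/
def typicalSets (n m : ℕ) (γ σ T R : ℝ) : Set (Fin n → Finset (Fin m)) :=
  {S | (∀ i, ((S i).card : ℝ) ≤ T * R) ∧ (∃ i, (n : ℝ) ^ σ * R < ((S i).card : ℝ)) ∧
    ∀ i j, i ≠ j → (n : ℝ) ^ γ * R ≤ ((S i).card : ℝ) → (n : ℝ) ^ σ * R ≤ ((S j).card : ℝ) →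
      ¬ Disjoint (S j) (S i)}

theorem edist_le_of_mem_typicalSets {S : Fin n → Finset (Fin m)} (hS : S ∈ typicalSets n m γ σ T R)
    {v w : Fin n} {N : ℕ} (hw : IsMaximalVertex S w)
    (hv : ¬ FarFromLarge v N ((n : ℝ) ^ γ * R) S) :
    (intersectionGraph S).edist v w ≤ (N + 1 : ℕ) := by
  unfold FarFromLarge at hv
  push Not at hv
  obtain ⟨y, hy1, hy2⟩ := hv
  obtain ⟨_, ⟨i, hi⟩, hlink⟩ := hS
  have hwσ : (n : ℝ) ^ σ * R ≤ ((S w).card : ℝ) := hi.le.trans (by exact_mod_cast hw i)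
  refine (SimpleGraph.edist_triangle (v := y)).trans ?_
  push_cast
  refine add_le_add hy1 ?_
  by_cases hyw : y = w
  · subst hyw; simp
  · obtain ⟨e, he1, he2⟩ := Finset.not_disjoint_iff.1 (hlink y w hyw hy2 hwσ)
    exact edist_intersectionGraph_le_one he2 he1

variable [MeasurableSpace (Finset (Fin m))] [DiscreteMeasurableSpace (Finset (Fin m))]

/-- Integrate over coordinate `j` first, with the set of `i` frozen. -/
theorem pi_disjoint_le {ν : Fin n → Measure (Finset (Fin m))}
    (h : ∀ i, IsPowerLaw α c₀ c₁ c₂ T R (ν i)) {i j : Fin n} (hij : i ≠ j) {a b : ℝ} (hb : 0 ≤ b) :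
    Measure.pi ν {S | a ≤ ((S i).card : ℝ) ∧ b ≤ ((S j).card : ℝ) ∧ Disjoint (S j) (S i)} ≤
      ENNReal.ofReal (Real.exp (-(a * b / m))) := by
  have hprob := fun i => (h i).isProbabilityMeasure
  set E := {S : Fin n → Finset (Fin m) | a ≤ ((S i).card : ℝ) ∧ b ≤ ((S j).card : ℝ) ∧
    Disjoint (S j) (S i)} with hE
  rw [← lintegral_indicator_one MeasurableSet.of_discrete,
    lintegral_eq_lmarginal_univ (fun _ => ∅), lmarginal_erase' _ Measurable.of_discrete
    (Finset.mem_univ j)]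
  refine (lmarginal_le_of_forall_le (c := ENNReal.ofReal (Real.exp (-(a * b / m))))
    fun S _ => ?_).trans (by simp)
  have e : (fun A => E.indicator (1 : (Fin n → Finset (Fin m)) → ℝ≥0∞) (Function.update S j A)) =
      {A | Function.update S j A ∈ E}.indicator 1 := by
    funext A; simp [indicator_apply]
  rw [e, lintegral_indicator_one MeasurableSet.of_discrete]
  by_cases ha : a ≤ ((S i).card : ℝ)
  · have h1 := measureReal_disjoint_le (h j).exch (A := S i) hb ha
    rw [Fintype.card_fin] at h1
    rw [← ofReal_measureReal (measure_ne_top _ _)]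
    refine ENNReal.ofReal_le_ofReal (le_trans (measureReal_mono fun A hA => ?_) h1)
    have h2 := hA.2
    rw [Function.update_self, Function.update_of_ne hij] at h2
    exact ⟨h2.2, h2.1⟩
  · have : {A | Function.update S j A ∈ E} = ∅ := by
      ext A
      simp only [mem_ofPred_eq, mem_empty_iff_false, iff_false]
      intro hA
      have := hA.1
      rw [Function.update_of_ne hij] at this
      exact ha this
    rw [this]; simp

/-- A bound for the probability that the configuration of sets is not typical. -/
theorem pi_compl_typicalSets_le {ν : Fin n → Measure (Finset (Fin m))}
    (h : ∀ i, IsPowerLaw α c₀ c₁ c₂ T R (ν i)) (hc₀T : c₀ ≤ T) (hn : 0 < n)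
    (hR : 0 ≤ R) (hRm : R ^ 2 / m = 1 / n) (hσ0 : c₀ ≤ (n : ℝ) ^ σ) (hσT : (n : ℝ) ^ σ ≤ T) :
    Measure.pi ν (typicalSets n m γ σ T R)ᶜ ≤
      ENNReal.ofReal (n * (c₂ * T ^ (-1 - α))) +
      ENNReal.ofReal (Real.exp (-(c₁ * (n : ℝ) ^ (1 + σ * (-1 - α))))) +
      ENNReal.ofReal ((n : ℝ) ^ 2 * Real.exp (-((n : ℝ) ^ (γ + σ - 1)))) := by
  have hprob := fun i => (h i).isProbabilityMeasure
  have hn0 : (0 : ℝ) < n := by exact_mod_cast hn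
  have hsub : (typicalSets n m γ σ T R)ᶜ ⊆
      ((⋃ i ∈ (Finset.univ : Finset (Fin n)), {S | T * R < ((S i).card : ℝ)}) ∪
      Set.pi univ fun _ => {A | (A.card : ℝ) ≤ (n : ℝ) ^ σ * R}) ∪
      ⋃ p ∈ (Finset.univ : Finset (Fin n × Fin n)).filter (fun p => p.1 ≠ p.2),
        {S | (n : ℝ) ^ γ * R ≤ ((S p.1).card : ℝ) ∧ (n : ℝ) ^ σ * R ≤ ((S p.2).card : ℝ) ∧
          Disjoint (S p.2) (S p.1)} := by
    intro S hS
    by_contra hS'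
    simp only [mem_union, mem_iUnion, Finset.mem_univ, exists_prop, true_and, not_or, not_exists,
      Finset.mem_filter, Prod.forall] at hS'
    obtain ⟨⟨h1, h2⟩, h3⟩ := hS'
    refine hS ⟨fun i => not_lt.1 (h1 i), ?_, fun i j hij hi hj hd => h3 i j ⟨hij, hi, hj, hd⟩⟩
    by_contra h4
    push Not at h4
    exact h2 fun i _ => h4 i
  refine (measure_mono hsub).trans ((measure_union_le _ _).trans (add_le_add
    ((measure_union_le _ _).trans (add_le_add ?_ ?_)) ?_))
  · refine (measure_biUnion_finset_le _ _).trans ?_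
    calc _ ≤ ∑ i : Fin n, ENNReal.ofReal (c₂ * T ^ (-1 - α)) := by
          refine Finset.sum_le_sum fun i _ => ?_
          have e : {S : Fin n → Finset (Fin m) | T * R < ((S i).card : ℝ)} =
              Function.eval i ⁻¹' {A | T * R < (A.card : ℝ)} := rfl
          rw [e, (measurePreserving_eval ν i).measure_preimage
            (MeasurableSet.of_discrete).nullMeasurableSet,
            ← ofReal_measureReal (measure_ne_top _ _)]
          exact ENNReal.ofReal_le_ofReal ((h i).upper T ⟨hc₀T, le_rfl⟩)
      _ = _ := by
          rw [Finset.sum_const, Finset.card_univ, Fintype.card_fin, nsmul_eq_mul,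
            ENNReal.ofReal_mul hn0.le, ENNReal.ofReal_natCast]
  · rw [Measure.pi_pi]
    have hi : ∀ i, ν i {A | (A.card : ℝ) ≤ (n : ℝ) ^ σ * R} ≤
        ENNReal.ofReal (Real.exp (-(c₁ * (n : ℝ) ^ (σ * (-1 - α))))) := by
      intro i
      rw [← ofReal_measureReal (measure_ne_top _ _)]
      refine ENNReal.ofReal_le_ofReal ?_
      have h1 := (h i).lower _ ⟨hσ0, hσT⟩
      have h2 : (ν i).real {A | (A.card : ℝ) ≤ (n : ℝ) ^ σ * R} =
          1 - (ν i).real {A | (n : ℝ) ^ σ * R < (A.card : ℝ)} := by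
        rw [← probReal_compl_eq_one_sub MeasurableSet.of_discrete]
        congr 1; ext A; simp
      rw [h2]
      rw [← Real.rpow_mul hn0.le] at h1
      have h3 := Real.add_one_le_exp (-(c₁ * (n : ℝ) ^ (σ * (-1 - α))))
      linarith
    refine (Finset.prod_le_prod' fun i _ => hi i).trans (le_of_eq ?_)
    rw [Finset.prod_const, Finset.card_univ, Fintype.card_fin,
      ← ENNReal.ofReal_pow (Real.exp_nonneg _), ← Real.exp_nat_mul]
    congr 2
    rw [Real.rpow_add hn0, Real.rpow_one]; ring
  · refine (measure_biUnion_finset_le _ _).trans ?_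
    calc _ ≤ ∑ p ∈ (Finset.univ : Finset (Fin n × Fin n)).filter (fun p => p.1 ≠ p.2),
          ENNReal.ofReal (Real.exp (-((n : ℝ) ^ (γ + σ - 1)))) := by
          refine Finset.sum_le_sum fun p hp => ?_
          refine (pi_disjoint_le h (Finset.mem_filter.1 hp).2 (by positivity)).trans ?_
          refine ENNReal.ofReal_le_ofReal (Real.exp_le_exp.2 (neg_le_neg (le_of_eq ?_)))
          calc (n : ℝ) ^ (γ + σ - 1) = (n : ℝ) ^ γ * (n : ℝ) ^ σ * (1 / n) := by
                rw [Real.rpow_sub hn0, Real.rpow_add hn0, Real.rpow_one]; ring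
            _ = _ := by rw [← hRm]; ring
      _ ≤ _ := by
          rw [Finset.sum_const, nsmul_eq_mul, ENNReal.ofReal_mul (by positivity)]
          gcongr
          rw [← ENNReal.ofReal_natCast]
          refine ENNReal.ofReal_le_ofReal ?_
          have : ((Finset.univ : Finset (Fin n × Fin n)).filter (fun p => p.1 ≠ p.2)).card ≤ n ^ 2 := by
            refine (Finset.card_filter_le _ _).trans ?_
            simp [sq]
          exact_mod_cast this

end Typical

/-! ### Asymptotics -/

section Asymptotics

/-- A sequence of families of random sets with power law sizes. -/
structure IsPowerLawSequence (α c₀ c₁ c₂ : ℝ) (ω : ℕ+ → ℝ) (m : ℕ+ → ℕ)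
    [∀ n, MeasurableSpace (Finset (Fin (m n)))]
    (ν : ∀ n : ℕ+, Fin (n : ℕ) → Measure (Finset (Fin (m n)))) : Prop where
  α_pos : 0 < α
  α_lt : α < 1
  c₀_pos : 0 < c₀
  c₁_pos : 0 < c₁
  c₂_pos : 0 < c₂
  tendsto : Tendsto ω atTop atTop
  le : ∀ᶠ n : ℕ+ in atTop, (n : ℕ) ≤ m n
  prob : ∀ n i, IsProbabilityMeasure (ν n i)
  law : ∀ᶠ n : ℕ+ in atTop, ∀ i, IsPowerLaw α c₀ c₁ c₂ (((n : ℕ) : ℝ) ^ (1 / (1 + α)) * ω n)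
    (Real.sqrt ((m n : ℝ) / (n : ℕ))) (ν n i)

theorem tendsto_pnat_val : Tendsto (fun n : ℕ+ => (n : ℕ)) atTop atTop :=
  tendsto_atTop_atTop.2 fun b =>
    ⟨⟨b + 1, Nat.succ_pos b⟩, fun _ hn => (Nat.le_succ b).trans (show _ from hn)⟩

/-- Take γ between α/(1+α) and 1/(1+β), an interval that is nonempty because αβ < 1, and then σ
between 1-γ and 1/(1+α). -/
theorem exists_exponents {α β : ℝ} (hα : 0 < α) (hβ : 1 < β) (hαβ : α * β < 1) :
    ∃ γ σ : ℝ, 0 < γ ∧ γ * (1 + β) < 1 ∧ 0 < σ ∧ σ < 1 / (1 + α) ∧ 0 < γ + σ - 1 := by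
  have h1 : α / (1 + α) < 1 / (1 + β) := by
    rw [div_lt_div_iff₀ (by linarith) (by linarith)]; linarith
  obtain ⟨γ, hγ1, hγ2⟩ := exists_between h1
  have h0 : 0 < α / (1 + α) := by positivity
  have h2 : 1 - γ < 1 / (1 + α) := by
    have : 1 / (1 + α) = 1 - α / (1 + α) := by field_simp; ring
    linarith
  obtain ⟨σ, hσ1, hσ2⟩ := exists_between h2
  have h3 : 1 / (1 + β) < 1 := by rw [div_lt_one (by linarith)]; linarith
  refine ⟨γ, σ, h0.trans hγ1, ?_, by linarith, hσ2, by linarith⟩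
  rwa [lt_div_iff₀ (by linarith)] at hγ2

variable {α c₀ c₁ c₂ β : ℝ} {ω : ℕ+ → ℝ} {m : ℕ+ → ℕ}
  [∀ n, MeasurableSpace (Finset (Fin (m n)))] [∀ n, DiscreteMeasurableSpace (Finset (Fin (m n)))]
  {ν : ∀ n : ℕ+, Fin (n : ℕ) → Measure (Finset (Fin (m n)))}

namespace IsPowerLawSequence

/-- The three error terms vanish because ω → ∞, σ(1+α) < 1 and γ + σ > 1, respectively; at T =
n^(1/(1+α))·ω the first one is c₂·ω^(-(1+α)). -/
theorem tendsto_compl_typicalSets (h : IsPowerLawSequence α c₀ c₁ c₂ ω m ν) {γ σ : ℝ}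
    (hσ0 : 0 < σ) (hσ : σ < 1 / (1 + α)) (hγσ : 0 < γ + σ - 1) :
    Tendsto (fun n : ℕ+ => Measure.pi (ν n) (typicalSets n (m n) γ σ
      (((n : ℕ) : ℝ) ^ (1 / (1 + α)) * ω n) (Real.sqrt ((m n : ℝ) / (n : ℕ))))ᶜ) atTop (𝓝 0) := by
  have hα := h.α_pos
  have hα1 : 0 < 1 + α := by linarith
  have hc₁ := h.c₁_pos
  have hn : Tendsto (fun n : ℕ+ => ((n : ℕ) : ℝ)) atTop atTop :=
    tendsto_natCast_atTop_atTop.comp tendsto_pnat_val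
  have hpow : ∀ a : ℝ, 0 < a → Tendsto (fun n : ℕ+ => ((n : ℕ) : ℝ) ^ a) atTop atTop :=
    fun a ha => (tendsto_rpow_atTop ha).comp hn
  have t1 : Tendsto (fun n : ℕ+ => c₂ * ω n ^ (-(1 + α))) atTop (𝓝 0) := by
    simpa using ((tendsto_rpow_neg_atTop hα1).comp h.tendsto).const_mul c₂
  have t2 : Tendsto (fun n : ℕ+ => Real.exp (-(c₁ * ((n : ℕ) : ℝ) ^ (1 + σ * (-1 - α)))))
      atTop (𝓝 0) := by
    refine Real.tendsto_exp_neg_atTop_nhds_zero.comp ((hpow _ ?_).const_mul_atTop hc₁)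
    rw [lt_div_iff₀ hα1] at hσ
    linarith
  have t3 : Tendsto (fun n : ℕ+ => ((n : ℕ) : ℝ) ^ 2 *
      Real.exp (-(((n : ℕ) : ℝ) ^ (γ + σ - 1)))) atTop (𝓝 0) := by
    have := (tendsto_rpow_mul_exp_neg_mul_atTop_nhds_zero (2 / (γ + σ - 1)) 1 one_pos).comp
      (hpow _ hγσ)
    refine this.congr fun n => ?_
    simp only [Function.comp]
    rw [← Real.rpow_mul (by positivity), mul_div_cancel₀ _ hγσ.ne', Real.rpow_two]
    simp
  have t : Tendsto (fun n : ℕ+ => ENNReal.ofReal (c₂ * ω n ^ (-(1 + α))) +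
      ENNReal.ofReal (Real.exp (-(c₁ * ((n : ℕ) : ℝ) ^ (1 + σ * (-1 - α))))) +
      ENNReal.ofReal (((n : ℕ) : ℝ) ^ 2 *
        Real.exp (-(((n : ℕ) : ℝ) ^ (γ + σ - 1))))) atTop (𝓝 0) := by
    simpa using ((ENNReal.tendsto_ofReal t1).add (ENNReal.tendsto_ofReal t2)).add
      (ENNReal.tendsto_ofReal t3)
  refine tendsto_of_tendsto_of_tendsto_of_le_of_le' tendsto_const_nhds t
    (Eventually.of_forall fun _ => zero_le) ?_
  filter_upwards [h.le, h.law, h.tendsto.eventually_ge_atTop 1, (hpow σ hσ0).eventually_ge_atTop c₀]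
    with n hnm hlaw hω hc₀
  have hn1 : (1 : ℝ) ≤ (n : ℕ) := by exact_mod_cast n.pos
  have hn0 : (0 : ℝ) < (n : ℕ) := by linarith
  have hσT : ((n : ℕ) : ℝ) ^ σ ≤ ((n : ℕ) : ℝ) ^ (1 / (1 + α)) * ω n := by
    calc ((n : ℕ) : ℝ) ^ σ ≤ ((n : ℕ) : ℝ) ^ (1 / (1 + α)) :=
          Real.rpow_le_rpow_of_exponent_le hn1 hσ.le
      _ ≤ _ := le_mul_of_one_le_right (by positivity) hω
  have := pi_compl_typicalSets_le (γ := γ) hlaw (hc₀.trans hσT) n.pos (Real.sqrt_nonneg _)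
    (sq_sqrt_div_div n.pos hnm) hc₀ hσT
  refine this.trans (le_of_eq ?_)
  congr 3
  rw [Real.mul_rpow (by positivity) (by linarith), ← Real.rpow_mul hn0.le,
    show 1 / (1 + α) * (-1 - α) = -1 by field_simp; ring, Real.rpow_neg_one,
    show -1 - α = -(1 + α) by ring]
  field_simp

theorem eventually_compl_typicalSets_le (h : IsPowerLawSequence α c₀ c₁ c₂ ω m ν) {γ σ : ℝ}
    (hσ0 : 0 < σ) (hσ : σ < 1 / (1 + α)) (hγσ : 0 < γ + σ - 1) {δ : ℝ} (hδ : 0 < δ) :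
    ∀ᶠ n : ℕ+ in atTop, Measure.pi (ν n) (typicalSets n (m n) γ σ
      (((n : ℕ) : ℝ) ^ (1 / (1 + α)) * ω n) (Real.sqrt ((m n : ℝ) / (n : ℕ))))ᶜ
        ≤ ENNReal.ofReal δ :=
  (h.tendsto_compl_typicalSets hσ0 hσ hγσ).eventually (ge_mem_nhds (by simpa using hδ))

omit [∀ n, DiscreteMeasurableSpace (Finset (Fin (m n)))] in
/-- Conditions on the starting level of a climb. -/
theorem eventually_level (h : IsPowerLawSequence α c₀ c₁ c₂ ω m ν) (hβ : 1 < β) (hαβ : α * β < 1)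
    {δ : ℝ} (hδ : 0 < δ) :
    ∀ᶠ L : ℝ in atTop, Real.exp 1 ≤ L ∧ c₀ ≤ L ∧ spread α c₁ c₂ ≤ L ^ (β - 1) ∧ ∀ K : ℕ,
      ∑ i ∈ Finset.range K, Real.exp (-(c₁ / 8 * (L ^ (β ^ i)) ^ (1 - α * β))) ≤ δ := by
  have hc₁ := h.c₁_pos
  filter_upwards [eventually_ge_atTop (Real.exp 1), eventually_ge_atTop c₀,
    (tendsto_rpow_atTop (sub_pos.2 hβ)).eventually_ge_atTop (spread α c₁ c₂),
    exists_sum_exp_level_le hβ (sub_pos.2 hαβ) (show 0 < c₁ / 8 by positivity) hδ] with L h1 h2 h3 h4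
  exact ⟨h1, h2, h3, h4⟩

/-- With high probability a vertex in a component that is not small is close to the maximal
vertices. -/
theorem exists_far_from_maximal_le (h : IsPowerLawSequence α c₀ c₁ c₂ ω m ν) (hβ : 1 < β)
    (hαβ : α * β < 1) {δ : ℝ} (hδ : 0 < δ) :
    ∃ M : ℕ, ∀ᶠ n : ℕ+ in atTop, ∀ v : Fin (n : ℕ), Measure.pi (ν n) {S | M < componentCard v S ∧
      ∃ w, IsMaximalVertex S w ∧
        ¬ (intersectionGraph S).edist v w ≤ (M + climbSteps β n + 2 : ℕ)} ≤ ENNReal.ofReal δ := by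
  have hα := h.α_pos
  have hc₀ := h.c₀_pos
  have hc₁ := h.c₁_pos
  have hc₂ := h.c₂_pos
  obtain ⟨γ, σ, hγ0, hγ, hσ0, hσ, hγσ⟩ := exists_exponents hα hβ hαβ
  have hδ3 : 0 < δ / 3 := by positivity
  -- The order of choices matters: `L` makes the climb reliable, `r < 1` depends on `L`, then `M`
  -- makes `r ^ M` small, and finally n is large.
  obtain ⟨L, hLe, hLc, hLκ, hLsum⟩ := (h.eventually_level hβ hαβ hδ3).exists
  have hL1 : 1 ≤ L := le_trans (by simp) hLe
  have hC := meanBound_pos hα hc₀ hc₂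
  set r := 1 - c₁ / 2 * L * (2 * L) ^ (-1 - α) / meanBound α c₀ c₂ with hr
  have hr1 : r < 1 := by
    have : 0 < c₁ / 2 * L * (2 * L) ^ (-1 - α) / meanBound α c₀ c₂ := by positivity
    linarith
  have hM : ∃ M : ℕ, ENNReal.ofReal r ^ M ≤ ENNReal.ofReal (δ / 3) := by
    have : Tendsto (fun M : ℕ => ENNReal.ofReal r ^ M) atTop (𝓝 0) :=
      ENNReal.tendsto_pow_atTop_nhds_zero_of_lt_one (by simpa using hr1)
    exact (this.eventually (ge_mem_nhds (by simpa using hδ3))).exists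
  obtain ⟨M, hM⟩ := hM
  refine ⟨M, ?_⟩
  filter_upwards [h.le, h.law, h.tendsto.eventually_ge_atTop 1,
    h.eventually_compl_typicalSets_le hσ0 hσ hγσ hδ3,
    tendsto_pnat_val.eventually (eventually_exists_isClimbScale hα
      (zero_le_two.trans (two_le_spread (α := α) (c₁ := c₁) (c₂ := c₂))) hβ hαβ hγ0 hγ hLe M)]
    with n hnm hlaw hω htyp hsc v
  obtain ⟨K, hK, hsc⟩ := hsc
  have hT : ((n : ℕ) : ℝ) ^ (1 / (1 + α)) ≤ ((n : ℕ) : ℝ) ^ (1 / (1 + α)) * ω n :=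
    le_mul_of_one_le_right (by positivity) hω
  have h1 := pi_explore_le hlaw hα hc₀ hc₁ hc₂ hβ hL1 hLc hLκ n.pos hnm hT hsc hK v
  have h2 : ENNReal.ofReal (δ / 3) + ENNReal.ofReal (δ / 3) + ENNReal.ofReal (δ / 3) =
      ENNReal.ofReal δ := by
    rw [← ENNReal.ofReal_add hδ3.le hδ3.le, ← ENNReal.ofReal_add (by positivity) hδ3.le]
    congr 1; ring
  rw [← h2]
  refine le_trans (measure_mono fun S hS => ?_) ((measure_union_le _ _).trans (add_le_add (h1.trans
    (add_le_add hM (ENNReal.ofReal_le_ofReal (hLsum K)))) htyp))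
  by_cases hS' : S ∈ typicalSets n (m n) γ σ
      (((n : ℕ) : ℝ) ^ (1 / (1 + α)) * ω n) (Real.sqrt ((m n : ℝ) / (n : ℕ)))
  · refine Or.inl ⟨hS'.1, hS.1, ?_⟩
    by_contra hfar
    obtain ⟨w, hw, hd⟩ := hS.2
    refine hd ((edist_le_of_mem_typicalSets hS' hw hfar).trans ?_)
    exact_mod_cast (by omega : M + 1 + climbSteps β n + 1 ≤ M + climbSteps β n + 2)
  · exact Or.inr hS'

/-- Vertices of large weight are connected to the maximal vertices with high probability. -/
theorem eventually_not_reachable_le (h : IsPowerLawSequence α c₀ c₁ c₂ ω m ν) {δ : ℝ} (hδ : 0 < δ) :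
    ∀ᶠ L : ℝ in atTop, ∀ δ' : ℝ, 0 < δ' → ∀ᶠ n : ℕ+ in atTop, ∀ Q : Finset (Fin (n : ℕ)),
      Q.card ≤ 2 → ∀ v ∈ Q, (Measure.pi (ν n)).real
        {S | (∀ i ∈ Q, L * Real.sqrt ((m n : ℝ) / (n : ℕ)) < ((S i).card : ℝ)) ∧
        ∃ w, IsMaximalVertex S w ∧ ¬ (intersectionGraph S).Reachable v w} ≤
        δ * ∏ i ∈ Q, (ν n i).real {A | L * Real.sqrt ((m n : ℝ) / (n : ℕ)) < (A.card : ℝ)} + δ' := by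
  have hα := h.α_pos
  have hc₀ := h.c₀_pos
  have hc₁ := h.c₁_pos
  have hc₂ := h.c₂_pos
  obtain ⟨β, hβ, hβα⟩ := exists_between (show 1 < 1 / α by rw [lt_div_iff₀ hα]; linarith [h.α_lt])
  have hαβ : α * β < 1 := by rw [lt_div_iff₀ hα] at hβα; linarith
  obtain ⟨γ, σ, hγ0, hγ, hσ0, hσ, hγσ⟩ := exists_exponents hα hβ hαβ
  -- `L` depends on `δ` only. The additive error `δ'`, from atypical configurations, is chosen after
  -- `L`, so it can be small compared with the probability of weight above `L`.
  filter_upwards [h.eventually_level hβ hαβ hδ] with L hL δ' hδ'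
  obtain ⟨hLe, hLc, hLκ, hLsum⟩ := hL
  have hL1 : 1 ≤ L := le_trans (by simp) hLe
  filter_upwards [h.le, h.law, h.tendsto.eventually_ge_atTop 1,
    h.eventually_compl_typicalSets_le hσ0 hσ hγσ hδ',
    tendsto_pnat_val.eventually (eventually_exists_isClimbScale hα
      (zero_le_two.trans (two_le_spread (α := α) (c₁ := c₁) (c₂ := c₂))) hβ hαβ hγ0 hγ hLe 0)]
    with n hnm hlaw hω htyp hsc Q hQ v hv
  have hprob := h.prob n
  obtain ⟨K, hK, hsc⟩ := hsc
  have hT : ((n : ℕ) : ℝ) ^ (1 / (1 + α)) ≤ ((n : ℕ) : ℝ) ^ (1 / (1 + α)) * ω n :=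
    le_mul_of_one_le_right (by positivity) hω
  have h1 := pi_climb_le hlaw hα hc₀ hc₁ hc₂ hβ hL1 hLc hLκ n.pos hnm hT hsc hK hv hQ
  refine ENNReal.toReal_le_of_le_ofReal (by positivity) ?_
  rw [ENNReal.ofReal_add (by positivity) hδ'.le, ENNReal.ofReal_mul hδ.le,
    ENNReal.ofReal_prod_of_nonneg fun _ _ => measureReal_nonneg]
  simp only [ofReal_measureReal (measure_ne_top _ _)]
  refine le_trans (measure_mono fun S hS => ?_) ((measure_union_le _ _).trans (add_le_add (h1.trans
    (mul_le_mul_left (ENNReal.ofReal_le_ofReal (hLsum K)) _)) htyp))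
  by_cases hS' : S ∈ typicalSets n (m n) γ σ
      (((n : ℕ) : ℝ) ^ (1 / (1 + α)) * ω n) (Real.sqrt ((m n : ℝ) / (n : ℕ)))
  · refine Or.inl ⟨hS.1, ?_⟩
    by_contra hfar
    obtain ⟨w, hw, hd⟩ := hS.2
    refine hd (SimpleGraph.reachable_of_edist_ne_top ?_)
    exact ((edist_le_of_mem_typicalSets hS' hw hfar).trans_lt (ENat.natCast_lt_top _)).ne
  · exact Or.inr hS'

omit [∀ n, DiscreteMeasurableSpace (Finset (Fin (m n)))] in
theorem eventually_tail_bounds (h : IsPowerLawSequence α c₀ c₁ c₂ ω m ν) {t : ℝ} (ht : c₀ ≤ t) :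
    ∀ᶠ n : ℕ+ in atTop, ∀ i,
      c₁ * t ^ (-1 - α) ≤
        (ν n i).real {A | t * Real.sqrt ((m n : ℝ) / (n : ℕ)) < (A.card : ℝ)} ∧
      (ν n i).real {A | t * Real.sqrt ((m n : ℝ) / (n : ℕ)) < (A.card : ℝ)} ≤
        c₂ * t ^ (-1 - α) := by
  have hα := h.α_pos
  have hn : Tendsto (fun n : ℕ+ => ((n : ℕ) : ℝ) ^ (1 / (1 + α))) atTop atTop :=
    (tendsto_rpow_atTop (by positivity)).comp
      (tendsto_natCast_atTop_atTop.comp tendsto_pnat_val)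
  filter_upwards [h.law, h.tendsto.eventually_ge_atTop 1, hn.eventually_ge_atTop t]
    with n hlaw hω hnt i
  have htT : t ∈ Icc c₀ (((n : ℕ) : ℝ) ^ (1 / (1 + α)) * ω n) :=
    ⟨ht, hnt.trans (le_mul_of_one_le_right (by positivity) hω)⟩
  exact ⟨(hlaw i).lower t htT, (hlaw i).upper t htT⟩

/-- The probability that one or two given vertices are connected to the maximal vertices is bounded
away from zero. -/
theorem exists_le_reachable (h : IsPowerLawSequence α c₀ c₁ c₂ ω m ν) :
    ∃ c : ℝ, 0 < c ∧ ∀ᶠ n : ℕ+ in atTop, ∀ Q : Finset (Fin (n : ℕ)), Q.card ≤ 2 →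
      c ≤ (Measure.pi (ν n)).real {S | ∀ v ∈ Q, ∀ w, IsMaximalVertex S w →
        (intersectionGraph S).Reachable v w} := by
  have hc₀ := h.c₀_pos
  have hc₁ := h.c₁_pos
  obtain ⟨L, hL, hLc⟩ := ((h.eventually_not_reachable_le (show (0 : ℝ) < 1 / 4 by norm_num)).and
    (eventually_ge_atTop c₀)).exists
  have hL0 : 0 < L := hc₀.trans_le hLc
  set p := c₁ * L ^ (-1 - α) with hp
  have hp0 : 0 < p := by positivity
  refine ⟨p ^ 2 / 4, by positivity, ?_⟩
  filter_upwards [hL (p ^ 2 / 8) (by positivity), h.eventually_tail_bounds hLc] with n hL hν Q hQ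
  have hprob := h.prob n
  set R := Real.sqrt ((m n : ℝ) / (n : ℕ)) with hR
  set X := ∏ i ∈ Q, (ν n i).real {A | L * R < (A.card : ℝ)} with hX
  have hp1 : p ≤ 1 := (hν ⟨0, n.pos⟩).1.trans measureReal_le_one
  have hXp : p ^ 2 ≤ X := by
    calc p ^ 2 ≤ p ^ Q.card := pow_le_pow_of_le_one hp0.le hp1 hQ
      _ = ∏ _i ∈ Q, p := by rw [Finset.prod_const]
      _ ≤ X := Finset.prod_le_prod (fun _ _ => hp0.le) fun i _ => (hν i).1
  have hA : (Measure.pi (ν n)).real {S | ∀ i ∈ Q, L * R < ((S i).card : ℝ)} = X := by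
    have := Measure.pi_pi_finset (μ := ν n) (fun _ => {A | L * R < (A.card : ℝ)}) Q
    simp only [measureReal_def, hX]
    rw [← ENNReal.toReal_prod, ← this]
    rfl
  have hsub : {S : Fin (n : ℕ) → Finset (Fin (m n)) | ∀ i ∈ Q, L * R < ((S i).card : ℝ)} ⊆
      {S | ∀ v ∈ Q, ∀ w, IsMaximalVertex S w → (intersectionGraph S).Reachable v w} ∪
      ⋃ v ∈ Q, {S | (∀ i ∈ Q, L * R < ((S i).card : ℝ)) ∧
        ∃ w, IsMaximalVertex S w ∧ ¬ (intersectionGraph S).Reachable v w} := by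
    intro S hS
    by_cases hS' : ∀ v ∈ Q, ∀ w, IsMaximalVertex S w → (intersectionGraph S).Reachable v w
    · exact Or.inl hS'
    · push Not at hS'
      obtain ⟨v, hv, w, hw⟩ := hS'
      exact Or.inr (mem_biUnion hv ⟨hS, w, hw⟩)
  -- At most two vertices can fail, so at least X/2 - p²/4 ≥ p²/4 remains.
  have h1 : X ≤ (Measure.pi (ν n)).real {S | ∀ v ∈ Q, ∀ w, IsMaximalVertex S w →
      (intersectionGraph S).Reachable v w} + 2 * (1 / 4 * X + p ^ 2 / 8) := by
    rw [← hA]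
    refine (measureReal_mono hsub).trans ((measureReal_union_le _ _).trans ?_)
    rw [hA]
    gcongr
    refine (measureReal_biUnion_finset_le _ _).trans ?_
    calc _ ≤ ∑ _v ∈ Q, (1 / 4 * X + p ^ 2 / 8) := Finset.sum_le_sum fun v hv => hL Q hQ v hv
      _ = Q.card * (1 / 4 * X + p ^ 2 / 8) := by rw [Finset.sum_const, nsmul_eq_mul]
      _ ≤ _ := by
        have : (Q.card : ℝ) ≤ 2 := by exact_mod_cast hQ
        gcongr
  linarith

/-- With high probability every largest component contains the maximal vertices. -/
theorem eventually_largest_le (h : IsPowerLawSequence α c₀ c₁ c₂ ω m ν) {δ : ℝ} (hδ : 0 < δ) :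
    ∀ᶠ n : ℕ+ in atTop, (Measure.pi (ν n)).real {S | ∃ w, IsMaximalVertex S w ∧
      ∃ C, IsLargestComponent (intersectionGraph S) C ∧ w ∉ C} ≤ δ := by
  have hα := h.α_pos
  have hc₀ := h.c₀_pos
  have hc₁ := h.c₁_pos
  have hc₂ := h.c₂_pos
  obtain ⟨β, hβ, hβα⟩ := exists_between (show 1 < 1 / α by rw [lt_div_iff₀ hα]; linarith [h.α_lt])
  have hαβ : α * β < 1 := by rw [lt_div_iff₀ hα] at hβα; linarith
  obtain ⟨L, hL, hLc⟩ := ((h.eventually_not_reachable_le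
    (show (0 : ℝ) < δ * c₁ / (24 * c₂) by positivity)).and (eventually_ge_atTop c₀)).exists
  have hL0 : 0 < L := hc₀.trans_le hLc
  set q := c₁ * L ^ (-1 - α) with hq
  have hq0 : 0 < q := by positivity
  obtain ⟨M, hM⟩ := h.exists_far_from_maximal_le hβ hαβ (show 0 < δ * q / 12 by positivity)
  have he : 0 < 1 / 2 - Real.exp (-1) := by
    have h1 : Real.exp (-1) < 1 / 2 := by
      have h2 := Real.exp_one_gt_d9
      rw [Real.exp_neg, inv_lt_comm₀ (Real.exp_pos _) (by norm_num)]
      norm_num; linarith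
    linarith
  have hn : Tendsto (fun n : ℕ+ => ((n : ℕ) : ℝ)) atTop atTop :=
    tendsto_natCast_atTop_atTop.comp tendsto_pnat_val
  have hexp : Tendsto (fun n : ℕ+ => Real.exp (-((1 / 2 - Real.exp (-1)) * (((n : ℕ) : ℝ) * q))))
      atTop (𝓝 0) :=
    Real.tendsto_exp_neg_atTop_nhds_zero.comp ((hn.atTop_mul_const hq0).const_mul_atTop he)
  filter_upwards [hL (δ * q / 24) (by positivity), h.eventually_tail_bounds hLc, hM,
    hexp.eventually (ge_mem_nhds (show 0 < δ / 3 by positivity)),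
    hn.eventually_ge_atTop (4 * M / q)] with n hL hν hM hexp hnM
  have hprob := h.prob n
  have hn0 : (0 : ℝ) < (n : ℕ) := by exact_mod_cast n.pos
  set R := Real.sqrt ((m n : ℝ) / (n : ℕ)) with hR
  rw [div_le_iff₀ hq0] at hnM
  have ha : 0 < (n : ℕ) * q / 4 := by positivity
  set E₁ : Fin (n : ℕ) → Set (Fin (n : ℕ) → Finset (Fin (m n))) := fun i =>
    {S | (∀ j ∈ ({i} : Finset _), L * R < ((S j).card : ℝ)) ∧
        ∃ w, IsMaximalVertex S w ∧ ¬ (intersectionGraph S).Reachable i w} with hE₁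
  set E₂ : Fin (n : ℕ) → Set (Fin (n : ℕ) → Finset (Fin (m n))) := fun i =>
    {S | M < componentCard i S ∧ ∃ w, IsMaximalVertex S w ∧
        ¬ (intersectionGraph S).edist i w ≤ (M + climbSteps β n + 2 : ℕ)} with hE₂
  -- More than nq/2 vertices have weight above `L` (bound `h3`), fewer than nq/4 of them are cut off
  -- from a maximal vertex (`h1`), and fewer than nq/4 vertices of components larger than `M` are
  -- (`h2`). As M ≤ nq/4, the counting lemma applies outside of these three events.
  have h1 : (Measure.pi (ν n)).real {S | (n : ℕ) * q / 4 ≤ ({i | S ∈ E₁ i}.ncard : ℝ)} ≤ δ / 3 := by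
    refine (measureReal_le_ncard_le (b := (n : ℕ) * (δ * q / 12)) ha ?_).trans (le_of_eq ?_)
    · calc ∑ i, (Measure.pi (ν n)).real (E₁ i) ≤ ∑ _i : Fin (n : ℕ), (δ * q / 12) := by
            refine Finset.sum_le_sum fun i _ => (hL {i} (by simp) i (by simp)).trans ?_
            rw [Finset.prod_singleton]
            calc _ ≤ δ * c₁ / (24 * c₂) * (c₂ * L ^ (-1 - α)) + δ * q / 24 := by
                  gcongr; exact (hν i).2
              _ = _ := by rw [hq]; field_simp; ring
        _ = _ := by rw [Finset.sum_const, Finset.card_univ, Fintype.card_fin, nsmul_eq_mul]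
    · field_simp; ring
  have h2 : (Measure.pi (ν n)).real {S | (n : ℕ) * q / 4 ≤ ({i | S ∈ E₂ i}.ncard : ℝ)} ≤ δ / 3 := by
    refine (measureReal_le_ncard_le (b := (n : ℕ) * (δ * q / 12)) ha ?_).trans (le_of_eq ?_)
    · calc ∑ i, (Measure.pi (ν n)).real (E₂ i) ≤ ∑ _i : Fin (n : ℕ), (δ * q / 12) :=
            Finset.sum_le_sum fun i _ => ENNReal.toReal_le_of_le_ofReal (by positivity) (hM i)
        _ = _ := by rw [Finset.sum_const, Finset.card_univ, Fintype.card_fin, nsmul_eq_mul]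
    · field_simp; ring
  have h3 : (Measure.pi (ν n)).real
      {S | ({i | S i ∈ {A : Finset (Fin (m n)) | L * R < (A.card : ℝ)}}.ncard : ℝ) ≤
        (n : ℕ) * q / 2} ≤ δ / 3 := by
    have := measureReal_ncard_le_le (ν := ν n) {A : Finset (Fin (m n)) | L * R < (A.card : ℝ)}
      (q := q) fun i => (hν i).1
    rw [Fintype.card_fin] at this
    exact this.trans hexp
  have h4 : δ = δ / 3 + δ / 3 + δ / 3 := by ring
  rw [h4]
  refine le_trans (measureReal_mono fun S hS => ?_) ((measureReal_union_le _ _).trans (add_le_add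
    ((measureReal_union_le _ _).trans (add_le_add h1 h2)) h3))
  obtain ⟨w, hw, C, hC, hwC⟩ := hS
  by_contra hS'
  simp only [mem_union, not_or] at hS'
  obtain ⟨⟨g1, g2⟩, g3⟩ := hS'
  replace g1 : ({i | S ∈ E₁ i}.ncard : ℝ) < (n : ℕ) * q / 4 := lt_of_not_ge g1
  replace g2 : ({i | S ∈ E₂ i}.ncard : ℝ) < (n : ℕ) * q / 4 := lt_of_not_ge g2
  set X : Set (Fin (n : ℕ)) := {i | L * R < ((S i).card : ℝ)} with hX
  have k1 : ({i | i ∈ X ∧ ¬ (intersectionGraph S).Reachable i w}.ncard : ℝ) < (n : ℕ) * q / 4 := by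
    refine lt_of_le_of_lt ?_ g1
    have hsub : {i | i ∈ X ∧ ¬ (intersectionGraph S).Reachable i w} ⊆ {i | S ∈ E₁ i} :=
      fun i hi => ⟨fun j hj => by rw [Finset.mem_singleton.1 hj]; exact hi.1, w, hw, hi.2⟩
    exact_mod_cast Set.ncard_le_ncard hsub
  have k2 : ({i | M < componentCard i S ∧ ¬ (intersectionGraph S).Reachable i w}.ncard : ℝ)
      < (n : ℕ) * q / 4 := by
    refine lt_of_le_of_lt ?_ g2
    have hsub : {i | M < componentCard i S ∧ ¬ (intersectionGraph S).Reachable i w} ⊆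
        {i | S ∈ E₂ i} := fun i hi => ⟨hi.1, w, hw, fun hd => hi.2
      (SimpleGraph.reachable_of_edist_ne_top (hd.trans_lt (ENat.natCast_lt_top _)).ne)⟩
    exact_mod_cast Set.ncard_le_ncard hsub
  have k3 : (n : ℕ) * q / 2 < (X.ncard : ℝ) := lt_of_not_ge g3
  refine hwC (mem_of_isLargestComponent hC (M := M) (X := X) ?_ ?_)
  · have : (M : ℝ) + ({i | i ∈ X ∧ ¬ (intersectionGraph S).Reachable i w}.ncard : ℝ)
        < X.ncard := by linarith
    exact_mod_cast this
  · have : ({i | M < componentCard i S ∧ ¬ (intersectionGraph S).Reachable i w}.ncard : ℝ) +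
        ({i | i ∈ X ∧ ¬ (intersectionGraph S).Reachable i w}.ncard : ℝ) < X.ncard := by linarith
    exact_mod_cast this

/-- The probability that two given vertices are in every largest component is bounded away from
zero. -/
theorem exists_le_mem_largest (h : IsPowerLawSequence α c₀ c₁ c₂ ω m ν) :
    ∃ c : ℝ, 0 < c ∧ ∀ᶠ n : ℕ+ in atTop, ∀ Q : Finset (Fin (n : ℕ)), Q.card ≤ 2 →
      c ≤ (Measure.pi (ν n)).real {S | ∀ v ∈ Q, ∀ C,
        IsLargestComponent (intersectionGraph S) C → v ∈ C} := by
  obtain ⟨c, hc, hreach⟩ := h.exists_le_reachable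
  refine ⟨c / 2, by positivity, ?_⟩
  filter_upwards [hreach, h.eventually_largest_le (half_pos hc)] with n h1 h2 Q hQ
  have hprob := h.prob n
  have : Nonempty (Fin (n : ℕ)) := ⟨⟨0, n.pos⟩⟩
  have h3 : {S : Fin (n : ℕ) → Finset (Fin (m n)) | ∀ v ∈ Q, ∀ w, IsMaximalVertex S w →
        (intersectionGraph S).Reachable v w} ⊆
      {S | ∀ v ∈ Q, ∀ C, IsLargestComponent (intersectionGraph S) C → v ∈ C} ∪
      {S | ∃ w, IsMaximalVertex S w ∧
        ∃ C, IsLargestComponent (intersectionGraph S) C ∧ w ∉ C} := by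
    intro S hS
    by_cases hS' : ∃ w, IsMaximalVertex S w ∧
        ∃ C, IsLargestComponent (intersectionGraph S) C ∧ w ∉ C
    · exact Or.inr hS'
    · push Not at hS'
      refine Or.inl fun v hv C hC => ?_
      obtain ⟨w, hw⟩ := exists_isMaximalVertex S
      have hwC := hS' w hw C hC
      obtain ⟨c, rfl, _⟩ := hC
      rw [SimpleGraph.ConnectedComponent.mem_supp_iff] at hwC ⊢
      rw [← hwC, SimpleGraph.ConnectedComponent.eq]
      exact hS v hv w hw
  have h4 := (h1 Q hQ).trans ((measureReal_mono h3).trans (measureReal_union_le _ _))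
  linarith

end IsPowerLawSequence

end Asymptotics

/-! ### Conditional probabilities and the distance bounds -/

section Main

/-- Conditional probabilities tend to one if the exceptional events are negligible and the
conditions have probabilities that are bounded away from zero. -/
theorem tendsto_cond_one {ι : Type*} {l : Filter ι} {Ω : ι → Type*} [∀ n, MeasurableSpace (Ω n)]
    {μ : ∀ n, Measure (Ω n)} [∀ n, IsProbabilityMeasure (μ n)] {s t : ∀ n, Set (Ω n)}
    (ht : ∀ n, MeasurableSet (t n)) {c : ℝ} (hc : 0 < c)
    (hct : ∀ᶠ n in l, ENNReal.ofReal c ≤ μ n (t n))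
    (hbad : ∀ δ : ℝ, 0 < δ → ∀ᶠ n in l, μ n (t n \ s n) ≤ ENNReal.ofReal δ) :
    Tendsto (fun n => (μ n)[s n | t n]) l (𝓝 1) := by
  refine tendsto_order.2 ⟨fun a ha => ?_, fun a ha => ?_⟩
  · obtain ⟨r, har, hr1⟩ := ENNReal.lt_iff_exists_nnreal_btwn.1 ha
    have hr : (r : ℝ) < 1 := by exact_mod_cast hr1
    -- Division by a condition of probability at least `c` turns this exceptional probability into
    -- at most `1 - r`.
    have hδ : 0 < c * (1 - (r : ℝ)) := mul_pos hc (by linarith)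
    filter_upwards [hct, hbad _ hδ] with n hct hbad
    refine har.trans_le ?_
    have hc0 : ENNReal.ofReal c ≠ 0 := by simpa using hc
    have ht0 : μ n (t n) ≠ 0 := fun h0 => hc0 (by simpa [h0] using hct)
    have h1 : 1 ≤ (μ n)[s n | t n] + ENNReal.ofReal (1 - (r : ℝ)) := by
      rw [cond_apply (ht n)]
      calc (1 : ℝ≥0∞) = (μ n (t n))⁻¹ * μ n (t n) :=
            (ENNReal.inv_mul_cancel ht0 (measure_ne_top _ _)).symm
        _ ≤ (μ n (t n))⁻¹ * (μ n (t n ∩ s n) + μ n (t n \ s n)) := by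
            gcongr
            exact measure_le_inter_add_sdiff _ _ _
        _ = (μ n (t n))⁻¹ * μ n (t n ∩ s n) + (μ n (t n))⁻¹ * μ n (t n \ s n) := mul_add _ _ _
        _ ≤ (μ n (t n))⁻¹ * μ n (t n ∩ s n) +
            (ENNReal.ofReal c)⁻¹ * ENNReal.ofReal (c * (1 - (r : ℝ))) := by gcongr
        _ = _ := by
            rw [ENNReal.ofReal_mul hc.le, ← mul_assoc,
              ENNReal.inv_mul_cancel hc0 ENNReal.ofReal_ne_top, one_mul]
    have h2 : (1 : ℝ≥0∞) = (r : ℝ≥0∞) + ENNReal.ofReal (1 - (r : ℝ)) := by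
      rw [← ENNReal.ofReal_coe_nnreal, ← ENNReal.ofReal_add r.coe_nonneg (by linarith)]
      simp
    rw [h2] at h1
    exact (ENNReal.add_le_add_iff_right ENNReal.ofReal_ne_top).1 h1
  · filter_upwards [hct] with n hct
    have hc0 : ENNReal.ofReal c ≠ 0 := by simpa using hc
    have ht0 : μ n (t n) ≠ 0 := fun h0 => hc0 (by simpa [h0] using hct)
    have := cond_isProbabilityMeasure ht0
    exact prob_le_one.trans_lt ha

/-- Here β = (1/α)^(1/(1+ε/2)) lies just below 1/α, so the climb takes about (1+ε/2) ln ln n /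
ln(1/α) steps. The other ε/2 absorbs M + 2 and the rounding. -/
theorem eventually_steps_le {α ε : ℝ} (hα₀ : 0 < α) (hα₁ : α < 1) (hε : 0 < ε) (M : ℕ) :
    ∀ᶠ n : ℕ in atTop,
      ((M + climbSteps (Real.exp (Real.log (1 / α) / (1 + ε / 2))) n + 2 : ℕ) : ℝ) ≤
        (1 + ε) * (Real.log (1 / α))⁻¹ * Real.log (Real.log (2 + (n : ℝ))) := by
  have hl : 0 < Real.log (1 / α) := Real.log_pos (by rwa [lt_div_iff₀ hα₀, one_mul])
  set l := Real.log (1 / α) with hldef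
  have h0 : Tendsto (fun n : ℕ => Real.log (Real.log n)) atTop atTop :=
    Real.tendsto_log_atTop.comp (Real.tendsto_log_atTop.comp tendsto_natCast_atTop_atTop)
  filter_upwards [h0.eventually_ge_atTop 0,
    (h0.const_mul_atTop (show 0 < ε / 2 * l⁻¹ by positivity)).eventually_ge_atTop (M + 3),
    eventually_ge_atTop 3] with n h1 h2 hn
  have hn1 : (1 : ℝ) < n := by exact_mod_cast (by omega : 1 < n)
  have h3 := (Nat.ceil_lt_add_one (div_nonneg h1 (show 0 ≤ l / (1 + ε / 2) by positivity))).le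
  have h4 : Real.log (Real.log n) ≤ Real.log (Real.log (2 + (n : ℝ))) :=
    Real.log_le_log (Real.log_pos hn1) (Real.log_le_log (by linarith) (by linarith))
  have h5 : Real.log (Real.log n) / (l / (1 + ε / 2)) =
      (1 + ε / 2) * l⁻¹ * Real.log (Real.log n) := by field_simp
  unfold climbSteps
  rw [Real.log_exp]
  push_cast
  rw [h5] at h3 ⊢
  calc _ ≤ (1 + ε / 2) * l⁻¹ * Real.log (Real.log n) + ε / 2 * l⁻¹ * Real.log (Real.log n) := by
        linarith
    _ = (1 + ε) * l⁻¹ * Real.log (Real.log n) := by ring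
    _ ≤ _ := by gcongr

theorem toENNReal_le_ofReal {d : ℕ∞} {k : ℕ} {b : ℝ} (hd : d ≤ k) (hk : (k : ℝ) ≤ b) :
    (d : ℝ≥0∞) ≤ ENNReal.ofReal b := by
  calc (d : ℝ≥0∞) ≤ ((k : ℕ∞) : ℝ≥0∞) := by exact_mod_cast hd
    _ = ENNReal.ofReal k := by simp
    _ ≤ _ := ENNReal.ofReal_le_ofReal hk

theorem lt_normalizedSize_iff {n m : ℕ} (hn : 0 < n) (hm : 0 < m) (t : ℝ) (A : Finset (Fin m)) :
    t < normalizedSize n A ↔ t * Real.sqrt ((m : ℝ) / n) < (A.card : ℝ) := by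
  have hn0 : (0 : ℝ) < n := by exact_mod_cast hn
  have hm0 : (0 : ℝ) < m := by exact_mod_cast hm
  have h1 : 0 < Real.sqrt ((m : ℝ) / n) := Real.sqrt_pos.2 (by positivity)
  have h2 : Real.sqrt ((n : ℝ) / m) = (Real.sqrt ((m : ℝ) / n))⁻¹ := by
    rw [← Real.sqrt_inv, inv_div]
  unfold normalizedSize
  rw [h2, ← div_eq_mul_inv, lt_div_iff₀ h1]

/-! ### The laws of the sets in the random intersection model. -/

section Model

variable {n m : ℕ} {Ω : Type*} [MeasurableSpace Ω] {μ : Measure Ω} {P : Fin n → PMF (Fin (m + 1))}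
  {S : Fin n → Ω → Finset (Fin m)}

theorem IsRandomIntersectionModel.measurable_set [MeasurableSpace (Finset (Fin m))]
    (h : IsRandomIntersectionModel μ P S) (i : Fin n) : Measurable (S i) :=
  measurable_to_countable' fun A => h.measurable i A

theorem IsRandomIntersectionModel.exch [MeasurableSpace (Finset (Fin m))]
    [DiscreteMeasurableSpace (Finset (Fin m))]
    (h : IsRandomIntersectionModel μ P S) (i : Fin n) (A B : Finset (Fin m))
    (hAB : A.card = B.card) : μ.map (S i) {A} = μ.map (S i) {B} := by
  rw [Measure.map_apply (h.measurable_set i) MeasurableSet.of_discrete,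
    Measure.map_apply (h.measurable_set i) MeasurableSet.of_discrete]
  have hA : S i ⁻¹' {A} = {ω | S i ω = A} := rfl
  have hB : S i ⁻¹' {B} = {ω | S i ω = B} := rfl
  have e : (⟨A.card, card_lt_succ_of_finset_fin A⟩ : Fin (m + 1)) =
      ⟨B.card, card_lt_succ_of_finset_fin B⟩ := Fin.ext hAB
  rw [hA, hB, h.law i A, h.law i B, e, hAB]

theorem IsRandomIntersectionModel.isPowerLaw [IsProbabilityMeasure μ]
    [MeasurableSpace (Finset (Fin m))] [DiscreteMeasurableSpace (Finset (Fin m))]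
    (h : IsRandomIntersectionModel μ P S) (hn : 0 < n) (hm : 0 < m) {α c₀ c₁ c₂ T : ℝ} {i : Fin n}
    (hT : ∀ t ∈ Icc c₀ T, c₁ * t ^ (-1 - α) ≤ μ.real {x | t < normalizedSize n (S i x)} ∧
      μ.real {x | t < normalizedSize n (S i x)} ≤ c₂ * t ^ (-1 - α)) :
    IsPowerLaw α c₀ c₁ c₂ T (Real.sqrt ((m : ℝ) / n)) (μ.map (S i)) := by
  have e : ∀ t, (μ.map (S i)).real {A | t * Real.sqrt ((m : ℝ) / n) < (A.card : ℝ)} =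
      μ.real {x | t < normalizedSize n (S i x)} := by
    intro t
    rw [map_measureReal_apply (h.measurable_set i) MeasurableSet.of_discrete]
    congr 1; ext x
    exact (lt_normalizedSize_iff hn hm t _).symm
  exact ⟨Measure.isProbabilityMeasure_map (h.measurable_set i).aemeasurable, h.exch i,
    fun t ht => (e t).symm ▸ (hT t ht).1, fun t ht => (e t).symm ▸ (hT t ht).2⟩

end Model

end Main

theorem theorem1
    (α c₀ c₁ c₂ : ℝ) (hα₀ : 0 < α) (hα₁ : α < 1) (hc₀ : 0 < c₀) (hc₁ : 0 < c₁) (hc₂ : 0 < c₂)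
    (ω : ℕ+ → ℝ) (hω_pos : ∀ n, 0 < ω n) (hω : Tendsto ω atTop atTop)
    (m : ℕ+ → ℕ)
    (P : ∀ n : ℕ+, Fin (n : ℕ) → PMF (Fin (m n + 1)))
    (Ω : ℕ+ → Type*) [∀ n, MeasurableSpace (Ω n)]
    (μ : ∀ n, Measure (Ω n)) [∀ n, IsProbabilityMeasure (μ n)]
    (S : ∀ n : ℕ+, Fin (n : ℕ) → Ω n → Finset (Fin (m n)))
    (hS : ∀ n, IsRandomIntersectionModel (μ n) (P n) (S n))
    (h_i : (fun n : ℕ+ => ((n : ℕ) : ℝ) * Real.log ((n : ℕ) : ℝ) ^ 2)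
      =o[atTop] (fun n : ℕ+ => (m n : ℝ)))
    (h_ii : ∃ n₀ : ℕ, ∀ n : ℕ+, n₀ < (n : ℕ) →
      ∀ t ∈ Set.Icc c₀ (((n : ℕ) : ℝ) ^ (1 / (1 + α)) * ω n), ∀ i : Fin (n : ℕ),
        c₁ * t ^ (-1 - α) ≤ (μ n).real {x | t < normalizedSize (n : ℕ) (S n i x)} ∧
        (μ n).real {x | t < normalizedSize (n : ℕ) (S n i x)} ≤ c₂ * t ^ (-1 - α)) :
    (∀ u : ∀ n : ℕ+, Ω n → Fin (n : ℕ), (∀ n : ℕ+, Measurable (u n)) →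
      (∀ (n : ℕ+) (x : Ω n), IsMaximalVertex (fun i => S n i x) (u n x)) →
      ∀ ε : ℝ, 0 < ε →
        Tendsto (fun n : ℕ+ =>
          (μ n)[{x | (((intersectionGraph fun i => S n i x).edist 0 (u n x) : ℕ∞) : ℝ≥0∞) ≤
                  ENNReal.ofReal ((1 + ε) * (Real.log (1 / α))⁻¹ *
                    Real.log (Real.log (2 + ((n : ℕ) : ℝ))))} |
                {x | (intersectionGraph fun i => S n i x).edist 0 (u n x) < ⊤}])
          atTop (𝓝 1)) ∧
    (∀ C : ∀ n : ℕ+, Ω n → Set (Fin (n : ℕ)),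
      (∀ (n : ℕ+) (v : Fin (n : ℕ)), MeasurableSet {x | v ∈ C n x}) →
      (∀ (n : ℕ+) (x : Ω n), IsLargestComponent (intersectionGraph fun i => S n i x) (C n x)) →
      ∀ ε : ℝ, 0 < ε →
        Tendsto (fun n : ℕ+ =>
          (μ n)[{x | (((intersectionGraph fun i => S n i x).edist 0 1 : ℕ∞) : ℝ≥0∞) ≤
                  ENNReal.ofReal ((2 + ε) * (Real.log (1 / α))⁻¹ *
                    Real.log (Real.log (2 + ((n : ℕ) : ℝ))))} |
                {x | (0 : Fin (n : ℕ)) ∈ C n x ∧ (1 : Fin (n : ℕ)) ∈ C n x}])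
          atTop (𝓝 1)) := by
  let inst : ∀ n, MeasurableSpace (Finset (Fin (m n))) := fun _ => ⊤
  have hdisc : ∀ n, DiscreteMeasurableSpace (Finset (Fin (m n))) := fun _ => ⟨fun _ => trivial⟩
  set ν : ∀ n : ℕ+, Fin (n : ℕ) → Measure (Finset (Fin (m n))) :=
    fun n i => (μ n).map (S n i) with hν
  have hmeas : ∀ n, Measurable fun x i => S n i x :=
    fun n => measurable_pi_lambda _ fun i => (hS n).measurable_set i
  have hpi : ∀ (n : ℕ+) (E : Set (Fin (n : ℕ) → Finset (Fin (m n)))),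
      μ n {x | (fun i => S n i x) ∈ E} = Measure.pi (ν n) E := by
    intro n E
    have h1 := (iIndepFun_iff_map_fun_eq_pi_map
      (fun i => ((hS n).measurable_set i).aemeasurable)).1 (hS n).indep
    rw [hν, ← h1, Measure.map_apply (hmeas n) MeasurableSet.of_discrete]
    rfl
  have hprob : ∀ n i, IsProbabilityMeasure (ν n i) := fun n i =>
    Measure.isProbabilityMeasure_map ((hS n).measurable_set i).aemeasurable
  -- This gives R ≥ 1: rounding a size to an integer then costs at most a constant factor.
  have hle : ∀ᶠ n : ℕ+ in atTop, (n : ℕ) ≤ m n := by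
    filter_upwards [h_i.def one_pos, tendsto_pnat_val.eventually_ge_atTop 3] with n hn hn3
    have h1 : (1 : ℝ) ≤ Real.log ((n : ℕ) : ℝ) := by
      rw [Real.le_log_iff_exp_le (by exact_mod_cast n.pos)]
      have h2 : (3 : ℝ) ≤ (n : ℕ) := by exact_mod_cast hn3
      linarith [Real.exp_one_lt_d9]
    rw [one_mul, Real.norm_natCast, Real.norm_of_nonneg (by positivity)] at hn
    have h3 : ((n : ℕ) : ℝ) ≤ m n := by
      refine le_trans ?_ hn
      exact le_mul_of_one_le_right (by positivity) (one_le_pow₀ h1)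
    exact_mod_cast h3
  have hseq : IsPowerLawSequence α c₀ c₁ c₂ ω m ν := by
    refine ⟨hα₀, hα₁, hc₀, hc₁, hc₂, hω, hle, hprob, ?_⟩
    obtain ⟨n₀, h_ii⟩ := h_ii
    filter_upwards [hle, tendsto_pnat_val.eventually_gt_atTop n₀] with n hnm hn i
    exact (hS n).isPowerLaw n.pos (n.pos.trans_le hnm) fun t ht => h_ii n hn t ht i
  have hexp : ∀ ε : ℝ, 0 < ε → 1 < Real.exp (Real.log (1 / α) / (1 + ε / 2)) ∧
      α * Real.exp (Real.log (1 / α) / (1 + ε / 2)) < 1 := by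
    intro ε hε
    have hl : 0 < Real.log (1 / α) := Real.log_pos (by rwa [lt_div_iff₀ hα₀, one_mul])
    refine ⟨Real.one_lt_exp_iff.2 (by positivity), ?_⟩
    have h1 : Real.log (1 / α) / (1 + ε / 2) < Real.log (1 / α) :=
      div_lt_self hl (by linarith)
    have h2 := Real.exp_lt_exp.2 h1
    rw [Real.exp_log (by positivity), lt_div_iff₀ hα₀] at h2
    linarith
  have hcast : ∀ (n : ℕ+) (c : ℝ) (E : Set (Fin (n : ℕ) → Finset (Fin (m n)))),
      c ≤ (Measure.pi (ν n)).real E → ENNReal.ofReal c ≤ Measure.pi (ν n) E := by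
    intro n c E h
    exact (ENNReal.ofReal_le_iff_le_toReal (measure_ne_top _ _)).2 h
  constructor
  · intro u hu hmax ε hε
    obtain ⟨hβ, hαβ⟩ := hexp ε hε
    set β := Real.exp (Real.log (1 / α) / (1 + ε / 2)) with hβdef
    obtain ⟨c, hc, hreach⟩ := hseq.exists_le_reachable
    refine tendsto_cond_one (fun n => ?_) hc ?_ fun δ hδ => ?_
    · have h1 : Measurable fun x => (u n x, fun i => S n i x) := (hu n).prodMk (hmeas n)
      exact h1 (t := {p | (intersectionGraph p.2).edist 0 p.1 < ⊤}) MeasurableSet.of_discrete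
    · filter_upwards [hreach] with n hn
      refine (hcast n _ _ (hn {0} (by simp))).trans ?_
      rw [← hpi]
      refine measure_mono fun x hx => ?_
      have h1 := hx 0 (Finset.mem_singleton_self _) (u n x) (hmax n x)
      exact lt_top_iff_ne_top.2 (SimpleGraph.edist_ne_top_iff_reachable.2 h1)
    · obtain ⟨M, hM⟩ := hseq.exists_far_from_maximal_le hβ hαβ hδ
      filter_upwards [hM, tendsto_pnat_val.eventually (eventually_steps_le hα₀ hα₁ hε M)]
        with n hM hsteps
      refine le_trans ?_ (hM 0)
      rw [← hpi]
      refine measure_mono fun x hx => ?_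
      have hfar : ¬ (intersectionGraph fun i => S n i x).edist 0 (u n x) ≤
          (M + climbSteps β n + 2 : ℕ) := fun hd => hx.2 (toENNReal_le_ofReal hd hsteps)
      refine ⟨?_, u n x, hmax n x, hfar⟩
      -- In a component with at most `M` vertices every distance is at most `M`, so a violation of
      -- the bound forces a larger component.
      by_contra hsmall
      refine hfar ((edist_le_componentCard
        (SimpleGraph.reachable_of_edist_ne_top (LT.lt.ne hx.1))).trans ?_)
      exact_mod_cast (not_lt.1 hsmall).trans (by omega)
  · intro C hCmeas hC ε hε
    have hε2 : 0 < ε / 2 := half_pos hε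
    -- With ε/2 in place of ε, the two legs through a maximal vertex have total factor 2(1 + ε/2) =
    -- 2 + ε.
    obtain ⟨hβ, hαβ⟩ := hexp (ε / 2) hε2
    set β := Real.exp (Real.log (1 / α) / (1 + ε / 2 / 2)) with hβdef
    obtain ⟨c, hc, hlarge⟩ := hseq.exists_le_mem_largest
    refine tendsto_cond_one (fun n => (hCmeas n 0).inter (hCmeas n 1)) hc ?_ fun δ hδ => ?_
    · filter_upwards [hlarge] with n hn
      refine (hcast n _ _ (hn {0, 1} Finset.card_le_two)).trans ?_
      rw [← hpi]
      refine measure_mono fun x hx => ⟨?_, ?_⟩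
      · exact hx 0 (by simp) _ (hC n x)
      · exact hx 1 (by simp) _ (hC n x)
    · obtain ⟨M, hM⟩ := hseq.exists_far_from_maximal_le hβ hαβ (half_pos hδ)
      filter_upwards [hM, tendsto_pnat_val.eventually (eventually_steps_le hα₀ hα₁ hε2 M)]
        with n hM hsteps
      have : Nonempty (Fin (n : ℕ)) := ⟨0⟩
      have hδ2 : ENNReal.ofReal δ = ENNReal.ofReal (δ / 2) + ENNReal.ofReal (δ / 2) := by
        rw [← ENNReal.ofReal_add (by positivity) (by positivity), add_halves]
      rw [hδ2]
      refine le_trans ?_ (add_le_add (hM 0) (hM 1))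
      refine le_trans ?_ (measure_union_le _ _)
      rw [← hpi]
      refine measure_mono fun x hx => ?_
      have hfar : ¬ (intersectionGraph fun i => S n i x).edist 0 1 ≤
          ((M + climbSteps β n + 2) + (M + climbSteps β n + 2) : ℕ) := fun hd => by
        refine hx.2 (toENNReal_le_ofReal hd ?_)
        push_cast at hsteps ⊢
        linarith
      have hreach : (intersectionGraph fun i => S n i x).Reachable 0 1 := by
        obtain ⟨h0, h1⟩ := hx.1
        obtain ⟨c, hc, _⟩ := hC n x
        rw [← hc, SimpleGraph.ConnectedComponent.mem_supp_iff] at h0 h1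
        exact SimpleGraph.ConnectedComponent.eq.1 (h0.trans h1.symm)
      have hbig : M < componentCard 0 fun i => S n i x := by
        by_contra hsmall
        refine hfar ((edist_le_componentCard hreach).trans ?_)
        exact_mod_cast (not_lt.1 hsmall).trans (by omega)
      -- If vertices 0 and 1 are too far apart, at least one of them is far from `w`, by the
      -- triangle inequality; both lie in the same large component.
      obtain ⟨w, hw⟩ := exists_isMaximalVertex fun i => S n i x
      by_cases h0 : (intersectionGraph fun i => S n i x).edist 0 w ≤ (M + climbSteps β n + 2 : ℕ)
      · refine Or.inr ⟨componentCard_eq hreach ▸ hbig, w, hw, fun h1 => hfar ?_⟩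
        refine (SimpleGraph.edist_triangle (v := w)).trans ?_
        rw [Nat.cast_add]
        exact add_le_add h0 (SimpleGraph.edist_comm.trans_le h1)
      · exact Or.inl ⟨hbig, w, hw, h0⟩
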